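/- **Setting.** Let $p,q\ge 0$, $n=p+q\ge 1$, $m\ge n$, and let $Q=\{(\mathbf u,\mathbf x)\in\mathbb Q^p\times\mathbb Q^q \mid \mathbf A(\mathbf u,\mathbf x)\le \mathbf c\}$ be full-dimensional, with $\mathbf A=[A,B]\in\mathbb Q^{m\times n}$ and $\mathbf c\in\mathbb Q^m$, the first $n$ rows of $\mathbf A$ and the first $q$ rows of $B$ being linearly independent (so $Q$ is pointed). For a matrix $D$ with $m$ rows and $k\le m$ columns put $D_0=[D,\mathbf e_{k+1},\dots,\mathbf e_m]$. The *redundancy test cone* $\mathcal P_{\mathbf u}(Q)\subseteq\mathbb Q^{q}\times\mathbb Q$ is the projection onto $(\mathbf v,v_0)$ of the set of all $(\mathbf v,\mathbf w,v_0)\in\mathbb Q^q\times\mathbb Q^{m-q}\times\mathbb Q$ with $[\mathbf v^t,\mathbf w^t]B_0^{-1}A=0$, $[\mathbf v^t,\mathbf w^t]B_0^{-1}\ge 0$ and $-[\mathbf v^t,\mathbf w^t]B_0^{-1}\mathbf c+v_0\ge 0$. For $p=0$ it is the *initial* redundancy test cone, the projection onto $(\mathbf v,v_0)\in\mathbb Q^n\times\mathbb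 Q$ of $W=\{(\mathbf v,\mathbf w,v_0)\mid [\mathbf v^t,\mathbf w^t]\mathbf A_0^{-1}\ge 0,\ -[\mathbf v^t,\mathbf w^t]\mathbf A_0^{-1}\mathbf c+v_0\ge 0\}$. Write $W$ as $\{x\mid Lx\ge 0\}$. Let $M$ be a coefficient matrix of the initial redundancy test cone obtained by block elimination: for each extreme ray $y$ (one per class up to positive multiples) of the projection cone $\{y\ge 0\mid y^tL \text{ vanishes on the columns of } \mathbf w\}$, $M$ has one row, a positive multiple of the $(\mathbf v,v_0)$-part of $-y^tL$. Let $M_{\mathbf u}$, with $q+1$ columns, be $M$ without the columns of the $p$ eliminated variables. **Algorithm (redundancy test).** On input a rational matrix $N$ with $q+1$ columns and $s=(\mathbf a,c)\in\mathbb Q^{q}\times\mathbb Q$, return *false* if the rows of $N$ with index in $\zeta=\{i\mid (Ns)_i=0\}$ have rank $q$, and *true* otherwise. **Cost model.** Programs are random access programs on integer registers (finite programs with sequencing, branching, loops and indirect addressing); rationals are given as numerator and denominator. An operation $+,-,\times$, quotient or remainder on integers $|a|,|b|<2^k$ is charged the number of bit operations (binary Boolean gates) that it requires, and every instruction is charged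 one plus the bit lengths of the numbers and computed addresses that it handles. $\theta$ is the infimum of the $\tau>0$ such that $n\times n$ matrices can be multiplied with $O(n^\tau)$ arithmetic operations. The height of $a/b$ in lowest terms is $\log\max(|a|,|b|)$. **Lemma.** 1. If $\{x\mid Nx\le 0\}\subseteq\mathbb Q^{q+1}$ is pointed and contains $s$, then the algorithm returns *false* if and only if $s$ is an extreme ray of this cone (a nonzero vector on a one-dimensional face). 2. The algorithm is performed, on all inputs $(N,s)$, by one program with the following properties. Let $Q,M,M_{\mathbf u}$ be as above, let $s=(\mathbf a,c)\in\mathbb Q^q\times\mathbb Q$, let $\varepsilon>0$ and $K$ be real, and let $h\ge 1$ bound the heights of all entries of $\mathbf A$ and $\mathbf c$. Suppose that the rows of $M$ are primitive integer vectors or, more generally, that the entries of $M$ have height at most $Kn^{2+\varepsilon}h$. * If $(\mathbf a,c)\in\mathcal P_{\mathbf u}(Q)$, then on input $(M_{\mathbf u},s)$ the answer is *false* if and only if $(\mathbf a,c)$ is an extreme ray of $\mathcal P_{\mathbf u}(Q)$. * If the entries of $s$ have height at most $Kn^{2+\varepsilon}h$, then on input $(M_{\mathbf u},s)$ the program halts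 within $$C\, m^{\frac n2}\, n^{\theta+\varepsilon}\, h^{1+\varepsilon}$$ bit operations, where $C$ depends only on $\varepsilon$ and $K$. -/

import Mathlib

open Matrix

/-! ## Polyhedra, polyhedral cones, extreme rays -/

/-- The height of a rational number `a / b` in lowest terms: `log (max |a| |b|)`. -/
noncomputable def ratHeight (x : ℚ) : ℝ :=
  Real.log (max x.num.natAbs x.den : ℕ)

/-- The polyhedron `{y | A y ≤ c}`. -/
def polyhedron {m n : ℕ} (A : Matrix (Fin m) (Fin n) ℚ) (c : Fin m → ℚ) : Set (Fin n → ℚ) :=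
  {y | ∀ i, (A *ᵥ y) i ≤ c i}

/-- Full-dimensionality in the ambient space. -/
def FullDimensional {n : ℕ} (Q : Set (Fin n → ℚ)) : Prop :=
  affineSpan ℚ Q = ⊤

/-- `F` is a face of the polyhedral cone `C`: for some representation of `C` by finitely many
homogeneous inequalities, `F` is obtained by turning some of them into equations. -/
def IsFace {ι : Type*} [Fintype ι] (C F : Set (ι → ℚ)) : Prop :=
  ∃ (d : ℕ) (M : Matrix (Fin d) ι ℚ) (S : Set (Fin d)),
    C = {x | ∀ i, (M *ᵥ x) i ≤ 0} ∧ F = {x ∈ C | ∀ i ∈ S, (M *ᵥ x) i = 0}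

/-- `r` is (a nonzero vector on) an extreme ray of the pointed polyhedral cone `C`, that is, it
lies on a face of dimension one; the dimension of a cone is the maximal number of linearly
independent vectors in it. -/
def IsExtremeRay {ι : Type*} [Fintype ι] (C : Set (ι → ℚ)) (r : ι → ℚ) : Prop :=
  r ≠ 0 ∧ ∃ F, IsFace C F ∧ r ∈ F ∧ Module.finrank ℚ (Submodule.span ℚ F) = 1

/-! ## Redundancy test cones -/

/-- For `B` with `m` rows and `k ≤ m` columns, the square matrix `B₀ = [B, e_{k+1}, …, e_m]`. -/
def extMatrix {m k : ℕ} (B : Matrix (Fin m) (Fin k) ℚ) : Matrix (Fin m) (Fin m) ℚ :=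
  Matrix.of fun i j => if h : j.1 < k then B i ⟨j.1, h⟩ else if i = j then 1 else 0

/-- The redundancy test cone of `{(u, x) | A u + B x ≤ c}` with respect to `u`: the projection onto
`(v, v₀)` of the cone `W⁰` of all `(v, w, v₀)` with `[v, w] B₀⁻¹ A = 0`, `[v, w] B₀⁻¹ ≥ 0` and
`-[v, w] B₀⁻¹ c + v₀ ≥ 0`. Below `z` is the concatenation `[v, w]`; a vector `(v, v₀)` is indexed by
`Fin q ⊕ Unit`, with `v₀` at `inr ()`. -/
def testCone {m p q : ℕ} (hq : q ≤ m) (A : Matrix (Fin m) (Fin p) ℚ)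
    (B : Matrix (Fin m) (Fin q) ℚ) (c : Fin m → ℚ) : Set (Fin q ⊕ Unit → ℚ) :=
  {x | ∃ z : Fin m → ℚ, (∀ j : Fin q, z (Fin.castLE hq j) = x (Sum.inl j)) ∧
    (z ᵥ* (extMatrix B)⁻¹) ᵥ* A = 0 ∧
    (∀ i, 0 ≤ (z ᵥ* (extMatrix B)⁻¹) i) ∧
    0 ≤ -((z ᵥ* (extMatrix B)⁻¹) ⬝ᵥ c) + x (Sum.inr ())}

/-- Coefficients of the `m + 1` inequalities that define the cone `W` for the initial redundancy
test cone: `W = {(v, w, v₀) | [v, w] A₀⁻¹ ≥ 0, -[v, w] A₀⁻¹ c + v₀ ≥ 0}` is `{x | L x ≥ 0}`. -/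
noncomputable def liftedRows {m n : ℕ} (A : Matrix (Fin m) (Fin n) ℚ) (c : Fin m → ℚ) :
    Matrix (Fin m ⊕ Unit) (Fin m ⊕ Unit) ℚ :=
  Matrix.fromBlocks ((extMatrix A)⁻¹)ᵀ 0
    (Matrix.of fun _ j => -((extMatrix A)⁻¹ *ᵥ c) j) 1

/-- The projection cone of `W` with respect to `w`: the nonnegative vectors `y` for which
`yᵗ L` vanishes on the columns of `w`, which are the columns of index `n ≤ j < m`. -/
def projectionCone {m n : ℕ} (A : Matrix (Fin m) (Fin n) ℚ) (c : Fin m → ℚ) :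
    Set (Fin m ⊕ Unit → ℚ) :=
  {y | (∀ i, 0 ≤ y i) ∧ ∀ j : Fin m, n ≤ j.1 → (y ᵥ* liftedRows A c) (Sum.inl j) = 0}

/-- The inequality `-(yᵗ L) (v, v₀) ≤ 0` contributed by `y` in block elimination. -/
noncomputable def eliminationRow {m n : ℕ} (hn : n ≤ m) (A : Matrix (Fin m) (Fin n) ℚ)
    (c : Fin m → ℚ) (y : Fin m ⊕ Unit → ℚ) : Fin n ⊕ Unit → ℚ :=
  fun j => -(y ᵥ* liftedRows A c) (Sum.map (Fin.castLE hn) id j)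

/-- `M` is a coefficient matrix of the initial redundancy test cone of `{y | A y ≤ c}` as computed
by block elimination: one row, up to a positive factor, for each extreme ray of the projection
cone. -/
def IsInitialTestMatrix {m n d : ℕ} (hn : n ≤ m) (A : Matrix (Fin m) (Fin n) ℚ)
    (c : Fin m → ℚ) (M : Matrix (Fin d) (Fin n ⊕ Unit) ℚ) : Prop :=
  ∃ Y : Fin d → Fin m ⊕ Unit → ℚ,
    (∀ i, IsExtremeRay (projectionCone A c) (Y i)) ∧
    (∀ y, IsExtremeRay (projectionCone A c) y → ∃! i, ∃ t : ℚ, 0 < t ∧ y = t • Y i) ∧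
    ∀ i, ∃ t : ℚ, 0 < t ∧ M i = t • eliminationRow hn A c (Y i)

/-- A row with coprime integer entries. -/
def IsPrimitiveRow {ι : Type*} [Fintype ι] (r : ι → ℚ) : Prop :=
  ∃ z : ι → ℤ, (∀ j, r j = z j) ∧ Finset.univ.gcd z = 1

/-- Setting the first `p` of the variables `v` to zero: drop their columns. -/
def dropColumns {d : ℕ} (p q : ℕ) (M : Matrix (Fin d) (Fin (p + q) ⊕ Unit) ℚ) :
    Matrix (Fin d) (Fin q ⊕ Unit) ℚ :=
  M.submatrix id (Sum.map (Fin.natAdd p) id)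

open Classical in
/-- The redundancy test: `false` if the rows of `M` in the zero set of `M s` have rank `q`, the
number of variables, and `true` otherwise. -/
noncomputable def redundancyTest {d q : ℕ} (M : Matrix (Fin d) (Fin q ⊕ Unit) ℚ)
    (s : Fin q ⊕ Unit → ℚ) : Bool :=
  if (M.submatrix (Subtype.val : {i // (M *ᵥ s) i = 0} → Fin d) id).rank = q then false else true

/-! ## Straight-line programs -/

/-- A gate: an operation symbol and two operands, each an earlier wire or a constant. -/
structure Gate (σ α : Type) where
  op : σ
  lhs : ℕ ⊕ α
  rhs : ℕ ⊕ α

def operandVal {α : Type} [Inhabited α] (w : List α) : ℕ ⊕ α → α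
  | Sum.inl i => w.getD i default
  | Sum.inr a => a

/-- The list of all wire values: the inputs followed by the value of every gate. -/
def runGates {σ α : Type} [Inhabited α] (ev : σ → α → α → α) (x : List α)
    (G : List (Gate σ α)) : List α :=
  G.foldl (fun w g => w ++ [ev g.op (operandVal w g.lhs) (operandVal w g.rhs)]) x

/-- The ring operations. -/
inductive RingOp
  | add | sub | mul

def RingOp.eval : RingOp → ℚ → ℚ → ℚ
  | .add, a, b => a + b
  | .sub, a, b => a - b
  | .mul, a, b => a * b

/-- Number of arithmetic operations required to multiply an `a × b` by a `b × c` matrix. -/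
noncomputable def matMulCost (a b c : ℕ) : ℕ :=
  sInf {N | ∃ (G : List (Gate RingOp ℚ)) (out : Fin a → Fin c → ℕ ⊕ ℚ), G.length = N ∧
    ∀ (X : Matrix (Fin a) (Fin b) ℚ) (Y : Matrix (Fin b) (Fin c) ℚ) (i : Fin a) (j : Fin c),
      operandVal (runGates RingOp.eval
        ((List.ofFn fun i => List.ofFn (X i)).flatten ++
          (List.ofFn fun i => List.ofFn (Y i)).flatten) G) (out i j) = (X * Y) i j}

/-- The exponent of linear algebra: the infimum of all `τ > 0` for which `n × n` matrices can be
multiplied with `O(n ^ τ)` arithmetic operations. -/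
noncomputable def linAlgExponent : ℝ :=
  sInf {τ : ℝ | 0 < τ ∧ ∃ C : ℝ, ∀ n : ℕ, (matMulCost n n n : ℝ) ≤ C * (n : ℝ) ^ τ}

/-! ## Integer random access programs and their bit cost -/

/-- The basic integer operations. -/
inductive IntOp
  | add | sub | mul | quo | rem

def IntOp.eval : IntOp → ℤ → ℤ → ℤ
  | .add, a, b => a + b
  | .sub, a, b => a - b
  | .mul, a, b => a * b
  | .quo, a, b => a / b
  | .rem, a, b => a % b

/-- The lowest `w` bits of an integer in two's complement. -/
def intBits (w : ℕ) (a : ℤ) : List Bool :=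
  List.ofFn fun i : Fin w => a.testBit i

/-- Number of bit operations (binary Boolean gates) required to perform `op` on integers of
absolute value less than `2 ^ k`. -/
noncomputable def opCost (op : IntOp) (k : ℕ) : ℕ :=
  sInf {N | ∃ (G : List (Gate (Bool → Bool → Bool) Bool)) (out : ℕ → ℕ ⊕ Bool), G.length = N ∧
    ∀ a b : ℤ, a.natAbs < 2 ^ k → b.natAbs < 2 ^ k → ∀ j < 2 * k + 2,
      operandVal (runGates id (intBits (k + 1) a ++ intBits (k + 1) b) G) (out j) =
        (op.eval a b).testBit j}

/-- Bit length of the absolute value. -/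
def bitLen (a : ℤ) : ℕ := a.natAbs.size

/-- Structured random access programs. `R` is an infinite array of integer registers and `inp` a
read-only array of integers. -/
inductive Cmd
  /-- do nothing -/
  | skip
  /-- `R[r] := z` -/
  | const (r : ℕ) (z : ℤ)
  /-- `R[r] := op R[a] R[b]` -/
  | arith (op : IntOp) (r a b : ℕ)
  /-- `R[r] := inp[R[a]]` -/
  | read (r a : ℕ)
  /-- `R[r] := R[R[a]]` -/
  | load (r a : ℕ)
  /-- `R[R[a]] := R[r]` -/
  | store (a r : ℕ)
  /-- sequential composition -/
  | seq (c₁ c₂ : Cmd)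
  /-- if `R[a] ≠ 0` then `c₁` else `c₂` -/
  | ite (a : ℕ) (c₁ c₂ : Cmd)
  /-- while `R[a] ≠ 0` do `c` -/
  | loop (a : ℕ) (c : Cmd)

/-- `Runs inp c R t R'`: on the input array `inp`, the program `c` started with registers `R` halts
with registers `R'` after `t` bit operations. An arithmetic instruction is charged the number of bit
operations its operands require, and every instruction one plus the bit lengths of the numbers and
the computed addresses that it handles. -/
inductive Runs (inp : ℕ → ℤ) : Cmd → (ℕ → ℤ) → ℕ → (ℕ → ℤ) → Prop
  | skip (R : ℕ → ℤ) : Runs inp .skip R 1 R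
  | const (R : ℕ → ℤ) (r : ℕ) (z : ℤ) :
      Runs inp (.const r z) R (1 + bitLen z) (Function.update R r z)
  | arith (R : ℕ → ℤ) (op : IntOp) (r a b : ℕ) :
      Runs inp (.arith op r a b) R
        (1 + bitLen (R a) + bitLen (R b) + opCost op (max (bitLen (R a)) (bitLen (R b))))
        (Function.update R r (op.eval (R a) (R b)))
  | read (R : ℕ → ℤ) (r a : ℕ) :
      Runs inp (.read r a) R (1 + bitLen (R a) + bitLen (inp (R a).toNat))
        (Function.update R r (inp (R a).toNat))
  | load (R : ℕ → ℤ) (r a : ℕ) :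
      Runs inp (.load r a) R (1 + bitLen (R a) + bitLen (R (R a).toNat))
        (Function.update R r (R (R a).toNat))
  | store (R : ℕ → ℤ) (a r : ℕ) :
      Runs inp (.store a r) R (1 + bitLen (R a) + bitLen (R r))
        (Function.update R (R a).toNat (R r))
  | seq {R₁ R₂ R₃ : ℕ → ℤ} {t₁ t₂ : ℕ} {c₁ c₂ : Cmd} :
      Runs inp c₁ R₁ t₁ R₂ → Runs inp c₂ R₂ t₂ R₃ → Runs inp (.seq c₁ c₂) R₁ (t₁ + t₂) R₃
  | ite_ne {R R' : ℕ → ℤ} {t a : ℕ} {c₁ c₂ : Cmd} :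
      R a ≠ 0 → Runs inp c₁ R t R' → Runs inp (.ite a c₁ c₂) R (1 + bitLen (R a) + t) R'
  | ite_eq {R R' : ℕ → ℤ} {t a : ℕ} {c₁ c₂ : Cmd} :
      R a = 0 → Runs inp c₂ R t R' → Runs inp (.ite a c₁ c₂) R (1 + bitLen (R a) + t) R'
  | loop_ne {R₁ R₂ R₃ : ℕ → ℤ} {t₁ t₂ a : ℕ} {c : Cmd} :
      R₁ a ≠ 0 → Runs inp c R₁ t₁ R₂ → Runs inp (.loop a c) R₂ t₂ R₃ →
        Runs inp (.loop a c) R₁ (1 + bitLen (R₁ a) + t₁ + t₂) R₃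
  | loop_eq {R : ℕ → ℤ} {a : ℕ} {c : Cmd} :
      R a = 0 → Runs inp (.loop a c) R (1 + bitLen (R a)) R

/-- A vector of rationals as a list of numerators and denominators. -/
def encodeRow {q : ℕ} (r : Fin q ⊕ Unit → ℚ) : List ℤ :=
  (List.ofFn fun j : Fin q => [(r (Sum.inl j)).num, ((r (Sum.inl j)).den : ℤ)]).flatten ++
    [(r (Sum.inr ())).num, ((r (Sum.inr ())).den : ℤ)]

/-- The input array for the redundancy test: number of rows, number of variables, the vector
`s = (a, c)`, and the rows of `M`. -/
def encodeInput {d q : ℕ} (M : Matrix (Fin d) (Fin q ⊕ Unit) ℚ) (s : Fin q ⊕ Unit → ℚ) : ℕ → ℤ :=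
  fun i => ([(d : ℤ), (q : ℤ)] ++ encodeRow s ++
    (List.ofFn fun i => encodeRow (M i)).flatten).getD i 0

/-- On the input array `inp`, the program halts after `t` bit operations with answer `b` in
register `0`; all registers are `0` at the start. -/
def Outputs (c : Cmd) (inp : ℕ → ℤ) (b : Bool) (t : ℕ) : Prop :=
  ∃ R : ℕ → ℤ, Runs inp c (fun _ => 0) t R ∧ R 0 = if b then 1 else 0

/-!
**Correctness.** A vector of a pointed cone `{x | M x ≤ 0}` in `q + 1` variables is an extreme ray
if and only if it is nonzero and the rows that vanish on it have a kernel of dimension one, that is,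
rank `q` (`isExtremeRay_ineqCone_iff`, `redundancyTest_eq_false_iff`). On the zero vector all rows
vanish, and they have rank `q + 1`.

For a test matrix it remains to be shown that `M_u` describes the redundancy test cone and that this
cone is pointed. In the coordinates `l = [v, w] B₀⁻¹` the cone consists of the inequalities
`l B x ≤ v₀` that are derived from the system by nonnegative multipliers `l` with `l A = 0`
(`mem_testCone_iff`). In the same way, the projection cone is the image of the homogenized cone
`A x + u c ≤ 0, u ≤ 0` under an injective linear map, and the rows of an initial test matrix are the
extreme rays of the homogenized cone, one for each class
(`isExtremeRay_projectionCone_iff`, `IsInitialTestMatrix.rows`). As a pointed cone is generated by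
its extreme rays (`exists_isExtremeRay_pos`), Farkas' lemma over `ℚ` (`farkas`) identifies the
inequalities `M_u (v, v₀) ≤ 0` with membership in the test cone (`ineqCone_dropColumns`). An
interior point of the polyhedron shows that the test cone contains no line (`testCone_pointed`).

**Running time.** Three estimates enter.

* A test matrix has at most `2 * (m + 1).choose ⌊n / 2⌋` rows, by the argument for the upper bound
  theorem: for a generic linear functional, every extreme ray is the unique maximum or the unique
  minimum, suitably normalized, on a face that is cut out by `⌊n / 2⌋` of the inequalities tight at
  it (`exists_half_face`, `card_extremeRays_le`).
* Primitive rows have polynomial height, by Cramer's rule (`natAbs_le_of_isExtremeRay`).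
* Sums and products of numbers of `k` bits are computed by Boolean circuits with `O(k ^ (1 + ε))`
  gates, by the Toom–Cook method with a large number of parts
  (`toomCook_step`, `exists_opCost_bound`).

The program (`testCmd`) clears the denominators of `s` and of one row after the other, skips the
rows whose inner product with `s` is not zero, and adds the remaining ones to an upper triangular
integer matrix by fraction-free elimination. It counts the nonzero rows of this matrix, and in the
end it compares their number with `q`. No common factors are removed, so that the bit length at most
doubles from one column to the next, and all numbers have at most `2 ^ n` times polynomially many
bits (`testCmd_outputs`). This factor is harmless, since
`(m + 1).choose ⌊n / 2⌋ ≤ (2 * m) ^ (n / 2) / ⌊n / 2⌋!`, and the factorial absorbs every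
exponential function of `n` (`exists_pow_div_factorial_half_le`). The running time is thus
`O(m ^ (n / 2) * h ^ (1 + ε))` (`exists_time_bound`), and about the exponent `θ` of linear algebra
nothing but `0 ≤ θ` is needed.
-/

/-! ### Polyhedral cones over the rationals -/

/-- The cone `{x | G x ≤ 0}`. -/
def ineqCone {κ ι : Type*} [Fintype ι] (G : Matrix κ ι ℚ) : Set (ι → ℚ) :=
  {x | ∀ i, (G *ᵥ x) i ≤ 0}

/-- Farkas' lemma over an ordered field, by induction on the number of functionals: if `γ` fails on
some `z` for the first `n` functionals, project along `z` onto the kernel of the last one. -/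
theorem farkas {V : Type*} [AddCommGroup V] [Module ℚ V] :
    ∀ (n : ℕ) (a : Fin n → V →ₗ[ℚ] ℚ) (γ : V →ₗ[ℚ] ℚ),
      (∀ x, (∀ i, a i x ≤ 0) → γ x ≤ 0) →
      ∃ l : Fin n → ℚ, (∀ i, 0 ≤ l i) ∧ γ = ∑ i, l i • a i := by
  intro n
  induction n with
  | zero =>
    intro a γ h
    refine ⟨fun _ => 0, fun _ => le_rfl, ?_⟩
    ext x
    have h1 := h x (fun i => i.elim0)
    have h2 := h (-x) (fun i => i.elim0)
    rw [map_neg] at h2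
    simp only [Finset.univ_eq_empty, Finset.sum_empty, LinearMap.zero_apply]
    linarith
  | succ n ih =>
    intro a γ h
    by_cases h0 : ∀ x, (∀ i : Fin n, a i.castSucc x ≤ 0) → γ x ≤ 0
    · obtain ⟨l, hl, e⟩ := ih (fun i => a i.castSucc) γ h0
      refine ⟨Fin.snoc l 0, fun i => ?_, ?_⟩
      · refine Fin.lastCases ?_ (fun i => ?_) i <;> simp [hl]
      · rw [Fin.sum_univ_castSucc]; simpa using e
    · push Not at h0
      obtain ⟨z, hz, hγ⟩ := h0
      set b := a (Fin.last n) with hb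
      have hbz : 0 < b z := by
        by_contra hc
        push Not at hc
        refine absurd (h z fun i => ?_) (not_le.2 hγ)
        exact Fin.lastCases hc hz i
      let P : V →ₗ[ℚ] V := LinearMap.id - (LinearMap.toSpanSingleton ℚ V ((b z)⁻¹ • z)).comp b
      have hP : ∀ x, P x = x - (b x * (b z)⁻¹) • z := fun x => by
        simp [P, smul_smul]
      have hbP : ∀ x, b (P x) = 0 := fun x => by
        rw [hP, map_sub, map_smul, smul_eq_mul]; field_simp; ring
      obtain ⟨l, hl, e⟩ := ih (fun i => (a i.castSucc).comp P) (γ.comp P) (by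
        intro x hx
        refine h (P x) fun i => Fin.lastCases ?_ hx i
        exact (hbP x).le)
      refine ⟨Fin.snoc l ((b z)⁻¹ * (γ z - ∑ i, l i * a i.castSucc z)), fun i => ?_, ?_⟩
      · refine Fin.lastCases ?_ (fun i => ?_) i
        · rw [Fin.snoc_last]
          have : ∑ i, l i * a i.castSucc z ≤ 0 :=
            Finset.sum_nonpos fun i _ => mul_nonpos_of_nonneg_of_nonpos (hl i) (hz i)
          have : 0 ≤ (b z)⁻¹ := by positivity
          exact mul_nonneg this (by linarith)
        · simpa using hl i
      · ext x
        have ex := LinearMap.congr_fun e x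
        rw [Fin.sum_univ_castSucc]
        simp only [LinearMap.add_apply, LinearMap.coe_sum, Finset.sum_apply, LinearMap.smul_apply,
          LinearMap.comp_apply, hP, map_sub, map_smul, smul_eq_mul, Fin.snoc_castSucc,
          Fin.snoc_last, mul_sub, Finset.sum_sub_distrib, ← hb] at ex ⊢
        have e2 : ∑ i, l i * (b x * (b z)⁻¹ * a i.castSucc z)
            = b x * (b z)⁻¹ * ∑ i, l i * a i.castSucc z := by
          rw [Finset.mul_sum]; exact Finset.sum_congr rfl fun i _ => by ring
        rw [e2] at ex
        linear_combination ex

/-- A vector on which every element of the cone `{ρ | G ρ ≤ 0}` is nonpositive is a nonnegative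
combination of the rows of `G`. -/
theorem exists_nonneg_vecMul {κ ι : Type*} [Fintype κ] [Fintype ι] (G : Matrix κ ι ℚ)
    (x : ι → ℚ) (h : ∀ ρ ∈ ineqCone G, ρ ⬝ᵥ x ≤ 0) :
    ∃ l : κ → ℚ, (∀ i, 0 ≤ l i) ∧ l ᵥ* G = x := by
  classical
  let e := Fintype.equivFin κ
  obtain ⟨l, hl, eq⟩ := farkas (Fintype.card κ)
    (fun i => (LinearMap.proj (e.symm i)).comp G.mulVecLin)
    (dotProductBilin ℚ ℚ x) (by
      intro ρ hρ
      have := h ρ fun i => by simpa using hρ (e i)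
      simpa [dotProduct_comm] using this)
  refine ⟨fun i => l (e i), fun i => hl _, ?_⟩
  funext j
  have := LinearMap.congr_fun eq (Pi.single j 1)
  simp only [LinearMap.coe_sum, Finset.sum_apply, LinearMap.smul_apply, LinearMap.comp_apply,
    LinearMap.proj_apply, mulVecLin_apply, smul_eq_mul] at this
  have h2 : (dotProductBilin ℚ ℚ x) (Pi.single j 1) = x j := by simp
  rw [← h2, this, ← Equiv.sum_comp e]
  simp [vecMul, dotProduct]

theorem exists_pos_smul_abs_le {κ : Type*} [Fintype κ] (a b : κ → ℚ)
    (h : ∀ i, b i = 0 → a i = 0) : ∃ δ : ℚ, 0 < δ ∧ ∀ i, δ * |a i| ≤ |b i| := by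
  have hs : 0 ≤ ∑ i, |a i| / |b i| := Finset.sum_nonneg fun i _ => by positivity
  refine ⟨1 / (1 + ∑ i, |a i| / |b i|), by positivity, fun i => ?_⟩
  rcases eq_or_ne (b i) 0 with hb | hb
  · simp [hb, h i hb]
  · have hb' : 0 < |b i| := abs_pos.2 hb
    have h1 : |a i| / |b i| ≤ ∑ i, |a i| / |b i| :=
      Finset.single_le_sum (f := fun i => |a i| / |b i|) (fun i _ => by positivity)
        (Finset.mem_univ i)
    rw [div_mul_eq_mul_div, one_mul, div_le_iff₀ (by positivity)]
    rw [div_le_iff₀ hb'] at h1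
    nlinarith

/-- A nonzero vector `r` of a polyhedral cone is an extreme ray if and only if the inequalities that
are tight at `r` determine it up to scaling. -/
theorem isExtremeRay_ineqCone_iff {κ ι : Type*} [Fintype κ] [Fintype ι] (G : Matrix κ ι ℚ)
    (r : ι → ℚ) :
    IsExtremeRay (ineqCone G) r ↔ r ≠ 0 ∧ r ∈ ineqCone G ∧
      ∀ x, (∀ i, (G *ᵥ r) i = 0 → (G *ᵥ x) i = 0) → ∃ t : ℚ, x = t • r := by
  constructor
  · rintro ⟨h0, F, ⟨d, M, S, hC, hF⟩, hr, hd⟩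
    have hrC : r ∈ ineqCone G := by rw [hF] at hr; exact hr.1
    refine ⟨h0, hrC, fun x hx => ?_⟩
    -- both `r + δ x` and `r - δ x` lie in the cone, hence in every face through `r`
    obtain ⟨δ, hδ, hle⟩ := exists_pos_smul_abs_le (G *ᵥ x) (G *ᵥ r) hx
    have key : ∀ σ : ℚ, |σ| ≤ δ → r + σ • x ∈ ineqCone G := by
      intro σ hσ i
      have h1 := hrC i
      have h2 := hle i
      rw [abs_of_nonpos h1] at h2
      have h3 : σ * (G *ᵥ x) i ≤ δ * |(G *ᵥ x) i| := by
        refine (le_abs_self _).trans ?_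
        rw [abs_mul]; gcongr
      simp only [mulVec_add, mulVec_smul, Pi.add_apply, Pi.smul_apply, smul_eq_mul]
      linarith
    have hp := key δ (abs_of_pos hδ).le
    have hm := key (-δ) (by rw [abs_neg, abs_of_pos hδ])
    have hpF : r + δ • x ∈ F := by
      rw [hF] at hr ⊢
      refine ⟨hp, fun i hi => ?_⟩
      rw [hC] at hp hm
      have a1 := hp i
      have a2 := hm i
      have a3 := hr.2 i hi
      simp only [mulVec_add, mulVec_smul, Pi.add_apply, Pi.smul_apply, smul_eq_mul, a3] at a1 a2 ⊢
      linarith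
    have hr' : (⟨r, Submodule.subset_span hr⟩ : Submodule.span ℚ F) ≠ 0 := by
      simpa [Subtype.ext_iff] using h0
    obtain ⟨t, ht⟩ := (finrank_eq_one_iff_of_nonzero' _ hr').1 hd
      ⟨r + δ • x, Submodule.subset_span hpF⟩
    have ht' : t • r = r + δ • x := congrArg Subtype.val ht
    refine ⟨δ⁻¹ * (t - 1), ?_⟩
    rw [mul_smul, sub_smul, ht', one_smul, add_sub_cancel_left, smul_smul, inv_mul_cancel₀ hδ.ne',
      one_smul]
  · rintro ⟨h0, hr, hx⟩
    classical
    let e := Fintype.equivFin κ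
    refine ⟨h0, {x ∈ ineqCone G | ∀ i ∈ {i | (G *ᵥ r) (e.symm i) = 0}, (G *ᵥ x) (e.symm i) = 0},
      ⟨Fintype.card κ, G.submatrix e.symm id, {i | (G *ᵥ r) (e.symm i) = 0}, ?_, ?_⟩,
      ⟨hr, fun i hi => hi⟩, ?_⟩
    · ext x
      exact ⟨fun h i => h _, fun h i => by simpa [mulVec, dotProduct] using h (e i)⟩
    · rfl
    · have : Submodule.span ℚ {x ∈ ineqCone G |
          ∀ i ∈ {i | (G *ᵥ r) (e.symm i) = 0}, (G *ᵥ x) (e.symm i) = 0} = ℚ ∙ r := by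
        apply le_antisymm
        · rw [Submodule.span_le]
          rintro x ⟨-, h⟩
          obtain ⟨t, rfl⟩ := hx x fun i hi => by
            simpa using h (e i) (by simpa using hi)
          exact Submodule.mem_span_singleton.2 ⟨t, rfl⟩
        · rw [Submodule.span_singleton_le_iff_mem]
          exact Submodule.subset_span ⟨hr, fun i hi => hi⟩
      rw [this, finrank_span_singleton h0]

/-- A linear functional that is positive somewhere on a pointed polyhedral cone is positive on one
of its extreme rays. A point with the fewest slack inequalities among the positive ones is extreme:
otherwise it is a positive combination of two points of the cone with fewer slack inequalities. -/
theorem exists_isExtremeRay_pos {κ ι : Type*} [Fintype κ] [Fintype ι] (G : Matrix κ ι ℚ)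
    (hG : ∀ x, G *ᵥ x = 0 → x = 0) (x : ι → ℚ) (ρ : ι → ℚ) (hρ : ρ ∈ ineqCone G)
    (hx : 0 < ρ ⬝ᵥ x) : ∃ r, IsExtremeRay (ineqCone G) r ∧ 0 < r ⬝ᵥ x := by
  classical
  induction hN : (Finset.univ.filter fun i => (G *ᵥ ρ) i ≠ 0).card using Nat.strong_induction_on
    generalizing ρ with
  | _ N ih =>
  by_cases hex : IsExtremeRay (ineqCone G) ρ
  · exact ⟨ρ, hex, hx⟩
  have hρ0 : ρ ≠ 0 := by rintro rfl; simp at hx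
  rw [isExtremeRay_ineqCone_iff] at hex
  push Not at hex
  obtain ⟨y, hy, hyne⟩ := hex hρ0 hρ
  set S := Finset.univ.filter fun i => (G *ᵥ ρ) i ≠ 0 with hS
  have hSne : S.Nonempty := by
    by_contra h
    rw [Finset.not_nonempty_iff_eq_empty] at h
    refine hρ0 (hG ρ (funext fun i => ?_))
    by_contra hi
    have : i ∈ S := by simpa [hS] using hi
    simp [h] at this
  have hneg : ∀ i ∈ S, (G *ᵥ ρ) i < 0 := fun i hi => by
    have := (Finset.mem_filter.1 hi).2
    exact lt_of_le_of_ne (hρ i) this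
  obtain ⟨i₀, hi₀, hmin⟩ := S.exists_min_image (fun i => (G *ᵥ y) i / (G *ᵥ ρ) i) hSne
  obtain ⟨i₁, hi₁, hmax⟩ := S.exists_max_image (fun i => (G *ᵥ y) i / (G *ᵥ ρ) i) hSne
  set α := (G *ᵥ y) i₀ / (G *ᵥ ρ) i₀
  set β := (G *ᵥ y) i₁ / (G *ᵥ ρ) i₁
  have hz : ∀ i ∉ S, (G *ᵥ ρ) i = 0 := fun i hi => by simpa [hS] using hi
  have smaller : ∀ (z : ι → ℚ) (j : κ), j ∈ S → (∀ i ∉ S, (G *ᵥ z) i = 0) → (G *ᵥ z) j = 0 →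
      (Finset.univ.filter fun i => (G *ᵥ z) i ≠ 0).card < N := by
    intro z j hj hzS hzj
    rw [← hN]
    refine Finset.card_lt_card ⟨fun i hi => ?_, fun h => ?_⟩
    · by_contra hi'
      exact (Finset.mem_filter.1 hi).2 (hzS i hi')
    · exact (Finset.mem_filter.1 (h hj)).2 hzj
  have e₀ : (G *ᵥ y) i₀ = α * (G *ᵥ ρ) i₀ := by
    rw [div_mul_cancel₀ _ (hneg _ hi₀).ne]
  have e₁ : (G *ᵥ y) i₁ = β * (G *ᵥ ρ) i₁ := by
    rw [div_mul_cancel₀ _ (hneg _ hi₁).ne]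
  have hab : α < β := by
    refine lt_of_le_of_ne (hmin i₁ hi₁) fun heq => hyne α ?_
    rw [← sub_eq_zero]
    refine hG _ (funext fun i => ?_)
    simp only [mulVec_sub, mulVec_smul, Pi.sub_apply, Pi.smul_apply, smul_eq_mul, Pi.zero_apply]
    by_cases hi : i ∈ S
    · have h1 := hmin i hi
      have h2 := hmax i hi
      have h3 : (G *ᵥ y) i / (G *ᵥ ρ) i = α := le_antisymm (heq ▸ h2) h1
      rw [← h3, div_mul_cancel₀ _ (hneg i hi).ne, sub_self]
    · rw [hy i (hz i hi), hz i hi]; simp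
  have m₀ : (G *ᵥ (y - α • ρ)) i₀ = 0 := by
    simp [mulVec_sub, mulVec_smul, e₀]
  have m₁ : (G *ᵥ (β • ρ - y)) i₁ = 0 := by
    simp [mulVec_sub, mulVec_smul, e₁]
  have z₀ : ∀ i ∉ S, (G *ᵥ (y - α • ρ)) i = 0 := fun i hi => by
    simp [mulVec_sub, mulVec_smul, hz i hi, hy i (hz i hi)]
  have z₁ : ∀ i ∉ S, (G *ᵥ (β • ρ - y)) i = 0 := fun i hi => by
    simp [mulVec_sub, mulVec_smul, hz i hi, hy i (hz i hi)]
  have c₀ : y - α • ρ ∈ ineqCone G := fun i => by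
    by_cases hi : i ∈ S
    · have := hmin i hi
      have h2 := (le_div_iff_of_neg (hneg i hi)).1 this
      simp only [mulVec_sub, mulVec_smul, Pi.sub_apply, Pi.smul_apply, smul_eq_mul]
      linarith
    · exact (z₀ i hi).le
  have c₁ : β • ρ - y ∈ ineqCone G := fun i => by
    by_cases hi : i ∈ S
    · have := hmax i hi
      have h2 := (div_le_iff_of_neg (hneg i hi)).1 this
      simp only [mulVec_sub, mulVec_smul, Pi.sub_apply, Pi.smul_apply, smul_eq_mul]
      linarith
    · exact (z₁ i hi).le
  have hsum : (y - α • ρ) ⬝ᵥ x + (β • ρ - y) ⬝ᵥ x = (β - α) * (ρ ⬝ᵥ x) := by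
    simp only [sub_dotProduct, smul_dotProduct, smul_eq_mul]; ring
  have hpos : 0 < (β - α) * (ρ ⬝ᵥ x) := mul_pos (sub_pos.2 hab) hx
  by_cases h : 0 < (y - α • ρ) ⬝ᵥ x
  · exact ih _ (smaller _ i₀ hi₀ z₀ m₀) _ c₀ h rfl
  · exact ih _ (smaller _ i₁ hi₁ z₁ m₁) _ c₁ (by linarith) rfl

/-! ### The rank test -/

/-- The rank test detects the extreme rays of a pointed cone. -/
theorem redundancyTest_eq_false_iff {d q : ℕ} (M : Matrix (Fin d) (Fin q ⊕ Unit) ℚ)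
    (s : Fin q ⊕ Unit → ℚ) (hM : ∀ x, M *ᵥ x = 0 → x = 0) (hs : ∀ i, (M *ᵥ s) i ≤ 0) :
    redundancyTest M s = false ↔ IsExtremeRay {x | ∀ i, (M *ᵥ x) i ≤ 0} s := by
  classical
  change _ ↔ IsExtremeRay (ineqCone M) s
  rw [isExtremeRay_ineqCone_iff]
  set N := M.submatrix (Subtype.val : {i // (M *ᵥ s) i = 0} → Fin d) id with hN
  have hNx : ∀ x i, (N *ᵥ x) i = (M *ᵥ x) i := fun x i => rfl
  have hsN : s ∈ LinearMap.ker N.mulVecLin := by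
    rw [LinearMap.mem_ker, mulVecLin_apply]
    exact funext fun i => i.2
  have hrank : N.rank + Module.finrank ℚ (LinearMap.ker N.mulVecLin) = q + 1 := by
    have := N.mulVecLin.finrank_range_add_finrank_ker
    simpa [Matrix.rank] using this
  have h1 : redundancyTest M s = false ↔ Module.finrank ℚ (LinearMap.ker N.mulVecLin) = 1 := by
    unfold redundancyTest
    rw [ite_eq_left_iff]
    simp only [Bool.true_eq_false, imp_false, not_not]
    constructor
    · intro h
      have : N.rank = q := by convert h
      omega
    · intro h
      have : N.rank = q := by omega
      convert this
  rw [h1]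
  have hker : ∀ x, x ∈ LinearMap.ker N.mulVecLin ↔ ∀ i, (M *ᵥ s) i = 0 → (M *ᵥ x) i = 0 := by
    intro x
    rw [LinearMap.mem_ker, mulVecLin_apply]
    exact ⟨fun h i hi => congrFun h ⟨i, hi⟩, fun h => funext fun i => h i i.2⟩
  constructor
  · intro h
    have hs0 : s ≠ 0 := by
      rintro rfl
      have : LinearMap.ker N.mulVecLin = ⊥ := by
        rw [eq_bot_iff]
        intro x hx
        exact hM x (funext fun i => (hker x).1 hx i (by simp))
      rw [this, finrank_bot] at h
      omega
    refine ⟨hs0, hs, fun x hx => ?_⟩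
    have hne : (⟨s, hsN⟩ : LinearMap.ker N.mulVecLin) ≠ 0 := by
      simpa [Subtype.ext_iff] using hs0
    obtain ⟨t, ht⟩ := (finrank_eq_one_iff_of_nonzero' _ hne).1 h ⟨x, (hker x).2 hx⟩
    exact ⟨t, (congrArg Subtype.val ht).symm⟩
  · rintro ⟨h0, -, hx⟩
    have hne : (⟨s, hsN⟩ : LinearMap.ker N.mulVecLin) ≠ 0 := by
      simpa [Subtype.ext_iff] using h0
    refine (finrank_eq_one_iff_of_nonzero' _ hne).2 fun w => ?_
    obtain ⟨t, ht⟩ := hx w ((hker _).1 w.2)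
    exact ⟨t, Subtype.ext ht.symm⟩

/-! ### Redundancy test cones -/

theorem sum_eq_sum_castLE {m k : ℕ} (hk : k ≤ m) (f : Fin m → ℚ)
    (hf : ∀ j : Fin m, k ≤ j.1 → f j = 0) : ∑ j, f j = ∑ j : Fin k, f (Fin.castLE hk j) := by
  have e : ∑ j : Fin k, f (Fin.castLE hk j) = ∑ j ∈ Finset.univ.map (Fin.castLEEmb hk), f j :=
    (Finset.sum_map Finset.univ (Fin.castLEEmb hk) f).symm
  rw [e]
  refine (Finset.sum_subset (Finset.subset_univ _) fun j _ hj => hf j ?_).symm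
  by_contra h
  refine hj (Finset.mem_map.2 ⟨⟨j.1, not_le.1 h⟩, Finset.mem_univ _, ?_⟩)
  rfl

theorem vecMul_extMatrix_castLE {m k : ℕ} (hk : k ≤ m) (B : Matrix (Fin m) (Fin k) ℚ)
    (z : Fin m → ℚ) (j : Fin k) : (z ᵥ* extMatrix B) (Fin.castLE hk j) = (z ᵥ* B) j := by
  simp [vecMul, dotProduct, extMatrix]

theorem vecMul_extMatrix_of_le {m k : ℕ} (B : Matrix (Fin m) (Fin k) ℚ)
    (z : Fin m → ℚ) (j : Fin m) (hj : k ≤ j.1) : (z ᵥ* extMatrix B) j = z j := by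
  simp [vecMul, dotProduct, extMatrix, not_lt.2 hj]

theorem extMatrix_mulVec {m k : ℕ} (hk : k ≤ m) (B : Matrix (Fin m) (Fin k) ℚ)
    (u : Fin m → ℚ) (hu : ∀ j : Fin m, k ≤ j.1 → u j = 0) :
    extMatrix B *ᵥ u = B *ᵥ (fun j => u (Fin.castLE hk j)) := by
  funext i
  simp only [mulVec, dotProduct]
  rw [sum_eq_sum_castLE hk _ fun j hj => by rw [hu j hj, mul_zero]]
  simp [extMatrix]

theorem isUnit_extMatrix {m k : ℕ} (hk : k ≤ m) (B : Matrix (Fin m) (Fin k) ℚ)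
    (hB : LinearIndependent ℚ (fun i : Fin k => B (Fin.castLE hk i))) :
    IsUnit (extMatrix B) := by
  rw [← vecMul_injective_iff_isUnit, ← coe_vecMulLinear, ← LinearMap.ker_eq_bot,
    LinearMap.ker_eq_bot']
  intro z hz
  rw [vecMulLinear_apply] at hz
  have h1 : ∀ j : Fin m, k ≤ j.1 → z j = 0 := fun j hj => by
    rw [← vecMul_extMatrix_of_le B z j hj, hz]; rfl
  have h2 : ∑ i : Fin k, z (Fin.castLE hk i) • B (Fin.castLE hk i) = 0 := by
    funext j
    have := congrFun hz (Fin.castLE hk j)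
    rw [vecMul_extMatrix_castLE] at this
    simp only [vecMul, dotProduct] at this
    rw [sum_eq_sum_castLE hk _ fun j hj => by rw [h1 j hj, zero_mul]] at this
    simpa [Finset.sum_apply] using this
  have h3 := Fintype.linearIndependent_iff.1 hB _ h2
  funext j
  by_cases hj : k ≤ j.1
  · exact h1 j hj
  · exact h3 ⟨j.1, not_le.1 hj⟩

/-- The redundancy test cone without reference to `B₀`: after the change of variables
`l = [v, w] B₀⁻¹` it consists of the inequalities `l B x ≤ v₀` derived by nonnegative multipliers
that eliminate `u`. -/
theorem mem_testCone_iff {m p q : ℕ} (hq : q ≤ m) (A : Matrix (Fin m) (Fin p) ℚ)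
    (B : Matrix (Fin m) (Fin q) ℚ) (c : Fin m → ℚ)
    (hB : LinearIndependent ℚ (fun i : Fin q => B (Fin.castLE hq i))) (x : Fin q ⊕ Unit → ℚ) :
    x ∈ testCone hq A B c ↔ ∃ l : Fin m → ℚ, (∀ i, 0 ≤ l i) ∧ l ᵥ* A = 0 ∧
      (∀ j, (l ᵥ* B) j = x (Sum.inl j)) ∧ l ⬝ᵥ c ≤ x (Sum.inr ()) := by
  have hu := isUnit_extMatrix hq B hB
  have hdet : IsUnit (extMatrix B).det := (isUnit_iff_isUnit_det _).1 hu
  constructor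
  · rintro ⟨z, hz, h0, h1, h2⟩
    refine ⟨_, h1, h0, fun j => ?_, by linarith⟩
    rw [← vecMul_extMatrix_castLE hq, vecMul_vecMul, nonsing_inv_mul _ hdet, vecMul_one, hz]
  · rintro ⟨l, h1, h0, hz, h2⟩
    refine ⟨l ᵥ* extMatrix B, fun j => by rw [vecMul_extMatrix_castLE, hz], ?_⟩
    have e : l ᵥ* extMatrix B ᵥ* (extMatrix B)⁻¹ = l := by
      rw [vecMul_vecMul, mul_nonsing_inv _ hdet, vecMul_one]
    rw [e]
    exact ⟨h0, h1, by linarith⟩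

/-- The coefficient matrix of the homogenized system `A x + u c ≤ 0, u ≤ 0`. -/
def homMatrix {m n : ℕ} (A : Matrix (Fin m) (Fin n) ℚ) (c : Fin m → ℚ) :
    Matrix (Fin m ⊕ Unit) (Fin n ⊕ Unit) ℚ :=
  Matrix.fromBlocks A (Matrix.of fun i _ => c i) 0 1

theorem homMatrix_mulVec_inl {m n : ℕ} (A : Matrix (Fin m) (Fin n) ℚ) (c : Fin m → ℚ)
    (ρ : Fin n ⊕ Unit → ℚ) (i : Fin m) :
    (homMatrix A c *ᵥ ρ) (Sum.inl i) = (A *ᵥ (fun j => ρ (Sum.inl j))) i + c i * ρ (Sum.inr ()) := by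
  simp [homMatrix, mulVec, dotProduct, Fintype.sum_sum_type]

theorem homMatrix_mulVec_inr {m n : ℕ} (A : Matrix (Fin m) (Fin n) ℚ) (c : Fin m → ℚ)
    (ρ : Fin n ⊕ Unit → ℚ) : (homMatrix A c *ᵥ ρ) (Sum.inr ()) = ρ (Sum.inr ()) := by
  simp [homMatrix, mulVec, dotProduct, Fintype.sum_sum_type]

theorem homMatrix_injective {m n : ℕ} (hn : n ≤ m) (A : Matrix (Fin m) (Fin n) ℚ) (c : Fin m → ℚ)
    (hA : LinearIndependent ℚ (fun i : Fin n => A (Fin.castLE hn i)))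
    (ρ : Fin n ⊕ Unit → ℚ) (h : homMatrix A c *ᵥ ρ = 0) : ρ = 0 := by
  have h0 : ρ (Sum.inr ()) = 0 := by rw [← homMatrix_mulVec_inr A c ρ, h]; rfl
  have h1 : A *ᵥ (fun j => ρ (Sum.inl j)) = 0 := by
    funext i
    have := congrFun h (Sum.inl i)
    rw [homMatrix_mulVec_inl, h0, mul_zero, add_zero] at this
    exact this
  have h2 : IsUnit (Matrix.of fun i : Fin n => A (Fin.castLE hn i)) :=
    linearIndependent_rows_iff_isUnit.1 hA
  have h3 := (mulVec_injective_iff_isUnit.2 h2) (a₁ := fun j => ρ (Sum.inl j)) (a₂ := 0) (by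
    rw [mulVec_zero]; exact funext fun i => congrFun h1 (Fin.castLE hn i))
  funext j
  rcases j with j | j
  · exact congrFun h3 j
  · exact h0

theorem vecMul_liftedRows_inr {m n : ℕ} (A : Matrix (Fin m) (Fin n) ℚ) (c : Fin m → ℚ)
    (y : Fin m ⊕ Unit → ℚ) : (y ᵥ* liftedRows A c) (Sum.inr ()) = y (Sum.inr ()) := by
  simp [liftedRows, vecMul, dotProduct, Fintype.sum_sum_type]

theorem vecMul_liftedRows_inl {m n : ℕ} (A : Matrix (Fin m) (Fin n) ℚ) (c : Fin m → ℚ)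
    (y : Fin m ⊕ Unit → ℚ) (j : Fin m) : (y ᵥ* liftedRows A c) (Sum.inl j) =
      ((extMatrix A)⁻¹ *ᵥ (fun i => y (Sum.inl i) - y (Sum.inr ()) * c i)) j := by
  have : (fun i => y (Sum.inl i) - y (Sum.inr ()) * c i)
      = (fun i => y (Sum.inl i)) - y (Sum.inr ()) • c := rfl
  rw [this, mulVec_sub, mulVec_smul]
  simp [liftedRows, vecMul, dotProduct, Fintype.sum_sum_type, mulVec, mul_comm, sub_eq_add_neg]

theorem eliminationRow_neg_homMatrix_mulVec {m n : ℕ} (hn : n ≤ m) (A : Matrix (Fin m) (Fin n) ℚ)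
    (c : Fin m → ℚ) (hA : LinearIndependent ℚ (fun i : Fin n => A (Fin.castLE hn i)))
    (ρ : Fin n ⊕ Unit → ℚ) :
    (∀ j : Fin m, n ≤ j.1 → ((-(homMatrix A c *ᵥ ρ)) ᵥ* liftedRows A c) (Sum.inl j) = 0) ∧
    eliminationRow hn A c (-(homMatrix A c *ᵥ ρ)) = ρ := by
  have hdet : IsUnit (extMatrix A).det := (isUnit_iff_isUnit_det _).1 (isUnit_extMatrix hn A hA)
  let u : Fin m → ℚ := fun j => if h : j.1 < n then -ρ (Sum.inl ⟨j.1, h⟩) else 0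
  have hu0 : ∀ j : Fin m, n ≤ j.1 → u j = 0 := fun j hj => dif_neg (not_lt.2 hj)
  have hu1 : ∀ j : Fin n, u (Fin.castLE hn j) = -ρ (Sum.inl j) := fun j => dif_pos j.2
  have key : ∀ j, ((-(homMatrix A c *ᵥ ρ)) ᵥ* liftedRows A c) (Sum.inl j) = u j := by
    intro j
    rw [vecMul_liftedRows_inl]
    have : (fun i => (-(homMatrix A c *ᵥ ρ)) (Sum.inl i) -
        (-(homMatrix A c *ᵥ ρ)) (Sum.inr ()) * c i) = extMatrix A *ᵥ u := by
      rw [extMatrix_mulVec hn A u hu0]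
      funext i
      simp only [Pi.neg_apply, homMatrix_mulVec_inl, homMatrix_mulVec_inr, hu1]
      have : (fun j => -ρ (Sum.inl j)) = -(fun j => ρ (Sum.inl j) : Fin n → ℚ) := rfl
      rw [this, mulVec_neg, Pi.neg_apply]; ring
    rw [this, mulVec_mulVec, nonsing_inv_mul _ hdet, one_mulVec]
  refine ⟨fun j hj => by rw [key, hu0 j hj], ?_⟩
  funext j
  rcases j with j | j
  · simp only [eliminationRow, Sum.map_inl]
    rw [key, hu1, neg_neg]
  · simp only [eliminationRow, Sum.map_inr, id]
    rw [vecMul_liftedRows_inr, Pi.neg_apply, homMatrix_mulVec_inr, neg_neg]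

theorem eq_neg_homMatrix_mulVec_eliminationRow {m n : ℕ} (hn : n ≤ m)
    (A : Matrix (Fin m) (Fin n) ℚ) (c : Fin m → ℚ)
    (hA : LinearIndependent ℚ (fun i : Fin n => A (Fin.castLE hn i)))
    (y : Fin m ⊕ Unit → ℚ)
    (hy : ∀ j : Fin m, n ≤ j.1 → (y ᵥ* liftedRows A c) (Sum.inl j) = 0) :
    y = -(homMatrix A c *ᵥ eliminationRow hn A c y) := by
  have hdet : IsUnit (extMatrix A).det := (isUnit_iff_isUnit_det _).1 (isUnit_extMatrix hn A hA)
  set w : Fin m → ℚ := fun i => y (Sum.inl i) - y (Sum.inr ()) * c i with hw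
  have h1 : extMatrix A *ᵥ ((extMatrix A)⁻¹ *ᵥ w) = w := by
    rw [mulVec_mulVec, mul_nonsing_inv _ hdet, one_mulVec]
  rw [extMatrix_mulVec hn A _ (fun j hj => by rw [← vecMul_liftedRows_inl, hy j hj])] at h1
  funext i
  rcases i with i | i
  · have h2 := congrFun h1 i
    rw [Pi.neg_apply, homMatrix_mulVec_inl]
    simp only [eliminationRow, Sum.map_inl, Sum.map_inr, id, vecMul_liftedRows_inr,
      vecMul_liftedRows_inl]
    have : (fun j : Fin n => -((extMatrix A)⁻¹ *ᵥ w) (Fin.castLE hn j))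
        = -(fun j : Fin n => ((extMatrix A)⁻¹ *ᵥ w) (Fin.castLE hn j)) := rfl
    rw [this, mulVec_neg, Pi.neg_apply, h2, hw]
    ring
  · rw [Pi.neg_apply, homMatrix_mulVec_inr]
    simp [eliminationRow, vecMul_liftedRows_inr]

/-- The projection cone as a cone of inequalities, every equation being a pair of them. -/
theorem projectionCone_eq_ineqCone {m n : ℕ} (A : Matrix (Fin m) (Fin n) ℚ) (c : Fin m → ℚ) :
    ∃ P : Matrix ((Fin m ⊕ Unit) ⊕ Fin m ⊕ Fin m) (Fin m ⊕ Unit) ℚ,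
      (∀ y i, (P *ᵥ y) (Sum.inl i) = -y i) ∧
      (∀ y j, (P *ᵥ y) (Sum.inr (Sum.inl j)) =
        if n ≤ j.1 then (y ᵥ* liftedRows A c) (Sum.inl j) else 0) ∧
      (∀ y j, (P *ᵥ y) (Sum.inr (Sum.inr j)) =
        -if n ≤ j.1 then (y ᵥ* liftedRows A c) (Sum.inl j) else 0) ∧
      projectionCone A c = ineqCone P := by
  let E : Fin m → Fin m ⊕ Unit → ℚ := fun j =>
    if n ≤ j.1 then fun i => liftedRows A c i (Sum.inl j) else 0
  have hE : ∀ y j, E j ⬝ᵥ y = if n ≤ j.1 then (y ᵥ* liftedRows A c) (Sum.inl j) else 0 := by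
    intro y j
    by_cases h : n ≤ j.1
    · simp [E, h, vecMul, dotProduct, mul_comm]
    · simp [E, h]
  refine ⟨Matrix.of (Sum.elim (fun i => -Pi.single i 1) (Sum.elim E (fun j => -E j))),
    fun y i => ?_, fun y j => ?_, fun y j => ?_, ?_⟩
  · have : (-Pi.single i 1 : Fin m ⊕ Unit → ℚ) ⬝ᵥ y = -y i := by
      rw [neg_dotProduct, single_dotProduct, one_mul]
    exact this
  · exact hE y j
  · have : (-E j) ⬝ᵥ y = -(if n ≤ j.1 then (y ᵥ* liftedRows A c) (Sum.inl j) else 0) := by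
      rw [neg_dotProduct, hE]
    exact this
  · ext y
    simp only [projectionCone, ineqCone, Set.mem_ofPred_eq, Sum.forall]
    simp only [mulVec, of_apply, Sum.elim_inl, Sum.elim_inr, neg_dotProduct, hE,
      single_dotProduct, one_mul]
    constructor
    · rintro ⟨⟨h1, h1'⟩, h2⟩
      refine ⟨⟨fun i => by linarith [h1 i], fun i => by linarith [h1' i]⟩, fun j => ?_, fun j => ?_⟩
      · split_ifs with h
        · exact (h2 j h).le
        · exact le_rfl
      · split_ifs with h
        · rw [h2 j h, neg_zero]
        · simp
    · rintro ⟨⟨h1, h1'⟩, h2, h3⟩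
      refine ⟨⟨fun i => by linarith [h1 i], fun i => by linarith [h1' i]⟩, fun j hj => ?_⟩
      have a := h2 j
      have b := h3 j
      rw [if_pos hj] at a b
      linarith

/-- The projection cone is a linear image of the cone `A x + u c ≤ 0, u ≤ 0`. -/
theorem isExtremeRay_projectionCone_iff {m n : ℕ} (hn : n ≤ m)
    (A : Matrix (Fin m) (Fin n) ℚ) (c : Fin m → ℚ)
    (hA : LinearIndependent ℚ (fun i : Fin n => A (Fin.castLE hn i)))
    (y : Fin m ⊕ Unit → ℚ) :
    IsExtremeRay (projectionCone A c) y ↔ y = -(homMatrix A c *ᵥ eliminationRow hn A c y) ∧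
      IsExtremeRay (ineqCone (homMatrix A c)) (eliminationRow hn A c y) := by
  obtain ⟨P, hP1, hP2, hP3, hP⟩ := projectionCone_eq_ineqCone A c
  rw [hP, isExtremeRay_ineqCone_iff, isExtremeRay_ineqCone_iff, ← hP]
  constructor
  · rintro ⟨h0, hy, hx⟩
    have e := eq_neg_homMatrix_mulVec_eliminationRow hn A c hA y hy.2
    set ρ := eliminationRow hn A c y with hρ
    refine ⟨e, ?_, fun i => ?_, fun x hx' => ?_⟩
    · intro h
      rw [h, mulVec_zero, neg_zero] at e
      exact h0 e
    · have := hy.1 i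
      rw [e, Pi.neg_apply] at this
      linarith
    · obtain ⟨h1, h2⟩ := eliminationRow_neg_homMatrix_mulVec hn A c hA x
      obtain ⟨t, ht⟩ := hx (-(homMatrix A c *ᵥ x)) (by
        rintro (i | j | j) hi
        · rw [hP1] at hi ⊢
          rw [e, Pi.neg_apply, neg_neg] at hi
          simpa using hx' i hi
        · rw [hP2]
          split_ifs with h
          exacts [h1 j h, rfl]
        · rw [hP3]
          split_ifs with h
          exacts [by rw [h1 j h, neg_zero], neg_zero])
      refine ⟨t, ?_⟩
      rw [e] at ht
      rw [← sub_eq_zero]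
      refine homMatrix_injective hn A c hA _ ?_
      rw [mulVec_sub, mulVec_smul]
      have := neg_injective (ht.trans (smul_neg t _))
      rw [this, sub_self]
  · rintro ⟨e, h0, hρ, hx⟩
    set ρ := eliminationRow hn A c y with hρe
    have hker := (eliminationRow_neg_homMatrix_mulVec hn A c hA ρ).1
    rw [← e] at hker
    refine ⟨?_, ⟨fun i => ?_, hker⟩, fun x hx' => ?_⟩
    · rintro rfl
      refine h0 (homMatrix_injective hn A c hA _ ?_)
      rw [← neg_eq_zero, ← e]
    · rw [e, Pi.neg_apply]
      linarith [hρ i]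
    · have hxk : ∀ j : Fin m, n ≤ j.1 → (x ᵥ* liftedRows A c) (Sum.inl j) = 0 := by
        intro j hj
        have := hx' (Sum.inr (Sum.inl j)) (by rw [hP2, if_pos hj, hker j hj])
        rwa [hP2, if_pos hj] at this
      have ex := eq_neg_homMatrix_mulVec_eliminationRow hn A c hA x hxk
      obtain ⟨t, ht⟩ := hx (eliminationRow hn A c x) (by
        intro i hi
        have h1 : y i = 0 := by rw [e, Pi.neg_apply, hi, neg_zero]
        have h2 := hx' (Sum.inl i) (by rw [hP1, h1, neg_zero])
        rw [hP1, neg_eq_zero] at h2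
        rw [ex, Pi.neg_apply, neg_eq_zero] at h2
        exact h2)
      refine ⟨t, ?_⟩
      rw [ex, ht, e, mulVec_smul, smul_neg]

/-- The rows of the initial test matrix are representatives of the extreme rays of the cone
`A x + u c ≤ 0, u ≤ 0`. -/
theorem IsInitialTestMatrix.rows {m n d : ℕ} {hn : n ≤ m} {A : Matrix (Fin m) (Fin n) ℚ}
    {c : Fin m → ℚ} {M : Matrix (Fin d) (Fin n ⊕ Unit) ℚ}
    (hA : LinearIndependent ℚ (fun i : Fin n => A (Fin.castLE hn i)))
    (h : IsInitialTestMatrix hn A c M) :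
    (∀ i, IsExtremeRay (ineqCone (homMatrix A c)) (M i)) ∧
    (∀ i j, ∀ t : ℚ, 0 < t → M i = t • M j → i = j) ∧
    ∀ r, IsExtremeRay (ineqCone (homMatrix A c)) r → ∃ i, ∃ t : ℚ, 0 < t ∧ r = t • M i := by
  obtain ⟨Y, hY, hY', hM⟩ := h
  have hY2 := fun i => (isExtremeRay_projectionCone_iff hn A c hA (Y i)).1 (hY i)
  refine ⟨fun i => ?_, fun i j t ht hij => ?_, fun r hr => ?_⟩
  · obtain ⟨t, ht, e⟩ := hM i
    have := (hY2 i).2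
    rw [isExtremeRay_ineqCone_iff] at this ⊢
    obtain ⟨h0, h1, h2⟩ := this
    rw [e]
    refine ⟨smul_ne_zero ht.ne' h0, fun k => ?_, fun x hx => ?_⟩
    · rw [mulVec_smul, Pi.smul_apply, smul_eq_mul]
      exact mul_nonpos_of_nonneg_of_nonpos ht.le (h1 k)
    · obtain ⟨σ, rfl⟩ := h2 x fun k hk => hx k (by rw [mulVec_smul, Pi.smul_apply, hk, smul_zero])
      exact ⟨σ * t⁻¹, by rw [smul_smul, mul_assoc, inv_mul_cancel₀ ht.ne', mul_one]⟩
  · obtain ⟨a, ha, ei⟩ := hM i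
    obtain ⟨b, hb, ej⟩ := hM j
    obtain ⟨k, -, hk⟩ := hY' (Y i) (hY i)
    have h1 := hk i ⟨1, one_pos, (one_smul _ _).symm⟩
    have h2 := hk j ⟨a⁻¹ * (t * b), by positivity, by
      rw [ei, ej, smul_smul] at hij
      rw [(hY2 i).1, (hY2 j).1, smul_neg, ← mulVec_smul, mul_smul, ← hij, smul_smul,
        inv_mul_cancel₀ ha.ne', one_smul, ← (hY2 i).1]⟩
    rw [h1, h2]
  · obtain ⟨-, e⟩ := eliminationRow_neg_homMatrix_mulVec hn A c hA r
    obtain ⟨i, ⟨t, ht, hi⟩, -⟩ := hY' (-(homMatrix A c *ᵥ r))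
      ((isExtremeRay_projectionCone_iff hn A c hA _).2 (by rw [e]; exact ⟨rfl, hr⟩))
    obtain ⟨a, ha, ei⟩ := hM i
    refine ⟨i, t * a⁻¹, by positivity, ?_⟩
    rw [ei, smul_smul, mul_assoc, inv_mul_cancel₀ ha.ne', mul_one]
    rw [← sub_eq_zero]
    refine homMatrix_injective hn A c hA _ ?_
    rw [mulVec_sub, mulVec_smul]
    rw [(hY2 i).1, smul_neg, neg_inj] at hi
    rw [hi, sub_self]

theorem dotProduct_of_extremeRays {m n d : ℕ} {hn : n ≤ m} {A : Matrix (Fin m) (Fin n) ℚ}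
    {c : Fin m → ℚ} {M : Matrix (Fin d) (Fin n ⊕ Unit) ℚ}
    (hA : LinearIndependent ℚ (fun i : Fin n => A (Fin.castLE hn i)))
    (h : IsInitialTestMatrix hn A c M) (x : Fin n ⊕ Unit → ℚ) :
    (∀ i, (M *ᵥ x) i ≤ 0) ↔ ∀ ρ ∈ ineqCone (homMatrix A c), ρ ⬝ᵥ x ≤ 0 := by
  obtain ⟨h1, -, h2⟩ := h.rows hA
  constructor
  · intro hx ρ hρ
    by_contra hlt
    obtain ⟨r, hr, hrx⟩ := exists_isExtremeRay_pos _ (homMatrix_injective hn A c hA) x ρ hρ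
      (not_le.1 hlt)
    obtain ⟨i, t, ht, rfl⟩ := h2 r hr
    rw [smul_dotProduct, smul_eq_mul] at hrx
    exact absurd (pos_of_mul_pos_right hrx ht.le) (not_lt.2 (hx i))
  · intro hx i
    exact hx _ ((isExtremeRay_ineqCone_iff _ _).1 (h1 i)).2.1

/-- Block elimination is correct, and setting the eliminated variables to zero turns a description
of the initial test cone into one of the test cone for `u`. -/
theorem ineqCone_dropColumns {m p q d : ℕ} (hn : p + q ≤ m) (hq : q ≤ m)
    (A : Matrix (Fin m) (Fin (p + q)) ℚ) (c : Fin m → ℚ)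
    (M : Matrix (Fin d) (Fin (p + q) ⊕ Unit) ℚ)
    (hA : LinearIndependent ℚ (fun i : Fin (p + q) => A (Fin.castLE hn i)))
    (hB : LinearIndependent ℚ
      (fun i : Fin q => A.submatrix id (Fin.natAdd p) (Fin.castLE hq i)))
    (hM : IsInitialTestMatrix hn A c M) :
    testCone hq (A.submatrix id (Fin.castAdd q)) (A.submatrix id (Fin.natAdd p)) c =
      {x | ∀ i, (dropColumns p q M *ᵥ x) i ≤ 0} := by
  ext x
  let X : Fin (p + q) ⊕ Unit → ℚ :=
    Sum.elim (Fin.addCases (fun _ => 0) (fun j => x (Sum.inl j))) (fun j => x (Sum.inr j))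
  have hX : dropColumns p q M *ᵥ x = M *ᵥ X := by
    funext i
    simp [mulVec, dotProduct, Fintype.sum_sum_type, Fin.sum_univ_add, X, dropColumns]
  rw [mem_testCone_iff hq _ _ c hB, Set.mem_ofPred_eq, hX, dotProduct_of_extremeRays hA hM]
  have hvm : ∀ l : Fin m ⊕ Unit → ℚ, ∀ j, (l ᵥ* homMatrix A c) (Sum.inl j) =
      ((fun i => l (Sum.inl i)) ᵥ* A) j := fun l j => by
    simp [vecMul, dotProduct, homMatrix, Fintype.sum_sum_type]
  have hvm2 : ∀ l : Fin m ⊕ Unit → ℚ, (l ᵥ* homMatrix A c) (Sum.inr ()) =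
      ((fun i => l (Sum.inl i)) ⬝ᵥ c) + l (Sum.inr ()) := fun l => by
    simp [vecMul, dotProduct, homMatrix, Fintype.sum_sum_type]
  constructor
  · rintro ⟨l, h0, h1, h2, h3⟩ ρ hρ
    let l' : Fin m ⊕ Unit → ℚ := Sum.elim l (fun _ => x (Sum.inr ()) - l ⬝ᵥ c)
    have hl' : ∀ i, 0 ≤ l' i := by
      rintro (i | i)
      · exact h0 i
      · simp only [l', Sum.elim_inr]; linarith
    have : X = l' ᵥ* homMatrix A c := by
      funext j
      rcases j with j | j
      · rw [hvm]
        refine Fin.addCases (fun j => ?_) (fun j => ?_) j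
        · have := congrFun h1 j
          simp only [X, Sum.elim_inl, Fin.addCases_left]
          exact this.symm
        · simp only [X, Sum.elim_inl, Fin.addCases_right]
          exact (h2 j).symm
      · rw [hvm2]; simp [X, l']
    rw [this, dotProduct_comm, ← dotProduct_mulVec]
    exact Finset.sum_nonpos fun i _ => mul_nonpos_of_nonneg_of_nonpos (hl' i) (hρ i)
  · intro h
    obtain ⟨l, hl, e⟩ := exists_nonneg_vecMul (homMatrix A c) X h
    refine ⟨fun i => l (Sum.inl i), fun i => hl _, ?_, fun j => ?_, ?_⟩
    · funext j
      have := hvm l (Fin.castAdd q j)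
      rw [e] at this
      simp only [X, Sum.elim_inl, Fin.addCases_left] at this
      exact this.symm
    · have := hvm l (Fin.natAdd p j)
      rw [e] at this
      simp only [X, Sum.elim_inl, Fin.addCases_right] at this
      exact this.symm
    · have := hvm2 l
      rw [e] at this
      simp only [X, Sum.elim_inr] at this
      linarith [hl (Sum.inr ())]

/-- If the polyhedron is full-dimensional, a nonnegative combination of its inequalities that
vanishes identically uses only trivial inequalities, so the test cone contains no line. -/
theorem testCone_pointed {m p q : ℕ} (hq : q ≤ m)
    (A : Matrix (Fin m) (Fin (p + q)) ℚ) (c : Fin m → ℚ)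
    (hB : LinearIndependent ℚ
      (fun i : Fin q => A.submatrix id (Fin.natAdd p) (Fin.castLE hq i)))
    (hQ : FullDimensional (polyhedron A c)) (x : Fin q ⊕ Unit → ℚ)
    (h1 : x ∈ testCone hq (A.submatrix id (Fin.castAdd q)) (A.submatrix id (Fin.natAdd p)) c)
    (h2 : -x ∈ testCone hq (A.submatrix id (Fin.castAdd q)) (A.submatrix id (Fin.natAdd p)) c) :
    x = 0 := by
  rw [mem_testCone_iff hq _ _ c hB] at h1 h2
  obtain ⟨l, hl, lA, lB, lc⟩ := h1
  obtain ⟨l', hl', lA', lB', lc'⟩ := h2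
  have hμA : (l + l') ᵥ* A = 0 := by
    funext j
    refine Fin.addCases (fun j => ?_) (fun j => ?_) j
    · have a := congrFun lA j
      have b := congrFun lA' j
      rw [add_vecMul]
      exact (congrArg₂ (· + ·) a b).trans (add_zero _)
    · have a := lB j
      have b := lB' j
      rw [add_vecMul]
      refine (congrArg₂ (· + ·) a b).trans ?_
      simp
  have hμc : (l + l') ⬝ᵥ c ≤ 0 := by
    rw [add_dotProduct]
    simp only [Pi.neg_apply] at lc'
    linarith
  -- complementary slackness: a used inequality is an equation on the polyhedron
  have tight : ∀ y ∈ polyhedron A c, ∀ i, (l + l') i * (c i - (A *ᵥ y) i) = 0 := by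
    intro y hy
    have hnn : ∀ i ∈ Finset.univ, 0 ≤ (l + l') i * (c i - (A *ᵥ y) i) := fun i _ =>
      mul_nonneg (add_nonneg (hl i) (hl' i)) (sub_nonneg.2 (hy i))
    have hs : ∑ i, (l + l') i * (c i - (A *ᵥ y) i) ≤ 0 := by
      have e : ∑ i, (l + l') i * (c i - (A *ᵥ y) i) = (l + l') ⬝ᵥ c - (l + l') ⬝ᵥ (A *ᵥ y) := by
        simp [dotProduct, mul_sub, Finset.sum_sub_distrib]
      rw [e, dotProduct_mulVec, hμA, zero_dotProduct, sub_zero]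
      exact hμc
    have h0 := le_antisymm hs (Finset.sum_nonneg hnn)
    exact fun i => (Finset.sum_eq_zero_iff_of_nonneg hnn).1 h0 i (Finset.mem_univ i)
  have trivialRow : ∀ i, (l + l') i ≠ 0 → (∀ j, A i j = 0) ∧ c i = 0 := by
    intro i hi
    have hall : ∀ y : Fin (p + q) → ℚ, (A *ᵥ y) i = c i := by
      intro y
      let f : (Fin (p + q) → ℚ) →ₗ[ℚ] ℚ := (LinearMap.proj i).comp A.mulVecLin
      have hsub : polyhedron A c ⊆ (AffineSubspace.comap f.toAffineMap
          (AffineSubspace.mk' (c i) (⊥ : Submodule ℚ ℚ)) : AffineSubspace ℚ _) := by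
        intro z hz
        have := (mul_eq_zero.1 (tight z hz i)).resolve_left hi
        simp only [AffineSubspace.coe_comap, Set.mem_preimage, SetLike.mem_coe,
          AffineSubspace.mem_mk', Submodule.mem_bot, vsub_eq_sub]
        simp only [f, LinearMap.coe_toAffineMap, LinearMap.comp_apply, mulVecLin_apply,
          LinearMap.proj_apply]
        linarith
      have hspan := affineSpan_le.2 hsub
      rw [hQ] at hspan
      have := hspan (AffineSubspace.mem_top ℚ _ y)
      simp only [AffineSubspace.mem_comap,
          AffineSubspace.mem_mk', Submodule.mem_bot, vsub_eq_sub, f, LinearMap.coe_toAffineMap,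
          LinearMap.comp_apply, mulVecLin_apply, LinearMap.proj_apply] at this
      linarith
    have hc : c i = 0 := by rw [← hall 0]; simp
    refine ⟨fun j => ?_, hc⟩
    have := hall (Pi.single j 1)
    simpa [hc] using this
  have hlz : ∀ i, l i ≠ 0 → (∀ j, A i j = 0) ∧ c i = 0 := fun i hi =>
    trivialRow i (by
      have a := hl i
      have b := hl' i
      have : 0 < l i := lt_of_le_of_ne a (Ne.symm hi)
      exact (by simp only [Pi.add_apply]; linarith : 0 < (l + l') i).ne')
  have hlz' : ∀ i, l' i ≠ 0 → c i = 0 := fun i hi =>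
    (trivialRow i (by
      have a := hl i
      have b := hl' i
      have : 0 < l' i := lt_of_le_of_ne b (Ne.symm hi)
      exact (by simp only [Pi.add_apply]; linarith : 0 < (l + l') i).ne')).2
  have hlc : l ⬝ᵥ c = 0 := Finset.sum_eq_zero fun i _ => by
    by_cases h : l i = 0
    · rw [h, zero_mul]
    · rw [(hlz i h).2, mul_zero]
  have hlc' : l' ⬝ᵥ c = 0 := Finset.sum_eq_zero fun i _ => by
    by_cases h : l' i = 0
    · rw [h, zero_mul]
    · rw [hlz' i h, mul_zero]
  funext j
  rcases j with j | j
  · rw [← lB j, Pi.zero_apply]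
    simp only [vecMul, dotProduct]
    refine Finset.sum_eq_zero fun i _ => ?_
    by_cases h : l i = 0
    · rw [h, zero_mul]
    · exact mul_eq_zero_of_right _ ((hlz i h).1 _)
  · rw [hlc] at lc
    rw [hlc', Pi.neg_apply] at lc'
    have hj : x (Sum.inr j) = 0 := le_antisymm (by linarith) lc
    exact hj

/-- Correctness of the rank test on the matrix of a redundancy test cone. -/
theorem redundancyTest_dropColumns_iff {m p q d : ℕ} (hn : p + q ≤ m) (hq : q ≤ m)
    (A : Matrix (Fin m) (Fin (p + q)) ℚ) (c : Fin m → ℚ)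
    (M : Matrix (Fin d) (Fin (p + q) ⊕ Unit) ℚ)
    (hA : LinearIndependent ℚ (fun i : Fin (p + q) => A (Fin.castLE hn i)))
    (hB : LinearIndependent ℚ
      (fun i : Fin q => A.submatrix id (Fin.natAdd p) (Fin.castLE hq i)))
    (hQ : FullDimensional (polyhedron A c))
    (hM : IsInitialTestMatrix hn A c M) (s : Fin q ⊕ Unit → ℚ)
    (hs : s ∈ testCone hq (A.submatrix id (Fin.castAdd q)) (A.submatrix id (Fin.natAdd p)) c) :
    redundancyTest (dropColumns p q M) s = false ↔
      IsExtremeRay (testCone hq (A.submatrix id (Fin.castAdd q))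
        (A.submatrix id (Fin.natAdd p)) c) s := by
  have e := ineqCone_dropColumns hn hq A c M hA hB hM
  rw [e] at hs ⊢
  refine redundancyTest_eq_false_iff _ _ (fun x hx => ?_) hs
  refine testCone_pointed hq A c hB hQ x ?_ ?_
  · rw [e]; intro i; rw [hx]; exact le_rfl
  · rw [e]; intro i; rw [mulVec_neg, hx]; simp

/-! ### Counting extreme rays -/

/-- At an extreme ray of a cone in dimension `n + 1` there are `n` linearly independent tight
inequalities, and they determine the ray up to scaling. -/
theorem exists_tight_basis {κ ι : Type*} [Fintype κ] [Fintype ι] (G : Matrix κ ι ℚ) (n : ℕ)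
    (hι : Fintype.card ι = n + 1) (ρ : ι → ℚ) (hρ : IsExtremeRay (ineqCone G) ρ) :
    ∃ b : Fin n → κ, (∀ k, (G *ᵥ ρ) (b k) = 0) ∧ LinearIndependent ℚ (fun k => G (b k)) ∧
      ∀ x, (∀ k, (G *ᵥ x) (b k) = 0) → ∃ t : ℚ, x = t • ρ := by
  classical
  obtain ⟨h0, -, hx⟩ := (isExtremeRay_ineqCone_iff G ρ).1 hρ
  set N := G.submatrix (Subtype.val : {i // (G *ᵥ ρ) i = 0} → κ) id with hN
  have hker : ∀ x, x ∈ LinearMap.ker N.mulVecLin ↔ ∀ i, (G *ᵥ ρ) i = 0 → (G *ᵥ x) i = 0 := by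
    intro x
    rw [LinearMap.mem_ker, mulVecLin_apply]
    exact ⟨fun h i hi => congrFun h ⟨i, hi⟩, fun h => funext fun i => h i i.2⟩
  have h1 : Module.finrank ℚ (LinearMap.ker N.mulVecLin) = 1 := by
    have hne : (⟨ρ, (hker ρ).2 fun i hi => hi⟩ : LinearMap.ker N.mulVecLin) ≠ 0 := by
      simpa [Subtype.ext_iff] using h0
    refine (finrank_eq_one_iff_of_nonzero' _ hne).2 fun w => ?_
    obtain ⟨t, ht⟩ := hx w ((hker _).1 w.2)
    exact ⟨t, Subtype.ext ht.symm⟩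
  have hrank : N.rank = n := by
    have := N.mulVecLin.finrank_range_add_finrank_ker
    rw [h1, Module.finrank_fintype_fun_eq_card, hι] at this
    exact Nat.succ_injective this
  rw [rank_eq_finrank_span_row] at hrank
  obtain ⟨f, hf, hspan, hli⟩ : ∃ f : Fin n → ι → ℚ, (∀ k, f k ∈ Set.range N.row) ∧
      Submodule.span ℚ (Set.range f) = Submodule.span ℚ (Set.range N.row) ∧
      LinearIndependent ℚ f := by
    rw [← hrank]
    exact Submodule.exists_fun_fin_finrank_span_eq ℚ (Set.range N.row)
  choose b hb using hf
  have hb' : ∀ k, G (b k).1 = f k := hb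
  refine ⟨fun k => (b k).1, fun k => (b k).2, by simpa only [hb'] using hli, fun x h => hx x ?_⟩
  intro i hi
  have hmem : G i ∈ Submodule.span ℚ (Set.range f) := by
    rw [hspan]
    exact Submodule.subset_span ⟨⟨i, hi⟩, rfl⟩
  have hle : Submodule.span ℚ (Set.range f) ≤ LinearMap.ker (dotProductBilin ℚ ℚ x) := by
    rw [Submodule.span_le]
    rintro _ ⟨k, rfl⟩
    rw [SetLike.mem_coe, LinearMap.mem_ker, ← hb']
    have := h k
    rw [mulVec, dotProduct_comm] at this
    exact this
  have := hle hmem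
  rw [LinearMap.mem_ker] at this
  rw [mulVec, dotProduct_comm]
  exact this

/-- A linear functional that is positive on a pointed cone outside the origin. -/
def slackSum {κ ι : Type*} [Fintype κ] (G : Matrix κ ι ℚ) : ι → ℚ := fun j => -∑ i, G i j

theorem slackSum_dotProduct {κ ι : Type*} [Fintype κ] [Fintype ι] (G : Matrix κ ι ℚ) (x : ι → ℚ) :
    slackSum G ⬝ᵥ x = ∑ i, -(G *ᵥ x) i := by
  simp only [slackSum, dotProduct, mulVec, neg_mul, Finset.sum_neg_distrib, Finset.sum_mul]
  rw [Finset.sum_comm]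

theorem slackSum_pos {κ ι : Type*} [Fintype κ] [Fintype ι] (G : Matrix κ ι ℚ)
    (hG : ∀ x, G *ᵥ x = 0 → x = 0) (x : ι → ℚ) (hx : x ∈ ineqCone G) (h0 : x ≠ 0) :
    0 < slackSum G ⬝ᵥ x := by
  rw [slackSum_dotProduct]
  have hnn : ∀ i ∈ Finset.univ, 0 ≤ -(G *ᵥ x) i := fun i _ => by linarith [hx i]
  refine lt_of_le_of_ne (Finset.sum_nonneg hnn) fun h => h0 (hG x (funext fun i => ?_))
  have := (Finset.sum_eq_zero_iff_of_nonneg hnn).1 h.symm i (Finset.mem_univ i)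
  simpa using this

/-- The slack functional and the row vectors `G (b k)`. -/
def slackFamily {κ ι : Type*} [Fintype κ] (G : Matrix κ ι ℚ) {n : ℕ} (b : Fin n → κ) :
    Option (Fin n) → ι → ℚ
  | none => slackSum G
  | some k => G (b k)

/-- A functional in general position with respect to all families of `n` rows. -/
theorem exists_generic {κ ι : Type*} [Fintype κ] [Fintype ι] (G : Matrix κ ι ℚ) (n : ℕ)
    (hι : Fintype.card ι = n + 1) :
    ∃ f : ι → ℚ, ∀ (b : Fin n → κ) (l : Option (Fin n) → ℚ),
      f = ∑ o, l o • slackFamily G b o → ∀ k, l (some k) ≠ 0 := by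
  classical
  let W : (Fin n → κ) × Fin n → Submodule ℚ (ι → ℚ) := fun bk =>
    Submodule.span ℚ ((Finset.univ.erase (some bk.2)).image (slackFamily G bk.1) : Finset (ι → ℚ))
  have hW : (⊤ : Submodule ℚ (ι → ℚ)) ∉ Finset.univ.image W := by
    intro h
    obtain ⟨bk, -, hbk⟩ := Finset.mem_image.1 h
    have h1 : (_ : ℕ) ≤ _ := finrank_span_finset_le_card (R := ℚ)
      ((Finset.univ.erase (some bk.2)).image (slackFamily G bk.1))
    have h2 : Module.finrank ℚ (W bk) = n + 1 := by
      rw [hbk, finrank_top, Module.finrank_fintype_fun_eq_card, hι]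
    have h3 : ((Finset.univ.erase (some bk.2)).image (slackFamily G bk.1)).card ≤ n := by
      refine Finset.card_image_le.trans ?_
      rw [Finset.card_erase_of_mem (Finset.mem_univ _), Finset.card_univ, Fintype.card_option,
        Fintype.card_fin]
      exact le_rfl
    change Module.finrank ℚ (W bk) ≤ _ at h1
    omega
  have hne := Subspace.biUnion_ne_univ_of_top_notMem hW
  rw [Set.ne_univ_iff_exists_notMem] at hne
  obtain ⟨f, hf⟩ := hne
  refine ⟨f, fun b l hl k hk => hf ?_⟩
  simp only [Set.mem_iUnion]
  refine ⟨W (b, k), Finset.mem_image.2 ⟨(b, k), Finset.mem_univ _, rfl⟩, ?_⟩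
  rw [SetLike.mem_coe, hl, ← Finset.sum_erase_add _ _ (Finset.mem_univ (some k)), hk, zero_smul,
    add_zero]
  refine Submodule.sum_mem _ fun o ho => Submodule.smul_mem _ _ (Submodule.subset_span ?_)
  exact Finset.mem_coe.2 (Finset.mem_image_of_mem _ ho)

/-- Each extreme ray maximizes or minimizes the generic functional, relative to the slack
functional, on a face given by `n / 2` of the inequalities: write `f` as a combination of the slack
functional and `n` tight rows; at most half of these rows have coefficients of the wrong sign, and
they are the ones made equations. -/
theorem exists_half_face {κ ι : Type*} [Fintype κ] [Fintype ι] (G : Matrix κ ι ℚ) (n : ℕ)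
    (hι : Fintype.card ι = n + 1) (hG : ∀ x, G *ᵥ x = 0 → x = 0) (f : ι → ℚ)
    (hf : ∀ (b : Fin n → κ) (l : Option (Fin n) → ℚ),
      f = ∑ o, l o • slackFamily G b o → ∀ k, l (some k) ≠ 0)
    (ρ : ι → ℚ) (hρ : IsExtremeRay (ineqCone G) ρ) :
    ∃ (σ : Bool) (S : Finset κ) (μ : ℚ), S.card = n / 2 ∧ (∀ i ∈ S, (G *ᵥ ρ) i = 0) ∧
      f ⬝ᵥ ρ = μ * (slackSum G ⬝ᵥ ρ) ∧
      ∀ x ∈ ineqCone G, (∀ i ∈ S, (G *ᵥ x) i = 0) →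
        (if σ then 1 else -1 : ℚ) * (f ⬝ᵥ x - μ * (slackSum G ⬝ᵥ x)) ≤ 0 ∧
        (f ⬝ᵥ x = μ * (slackSum G ⬝ᵥ x) → ∃ t : ℚ, x = t • ρ) := by
  classical
  obtain ⟨b, hb, hli, hx⟩ := exists_tight_basis G n hι ρ hρ
  obtain ⟨h0, hρC, -⟩ := (isExtremeRay_ineqCone_iff G ρ).1 hρ
  have hφ := slackSum_pos G hG ρ hρC h0
  have hli' : LinearIndependent ℚ (slackFamily G b) := by
    rw [linearIndependent_option]
    refine ⟨hli, fun hmem => ?_⟩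
    have hle : Submodule.span ℚ (Set.range (slackFamily G b ∘ (↑) : Fin n → ι → ℚ)) ≤
        LinearMap.ker (dotProductBilin ℚ ℚ ρ) := by
      rw [Submodule.span_le]
      rintro _ ⟨k, rfl⟩
      rw [SetLike.mem_coe, LinearMap.mem_ker]
      have := hb k
      rw [mulVec, dotProduct_comm] at this
      exact this
    have := hle hmem
    rw [LinearMap.mem_ker] at this
    have h2 : ρ ⬝ᵥ slackSum G = 0 := this
    rw [dotProduct_comm] at h2
    exact hφ.ne' h2
  have hcard : Fintype.card (Option (Fin n)) = Module.finrank ℚ (ι → ℚ) := by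
    rw [Fintype.card_option, Fintype.card_fin, Module.finrank_fintype_fun_eq_card, hι]
  let bas := basisOfLinearIndependentOfCardEqFinrank hli' hcard
  let l := bas.repr f
  have hl : f = ∑ o, l o • slackFamily G b o := by
    have := (bas.sum_repr f).symm
    rwa [coe_basisOfLinearIndependentOfCardEqFinrank] at this
  have hne := hf b l hl
  have hfx : ∀ x, f ⬝ᵥ x - l none * (slackSum G ⬝ᵥ x) = ∑ k, l (some k) * (G *ᵥ x) (b k) := by
    intro x
    conv_lhs => rw [hl]
    rw [Fintype.sum_option, add_dotProduct, smul_dotProduct, sum_dotProduct]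
    simp [slackFamily, mulVec, smul_dotProduct]
  have hbinj : Function.Injective b := fun i j hij => hli.injective (by simp only [hij])
  -- the common part of the two signs
  have main : ∀ σ : ℚ, (σ = 1 ∨ σ = -1) →
      (Finset.univ.filter fun k => σ * l (some k) < 0).card ≤ n / 2 →
      ∃ S : Finset κ, S.card = n / 2 ∧ (∀ i ∈ S, (G *ᵥ ρ) i = 0) ∧
        ∀ x ∈ ineqCone G, (∀ i ∈ S, (G *ᵥ x) i = 0) →
          σ * (f ⬝ᵥ x - l none * (slackSum G ⬝ᵥ x)) ≤ 0 ∧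
          (f ⬝ᵥ x = l none * (slackSum G ⬝ᵥ x) → ∃ t : ℚ, x = t • ρ) := by
    intro σ hσ hc
    obtain ⟨S, hS1, -, hS2⟩ := Finset.exists_subsuperset_card_eq (Finset.subset_univ _) hc
      (by rw [Finset.card_univ, Fintype.card_fin]; omega)
    refine ⟨S.image b, by rw [Finset.card_image_of_injective _ hbinj, hS2], ?_, ?_⟩
    · intro i hi
      obtain ⟨k, -, rfl⟩ := Finset.mem_image.1 hi
      exact hb k
    · intro x hxC hxS
      have hterm : ∀ k ∈ Finset.univ, σ * (l (some k) * (G *ᵥ x) (b k)) ≤ 0 := by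
        intro k _
        by_cases hk : k ∈ S
        · rw [hxS _ (Finset.mem_image_of_mem _ hk)]; simp
        · have : 0 ≤ σ * l (some k) := by
            by_contra h
            exact hk (hS1 (Finset.mem_filter.2 ⟨Finset.mem_univ _, not_le.1 h⟩))
          rw [← mul_assoc]
          exact mul_nonpos_of_nonneg_of_nonpos this (hxC _)
      refine ⟨?_, fun heq => hx x fun k => ?_⟩
      · rw [hfx, Finset.mul_sum]
        exact Finset.sum_nonpos hterm
      · have hz : ∑ k, σ * (l (some k) * (G *ᵥ x) (b k)) = 0 := by
          rw [← Finset.mul_sum, ← hfx, heq, sub_self, mul_zero]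
        have := (Finset.sum_eq_zero_iff_of_nonpos hterm).1 hz k (Finset.mem_univ k)
        have hσ0 : σ ≠ 0 := by rcases hσ with rfl | rfl <;> norm_num
        exact (mul_eq_zero.1 ((mul_eq_zero.1 this).resolve_left hσ0)).resolve_left (hne k)
  have hfρ : f ⬝ᵥ ρ = l none * (slackSum G ⬝ᵥ ρ) := by
    rw [← sub_eq_zero, hfx]
    exact Finset.sum_eq_zero fun k _ => by rw [hb, mul_zero]
  have hcards : (Finset.univ.filter fun k => (1 : ℚ) * l (some k) < 0).card +
      (Finset.univ.filter fun k => (-1 : ℚ) * l (some k) < 0).card ≤ n := by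
    rw [← Finset.card_union_of_disjoint]
    · exact (Finset.card_le_univ _).trans (by rw [Fintype.card_fin])
    · rw [Finset.disjoint_filter]
      intro k _ h1 h2
      linarith
  by_cases hc : (Finset.univ.filter fun k => (1 : ℚ) * l (some k) < 0).card ≤ n / 2
  · obtain ⟨S, h1, h2, h3⟩ := main 1 (Or.inl rfl) hc
    exact ⟨true, S, l none, h1, h2, hfρ, by simpa using h3⟩
  · obtain ⟨S, h1, h2, h3⟩ := main (-1) (Or.inr rfl) (by omega)
    exact ⟨false, S, l none, h1, h2, hfρ, by simpa using h3⟩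

/-- An asymptotic upper bound theorem: a pointed cone in dimension `n + 1` with `N` inequalities
has at most `2 * N.choose (n / 2)` extreme rays. -/
theorem card_extremeRays_le {κ ι : Type*} [Fintype κ] [Fintype ι] (G : Matrix κ ι ℚ) (n : ℕ)
    (hι : Fintype.card ι = n + 1) (hG : ∀ x, G *ᵥ x = 0 → x = 0) {d : ℕ} (M : Fin d → ι → ℚ)
    (hM : ∀ i, IsExtremeRay (ineqCone G) (M i))
    (hinj : ∀ i j, ∀ t : ℚ, 0 < t → M i = t • M j → i = j) :
    d ≤ 2 * (Fintype.card κ).choose (n / 2) := by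
  classical
  obtain ⟨f, hf⟩ := exists_generic G n hι
  choose σ S μ hS htight hμ hmax using fun i => exists_half_face G n hι hG f hf (M i) (hM i)
  have hC := fun i => ((isExtremeRay_ineqCone_iff G (M i)).1 (hM i))
  have hφ := fun i => slackSum_pos G hG (M i) (hC i).2.1 (hC i).1
  have key : Set.InjOn (fun i => (σ i, S i)) (Finset.univ : Finset (Fin d)) := by
    intro i _ j _ hij
    obtain ⟨e1, e2⟩ := Prod.mk.inj hij
    obtain ⟨a1, a2⟩ := hmax i (M j) (hC j).2.1 (by rw [e2]; exact htight j)
    obtain ⟨b1, -⟩ := hmax j (M i) (hC i).2.1 (by rw [← e2]; exact htight i)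
    rw [hμ j, ← sub_mul, ← mul_assoc] at a1
    rw [hμ i, ← sub_mul, ← mul_assoc, ← e1] at b1
    have a1' := nonpos_of_mul_nonpos_left a1 (hφ j)
    have b1' := nonpos_of_mul_nonpos_left b1 (hφ i)
    have hμe : μ j = μ i := by
      cases h : σ i <;> simp only [h, if_true, Bool.false_eq_true, if_false] at a1' b1' <;> linarith
    obtain ⟨t, ht⟩ := a2 (by rw [hμ j, hμe])
    refine (hinj j i t ?_ ht).symm
    have h1 := hφ j
    rw [ht, dotProduct_smul, smul_eq_mul] at h1
    exact pos_of_mul_pos_left h1 (hφ i).le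
  have hle := Finset.card_le_card_of_injOn (t := Finset.univ ×ˢ Finset.univ.powersetCard (n / 2))
    (fun i => (σ i, S i)) (by
      intro i _
      simp only [Finset.coe_product, Set.mem_prod, Finset.mem_coe, Finset.mem_univ, true_and]
      exact Finset.mem_powersetCard.2 ⟨Finset.subset_univ _, hS i⟩) key
  simpa using hle

/-! ### Heights of the rows of a test matrix -/

/-- A primitive integer vector on an extreme ray is bounded by the minors of the tight
inequalities. -/
theorem natAbs_le_of_isExtremeRay {κ : Type*} {n : ℕ} [Fintype κ]
    (G : Matrix κ (Fin n ⊕ Unit) ℚ) (P : ℕ) (hP : 1 ≤ P)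
    (hGP : ∀ i j, (G i j).num.natAbs ≤ P ∧ (G i j).den ≤ P) (z : Fin n ⊕ Unit → ℤ)
    (hz : Finset.univ.gcd z = 1) (hex : IsExtremeRay (ineqCone G) (fun j => (z j : ℚ))) (j) :
    (z j).natAbs ≤ (n + 1).factorial * (P ^ (n + 2)) ^ (n + 1) := by
  classical
  obtain ⟨b, hb, -, hx⟩ := exists_tight_basis G n (by simp) _ hex
  obtain ⟨h0, -, -⟩ := (isExtremeRay_ineqCone_iff G _).1 hex
  obtain ⟨j0, hj0⟩ : ∃ j0, z j0 ≠ 0 := by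
    by_contra h
    push Not at h
    exact h0 (funext fun j => by simp [h j])
  let D : Fin n → ℕ := fun k => ∏ j, (G (b k) j).den
  have hD : ∀ k, (D k : ℚ) ≠ 0 := fun k => by
    simp only [D, Nat.cast_prod]
    exact Finset.prod_ne_zero_iff.2 fun j _ => by exact_mod_cast (G (b k) j).den_nz
  let N : Fin n → Fin n ⊕ Unit → ℤ := fun k j =>
    (G (b k) j).num * ∏ j' ∈ Finset.univ.erase j, ((G (b k) j').den : ℤ)
  have hN : ∀ k j, (N k j : ℚ) = D k * G (b k) j := by
    intro k j
    simp only [N, D, Int.cast_mul, Int.cast_prod, Int.cast_natCast, Nat.cast_prod]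
    rw [← Finset.mul_prod_erase _ _ (Finset.mem_univ j)]
    have : ((G (b k) j).num : ℚ) = (G (b k) j).den * G (b k) j := (Rat.den_mul_eq_num _).symm
    rw [this]; ring
  have hNP : ∀ k j, |N k j| ≤ ((P ^ (n + 2) : ℕ) : ℤ) := by
    intro k j
    rw [abs_mul, Finset.abs_prod]
    have h1 : |(G (b k) j).num| ≤ (P : ℤ) := by
      rw [Int.abs_eq_natAbs]; exact_mod_cast (hGP (b k) j).1
    have h2 : ∏ j' ∈ Finset.univ.erase j, |((G (b k) j').den : ℤ)| ≤ (P : ℤ) ^ n := by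
      have := Finset.prod_le_prod (s := Finset.univ.erase j)
        (f := fun j' => |((G (b k) j').den : ℤ)|) (g := fun _ => (P : ℤ))
        (fun _ _ => abs_nonneg _) (fun j' _ => by
          rw [Nat.abs_cast]; exact_mod_cast (hGP (b k) j').2)
      simpa using this
    calc |(G (b k) j).num| * ∏ j' ∈ Finset.univ.erase j, |((G (b k) j').den : ℤ)|
        ≤ (P : ℤ) * (P : ℤ) ^ n := by
          refine mul_le_mul h1 h2 (Finset.prod_nonneg fun _ _ => abs_nonneg _) (by positivity)
      _ = (P : ℤ) ^ (n + 1) := by ring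
      _ ≤ (P : ℤ) ^ (n + 2) := pow_le_pow_right₀ (by exact_mod_cast hP) (by omega)
      _ = _ := by push_cast; rfl
  -- the tight rows, completed by a unit row to an invertible matrix
  let H : Matrix (Fin n ⊕ Unit) (Fin n ⊕ Unit) ℤ := Matrix.of (Sum.elim N (fun _ => Pi.single j0 1))
  have hHmul : ∀ x : Fin n ⊕ Unit → ℚ, ∀ k, (H.map (Int.cast : ℤ → ℚ) *ᵥ x) (Sum.inl k) =
      D k * (G *ᵥ x) (b k) := by
    intro x k
    simp only [mulVec, dotProduct, H, map_apply, of_apply, Sum.elim_inl, hN, Finset.mul_sum]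
    exact Finset.sum_congr rfl fun j _ => by ring
  have hHmul' : ∀ x : Fin n ⊕ Unit → ℚ, ∀ u, (H.map (Int.cast : ℤ → ℚ) *ᵥ x) (Sum.inr u) = x j0 := by
    intro x u
    simp [mulVec, dotProduct, H, Pi.single_apply]
  have hHz : H *ᵥ z = Pi.single (Sum.inr ()) (z j0) := by
    have : ∀ i, ((H *ᵥ z) i : ℚ) = (H.map (Int.cast : ℤ → ℚ) *ᵥ (fun j => (z j : ℚ))) i := by
      intro i; simp [mulVec, dotProduct]
    funext i
    have hi := this i
    rcases i with k | u
    · rw [hHmul, hb, mul_zero] at hi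
      simpa using hi
    · rw [hHmul'] at hi
      simpa using hi
  have hdet : H.det ≠ 0 := by
    intro hd
    have hd' : (H.map (Int.cast : ℤ → ℚ)).det = 0 := by
      have := (Int.castRingHom ℚ).map_det H
      rw [hd, map_zero] at this
      exact this.symm
    obtain ⟨v, hv0, hv⟩ := exists_mulVec_eq_zero_iff.2 hd'
    obtain ⟨t, rfl⟩ := hx v fun k => by
      have := hHmul v k
      rw [hv, Pi.zero_apply] at this
      exact (mul_eq_zero.1 this.symm).resolve_left (hD k)
    have := hHmul' (t • fun j => (z j : ℚ)) ()
    rw [hv] at this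
    simp only [Pi.zero_apply, Pi.smul_apply, smul_eq_mul] at this
    have ht : t = 0 := (mul_eq_zero.1 this.symm).resolve_right (by exact_mod_cast hj0)
    exact hv0 (by rw [ht, zero_smul])
  have hadj : ∀ j, H.det * z j = z j0 * H.adjugate j (Sum.inr ()) := by
    intro j
    have h1 : H.adjugate *ᵥ (H *ᵥ z) = H.det • z := by
      rw [mulVec_mulVec, adjugate_mul, smul_mulVec, one_mulVec]
    rw [hHz] at h1
    have := congrFun h1 j
    simp only [Pi.smul_apply, smul_eq_mul, mulVec_single] at this
    rw [← this]
    simp [mul_comm]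
  have hdvd : z j0 ∣ H.det := by
    have h1 : z j0 ∣ Finset.univ.gcd (fun j => H.det * z j) :=
      Finset.dvd_gcd fun j _ => ⟨_, hadj j⟩
    rw [Finset.gcd_mul_left, hz, mul_one] at h1
    exact dvd_normalize_iff.1 h1
  obtain ⟨a, ha⟩ := hdvd
  have ha0 : a ≠ 0 := by rintro rfl; exact hdet (by rw [ha, mul_zero])
  have hw : a * z j = H.adjugate j (Sum.inr ()) := by
    have := hadj j
    rw [ha, mul_assoc] at this
    exact mul_left_cancel₀ hj0 this
  have hadjle : |H.adjugate j (Sum.inr ())| ≤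
      (((n + 1).factorial * (P ^ (n + 2)) ^ (n + 1) : ℕ) : ℤ) := by
    rw [adjugate_apply]
    have hone : (1 : ℤ) ≤ ((P ^ (n + 2) : ℕ) : ℤ) := by exact_mod_cast Nat.one_le_pow _ _ hP
    have hs : ∀ j1 j2 : Fin n ⊕ Unit,
        |(Pi.single j1 1 : Fin n ⊕ Unit → ℤ) j2| ≤ ((P ^ (n + 2) : ℕ) : ℤ) := by
      intro j1 j2
      by_cases h : j2 = j1
      · subst h; simpa using hone
      · rw [Pi.single_eq_of_ne h, abs_zero]; positivity
    have := det_le (A := H.updateRow (Sum.inr ()) (Pi.single j 1)) (abv := AbsoluteValue.abs)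
      (x := ((P ^ (n + 2) : ℕ) : ℤ)) (by
        rintro (k | u) j2
        · rw [updateRow_ne (by simp)]
          exact hNP k j2
        · rw [updateRow_self]
          exact hs _ _)
    simpa using this
  have h1 : (z j).natAbs ≤ (H.adjugate j (Sum.inr ())).natAbs := by
    rw [← hw, Int.natAbs_mul]
    exact Nat.le_mul_of_pos_left _ (Int.natAbs_pos.2 ha0)
  refine h1.trans ?_
  rw [Int.abs_eq_natAbs] at hadjle
  exact_mod_cast hadjle

/-- There are few vectors of bounded bit length. -/
theorem card_le_of_bits {ι : Type*} [Fintype ι] {d b : ℕ} (M : Fin d → ι → ℚ)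
    (hinj : Function.Injective M)
    (hM : ∀ i j, (M i j).num.natAbs < 2 ^ b ∧ (M i j).den < 2 ^ b) :
    d ≤ 2 ^ ((2 * b + 1) * Fintype.card ι) := by
  classical
  let F : Fin d → ι → Bool × Fin (2 ^ b) × Fin (2 ^ b) := fun i j =>
    (decide (0 ≤ (M i j).num), ⟨_, (hM i j).1⟩, ⟨_, (hM i j).2⟩)
  have hF : Function.Injective F := by
    intro i i' h
    refine hinj (funext fun j => ?_)
    have := congrFun h j
    simp only [F, Prod.mk.injEq, Fin.mk.injEq, decide_eq_decide] at this
    obtain ⟨h1, h2, h3⟩ := this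
    exact Rat.ext (by omega) h3
  have := Fintype.card_le_of_injective F hF
  simp only [Fintype.card_fin, Fintype.card_fun, Fintype.card_prod, Fintype.card_bool] at this
  refine this.trans (le_of_eq ?_)
  rw [pow_mul]
  congr 1
  ring

/-! ### Boolean circuits for families of functions -/

/-- The two constant Boolean functions. -/
def constFns (X : Type) : Set (X → Bool) := {f | ∃ b, f = fun _ => b}

/-- `Gen S n T`: starting from the functions in `S` and the constants, `n` binary gates produce
exactly the functions in `T`. -/
inductive Gen {X : Type} (S : Set (X → Bool)) : ℕ → Set (X → Bool) → Prop
  | base : Gen S 0 (S ∪ constFns X)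
  | step {n : ℕ} {T : Set (X → Bool)} (op : Bool → Bool → Bool) (f g : X → Bool) :
      Gen S n T → f ∈ T → g ∈ T → Gen S (n + 1) (insert (fun x => op (f x) (g x)) T)

/-- All functions in `F` can be computed from those in `S` with at most `n` binary gates. Circuits
for numbers are composed on this level, where the domain `X` is arbitrary and no wires have to be
numbered. -/
def CircuitCost {X : Type} (S : Set (X → Bool)) (n : ℕ) (F : Set (X → Bool)) : Prop :=
  ∃ k ≤ n, ∃ T, Gen S k T ∧ F ⊆ T

variable {X : Type}

theorem Gen.subset {S T : Set (X → Bool)} {n : ℕ} (h : Gen S n T) : S ∪ constFns X ⊆ T := by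
  induction h with
  | base => exact subset_rfl
  | step op f g _ _ _ ih => exact ih.trans (Set.subset_insert _ _)

theorem Gen.trans {S T T' U : Set (X → Bool)} {n m : ℕ} (h : Gen S n T) (hT : T' ⊆ T)
    (h' : Gen T' m U) : Gen S (n + m) (T ∪ U) := by
  induction h' with
  | base =>
    have : T ∪ (T' ∪ constFns X) = T :=
      Set.union_eq_self_of_subset_right
        (Set.union_subset hT (Set.subset_union_right.trans h.subset))
    rw [this]; exact h
  | step op f g _ hf hg ih =>
    rw [Set.union_insert]
    exact Gen.step op f g ih (Or.inr hf) (Or.inr hg)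

namespace CircuitCost

variable {S S' F F' H : Set (X → Bool)} {n m : ℕ}

theorem of_subset (h : F ⊆ S ∪ constFns X) : CircuitCost S 0 F :=
  ⟨0, le_rfl, _, Gen.base, h⟩

theorem mono (h : CircuitCost S n F) (hn : n ≤ m) (hF : F' ⊆ F) : CircuitCost S m F' := by
  obtain ⟨k, hk, T, hT, hFT⟩ := h
  exact ⟨k, hk.trans hn, T, hT, hF.trans hFT⟩

theorem trans (h : CircuitCost S n F) (h' : CircuitCost (S ∪ F) m H) :
    CircuitCost S (n + m) (F ∪ H) := by
  obtain ⟨k, hk, T, hT, hFT⟩ := h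
  obtain ⟨k', hk', U, hU, hHU⟩ := h'
  refine ⟨k + k', by omega, _, hT.trans (Set.union_subset ?_ hFT) hU,
    Set.union_subset_union hFT hHU⟩
  exact Set.subset_union_left.trans hT.subset

theorem mono_left (h : CircuitCost S n F) (hS : S ⊆ S' ∪ constFns X) : CircuitCost S' n F := by
  obtain ⟨k, hk, T, hT, hFT⟩ := h
  exact ⟨0 + k, by omega, _, Gen.base.trans hS hT, hFT.trans Set.subset_union_right⟩

theorem union (h : CircuitCost S n F) (h' : CircuitCost S m H) : CircuitCost S (n + m) (F ∪ H) :=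
  h.trans (h'.mono_left (Set.subset_union_left.trans Set.subset_union_left))

/-- Composition that keeps only the final functions. -/
theorem comp (h : CircuitCost S n F) (h' : CircuitCost F m H) : CircuitCost S (n + m) H :=
  (h.trans (h'.mono_left (Set.subset_union_right.trans Set.subset_union_left))).mono le_rfl
    Set.subset_union_right

theorem gate (op : Bool → Bool → Bool) {f g : X → Bool} (hf : f ∈ S ∪ constFns X)
    (hg : g ∈ S ∪ constFns X) : CircuitCost S 1 {fun x => op (f x) (g x)} :=
  ⟨1, le_rfl, _, Gen.step op f g Gen.base hf hg, by simp⟩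

theorem comp_gate (op : Bool → Bool → Bool) {f g : X → Bool} (hf : CircuitCost S n {f})
    (hg : CircuitCost S m {g}) : CircuitCost S (n + m + 1) {fun x => op (f x) (g x)} :=
  (hf.union hg).comp (gate op (by simp) (by simp))

theorem mem {f : X → Bool} (hf : f ∈ S ∪ constFns X) : CircuitCost S 0 {f} :=
  of_subset (by simpa using hf)

theorem iUnion_lt (k : ℕ) (N : ℕ) (F : ℕ → Set (X → Bool))
    (h : ∀ i < k, CircuitCost S N (F i)) : CircuitCost S (k * N) {f | ∃ i < k, f ∈ F i} := by
  induction k with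
  | zero => exact (of_subset (F := ∅) (Set.empty_subset _)).mono (by omega) (by simp)
  | succ k ih =>
    refine ((ih fun i hi => h i (by omega)).union (h k (by omega))).mono
      (by rw [Nat.succ_mul]) ?_
    rintro f ⟨i, hi, hf⟩
    rcases Nat.lt_succ_iff_lt_or_eq.1 hi with h | rfl
    · exact Or.inl ⟨i, h, hf⟩
    · exact Or.inr hf

/-- A chain of `k` steps, each of which uses the results of the one before it. -/
theorem chain (k : ℕ) (N : ℕ) (F : ℕ → Set (X → Bool)) (h0 : F 0 ⊆ S ∪ constFns X)
    (h : ∀ i < k, CircuitCost (S ∪ F i) N (F (i + 1))) :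
    CircuitCost S (k * N) {f | ∃ i ≤ k, f ∈ F i} := by
  induction k with
  | zero =>
    refine (of_subset h0).mono (by omega) ?_
    rintro f ⟨i, hi, hf⟩
    obtain rfl : i = 0 := by omega
    exact hf
  | succ k ih =>
    have h1 := ih fun i hi => h i (by omega)
    refine (h1.trans ((h k (by omega)).mono_left ?_)).mono (by rw [Nat.succ_mul]) ?_
    · rintro f (hf | hf)
      · exact Or.inl (Or.inl hf)
      · exact Or.inl (Or.inr ⟨k, le_rfl, hf⟩)
    · rintro f ⟨i, hi, hf⟩
      rcases Nat.le_succ_iff.1 hi with h | rfl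
      · exact Or.inl ⟨i, h, hf⟩
      · exact Or.inr hf

theorem exists_lt (k : ℕ) (f : ℕ → X → Bool) (N : ℕ) (h : ∀ i < k, CircuitCost S N {f i}) :
    CircuitCost S (k * (N + 1)) {fun x => decide (∃ i < k, f i x = true)} := by
  induction k with
  | zero =>
    refine (mem (f := fun _ => false) (Or.inr ⟨false, rfl⟩)).mono (by omega) ?_
    simp
  | succ k ih =>
    refine ((ih fun i hi => h i (by omega)).comp_gate or (h k (by omega))).mono
      (by rw [Nat.succ_mul]; omega) ?_
    rw [Set.singleton_subset_iff, Set.mem_singleton_iff]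
    funext x
    rw [Bool.eq_iff_iff]
    simp only [decide_eq_true_eq, Bool.or_eq_true]
    constructor
    · rintro ⟨i, hi, hf⟩
      rcases Nat.lt_succ_iff_lt_or_eq.1 hi with h | rfl
      · exact Or.inl ⟨i, h, hf⟩
      · exact Or.inr hf
    · rintro (⟨i, hi, hf⟩ | hf)
      · exact ⟨i, by omega, hf⟩
      · exact ⟨k, by omega, hf⟩

end CircuitCost

/-! ### Bits of integers -/

theorem int_testBit_eq (a : ℤ) (i : ℕ) : a.testBit i = decide (a / 2 ^ i % 2 = 1) := by
  cases a with
  | ofNat m =>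
    rw [Int.testBit, Nat.testBit_eq_decide_div_mod_eq]
    have : (Int.ofNat m : ℤ) / 2 ^ i % 2 = ((m / 2 ^ i % 2 : ℕ) : ℤ) := by push_cast; rfl
    rw [this]
    rw [decide_eq_decide]
    omega
  | negSucc m =>
    rw [Int.testBit, Nat.testBit_eq_decide_div_mod_eq]
    have hp : (0 : ℤ) < 2 ^ i := by positivity
    have : (Int.negSucc m : ℤ) / 2 ^ i = -(((m / 2 ^ i : ℕ) : ℤ) + 1) := by
      rw [Int.negSucc_ediv _ hp]; push_cast; rfl
    rw [this, ← decide_not, decide_eq_decide]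
    omega

/-- The `i`-th bit of an integer-valued function. -/
def bitFn (a : X → ℤ) (i : ℕ) : X → Bool := fun x => (a x).testBit i

/-- The `w` lowest bits of an integer-valued function, in two's complement. -/
def bitFns (w : ℕ) (a : X → ℤ) : Set (X → Bool) := {f | ∃ i < w, f = bitFn a i}

theorem bitFn_mem {w i : ℕ} (a : X → ℤ) (h : i < w) : bitFn a i ∈ bitFns w a := ⟨i, h, rfl⟩

theorem bitFns_mono {w w' : ℕ} (a : X → ℤ) (h : w ≤ w') : bitFns w a ⊆ bitFns w' a := by
  rintro f ⟨i, hi, rfl⟩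
  exact ⟨i, by omega, rfl⟩

theorem bitFn_of_lt {a : X → ℤ} {w i : ℕ} (ha : ∀ x, 0 ≤ a x ∧ a x < 2 ^ w) (hi : w ≤ i) :
    bitFn a i = fun _ => false := by
  funext x
  rw [bitFn, int_testBit_eq, Int.ediv_eq_zero_of_lt (ha x).1
    ((ha x).2.trans_le (pow_le_pow_right₀ (by norm_num) hi))]
  rfl

theorem bitFns_subset_of_lt {a : X → ℤ} {w : ℕ} (ha : ∀ x, 0 ≤ a x ∧ a x < 2 ^ w) (w' : ℕ) :
    bitFns w' a ⊆ bitFns w a ∪ constFns X := by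
  rintro f ⟨i, -, rfl⟩
  by_cases hi : i < w
  · exact Or.inl ⟨i, hi, rfl⟩
  · exact Or.inr ⟨false, bitFn_of_lt ha (not_lt.1 hi)⟩

theorem bitFns_subset_of_abs_lt {a : X → ℤ} {k : ℕ} (ha : ∀ x, (a x).natAbs < 2 ^ k) (w' : ℕ) :
    bitFns w' a ⊆ bitFns (k + 1) a := by
  rintro f ⟨i, -, rfl⟩
  by_cases hi : i < k + 1
  · exact ⟨i, hi, rfl⟩
  · refine ⟨k, by omega, funext fun x => ?_⟩
    have hx : ∀ j, k ≤ j → a x / 2 ^ j = if 0 ≤ a x then 0 else -1 := by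
      intro j hj
      have h1 : ((a x).natAbs : ℤ) < 2 ^ k := by exact_mod_cast ha x
      have h2 : (2 : ℤ) ^ k ≤ 2 ^ j := pow_le_pow_right₀ (by norm_num) hj
      split_ifs with h
      · exact Int.ediv_eq_zero_of_lt h (by omega)
      · have h3 : (a x + 1 * 2 ^ j) / 2 ^ j = 0 := Int.ediv_eq_zero_of_lt (by omega) (by omega)
        rw [Int.add_mul_ediv_right _ _ (by positivity)] at h3
        omega
    rw [bitFn, bitFn, int_testBit_eq, int_testBit_eq, hx i (by omega), hx k le_rfl]

theorem bitFn_congr {a b : X → ℤ} {w i : ℕ} (h : ∀ x, ∃ y, a x = b x + 2 ^ w * y) (hi : i < w) :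
    bitFn a i = bitFn b i := by
  funext x
  obtain ⟨y, hy⟩ := h x
  rw [bitFn, bitFn, int_testBit_eq, int_testBit_eq, hy]
  obtain ⟨e, rfl⟩ : ∃ e, w = i + 1 + e := ⟨w - (i + 1), by omega⟩
  have : b x + 2 ^ (i + 1 + e) * y = b x + (2 * (2 ^ e * y)) * 2 ^ i := by ring
  rw [this, Int.add_mul_ediv_right _ _ (by positivity), Int.add_mul_emod_self_left]

theorem bitFns_congr {a b : X → ℤ} {w : ℕ} (h : ∀ x, ∃ y, a x = b x + 2 ^ w * y) :
    bitFns w a = bitFns w b := by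
  ext f
  constructor
  · rintro ⟨i, hi, rfl⟩; exact ⟨i, hi, bitFn_congr h hi⟩
  · rintro ⟨i, hi, rfl⟩; exact ⟨i, hi, (bitFn_congr h hi).symm⟩

theorem bitFn_shift (a : X → ℤ) (j i : ℕ) :
    bitFn (fun x => 2 ^ j * a x) i = if i < j then fun _ => false else bitFn a (i - j) := by
  funext x
  split_ifs with h
  · obtain ⟨e, rfl⟩ : ∃ e, j = i + 1 + e := ⟨j - (i + 1), by omega⟩
    have : (2 : ℤ) ^ (i + 1 + e) * a x = (2 * (2 ^ e * a x)) * 2 ^ i := by ring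
    rw [bitFn, int_testBit_eq, this, Int.mul_ediv_cancel _ (by positivity)]
    simp
  · obtain ⟨e, rfl⟩ : ∃ e, i = j + e := ⟨i - j, by omega⟩
    rw [bitFn, bitFn, int_testBit_eq, int_testBit_eq, pow_add,
      Int.mul_ediv_mul_of_pos _ _ (by positivity), Nat.add_sub_cancel_left]

theorem bitFns_shift_subset (w : ℕ) (a : X → ℤ) (j : ℕ) :
    bitFns w (fun x => 2 ^ j * a x) ⊆ bitFns w a ∪ constFns X := by
  rintro f ⟨i, hi, rfl⟩
  rw [bitFn_shift]
  split_ifs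
  · exact Or.inr ⟨false, rfl⟩
  · exact Or.inl ⟨i - j, by omega, rfl⟩

/-- The block of `l` bits that starts at position `j`. -/
theorem bitFn_block (a : X → ℤ) (j l i : ℕ) :
    bitFn (fun x => a x / 2 ^ j % 2 ^ l) i = if i < l then bitFn a (j + i) else fun _ => false := by
  split_ifs with h
  · rw [bitFn_congr (b := fun x => a x / 2 ^ j) (w := l) (fun x => ⟨-(a x / 2 ^ j / 2 ^ l), ?_⟩) h]
    · funext x
      rw [bitFn, bitFn, int_testBit_eq, int_testBit_eq, pow_add, Int.ediv_ediv_of_nonneg (by positivity)]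
    · have := Int.emod_add_mul_ediv (a x / 2 ^ j) (2 ^ l)
      linarith
  · exact bitFn_of_lt (w := l) (fun x => ⟨Int.emod_nonneg _ (by positivity),
      Int.emod_lt_of_pos _ (by positivity)⟩) (not_lt.1 h)

theorem bitFns_block_subset {w : ℕ} (a : X → ℤ) (j l w' : ℕ) (h : j + l ≤ w) :
    bitFns w' (fun x => a x / 2 ^ j % 2 ^ l) ⊆ bitFns w a ∪ constFns X := by
  rintro f ⟨i, hi, rfl⟩
  rw [bitFn_block]
  split_ifs
  · exact Or.inl ⟨j + i, by omega, rfl⟩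
  · exact Or.inr ⟨false, rfl⟩

/-! ### Linear-size circuits: addition, linear combinations, division by a constant -/

/-- The ripple-carry adder. -/
theorem circuitCost_add (w : ℕ) (a b : X → ℤ) (e : ℤ) (he : e = 0 ∨ e = 1) :
    CircuitCost (bitFns w a ∪ bitFns w b) (w * 6) (bitFns w (fun x => a x + b x + e)) := by
  let c : ℕ → X → Bool := fun i x => decide (2 ^ i ≤ a x % 2 ^ i + b x % 2 ^ i + e)
  have hsum : ∀ i, bitFn (fun x => a x + b x + e) i =
      fun x => xor (xor (bitFn a i x) (bitFn b i x)) (c i x) := by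
    intro i
    funext x
    simp only [bitFn, int_testBit_eq, c]
    have hp : (0 : ℤ) < 2 ^ i := by positivity
    have h1 := Int.emod_add_mul_ediv (a x) (2 ^ i)
    have h2 := Int.emod_add_mul_ediv (b x) (2 ^ i)
    have h3 := Int.emod_nonneg (a x) hp.ne'
    have h4 := Int.emod_nonneg (b x) hp.ne'
    have h5 := Int.emod_lt_of_pos (a x) hp
    have h6 := Int.emod_lt_of_pos (b x) hp
    set A := a x % 2 ^ i
    set B := b x % 2 ^ i
    set α := a x / 2 ^ i
    set β := b x / 2 ^ i
    have e1 : (a x + b x + e) / 2 ^ i = (A + B + e) / 2 ^ i + (α + β) := by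
      rw [← Int.add_mul_ediv_right _ _ hp.ne', ← h1, ← h2]; congr 1; ring
    have e2 : (A + B + e) / 2 ^ i = if 2 ^ i ≤ A + B + e then 1 else 0 := by
      split_ifs with h
      · have : (A + B + e - 2 ^ i) / 2 ^ i = 0 := Int.ediv_eq_zero_of_lt (by omega) (by omega)
        have h7 := Int.add_mul_ediv_right (A + B + e - 2 ^ i) 1 hp.ne'
        rw [this, one_mul, sub_add_cancel] at h7
        rw [h7]; norm_num
      · exact Int.ediv_eq_zero_of_lt (by omega) (by omega)
    rw [e1, e2]
    clear_value A B α β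
    rcases Int.emod_two_eq_zero_or_one α with ha | ha <;>
    rcases Int.emod_two_eq_zero_or_one β with hb | hb <;>
    by_cases h : 2 ^ i ≤ A + B + e <;> simp [h, ha, hb, Int.add_emod]
  have hcarry : ∀ i, c (i + 1) = fun x =>
      or (and (bitFn a i x) (bitFn b i x)) (and (or (bitFn a i x) (bitFn b i x)) (c i x)) := by
    intro i
    funext x
    simp only [bitFn, int_testBit_eq, c]
    have hp : (0 : ℤ) < 2 ^ i := by positivity
    have h3 := Int.emod_nonneg (a x) hp.ne'
    have h4 := Int.emod_nonneg (b x) hp.ne'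
    have h5 := Int.emod_lt_of_pos (a x) hp
    have h6 := Int.emod_lt_of_pos (b x) hp
    have key : ∀ y : ℤ, y % 2 ^ (i + 1) = y % 2 ^ i + 2 ^ i * (y / 2 ^ i % 2) := by
      intro y
      have h := Int.ediv_ediv_of_nonneg (x := y) (z := 2) hp.le
      rw [pow_succ, Int.emod_def y (2 ^ i * 2), Int.emod_def y (2 ^ i), Int.emod_def _ 2, ← h]
      ring
    rw [key, key, pow_succ]
    set A := a x % 2 ^ i
    set B := b x % 2 ^ i
    generalize (2 : ℤ) ^ i = P at *
    rcases Int.emod_two_eq_zero_or_one (a x / P) with ha | ha <;>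
    rcases Int.emod_two_eq_zero_or_one (b x / P) with hb | hb <;>
    rw [ha, hb] <;> simp <;> omega
  have hc0 : c 0 ∈ constFns X := by
    refine ⟨decide (e = 1), funext fun x => ?_⟩
    simp only [c, pow_zero, Int.emod_one, decide_eq_decide]
    omega
  set S := bitFns w a ∪ bitFns w b
  have hchain := CircuitCost.chain (S := S) w 4 (fun i => {c i}) (by
    rw [Set.singleton_subset_iff]; exact Or.inr hc0) (by
    intro i hi
    have ma : CircuitCost (S ∪ {c i}) 0 {bitFn a i} :=
      .mem (Or.inl (Or.inl (Or.inl (bitFn_mem a hi))))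
    have mb : CircuitCost (S ∪ {c i}) 0 {bitFn b i} :=
      .mem (Or.inl (Or.inl (Or.inr (bitFn_mem b hi))))
    have mc : CircuitCost (S ∪ {c i}) 0 {c i} := .mem (Or.inl (Or.inr rfl))
    rw [hcarry i]
    exact ((ma.comp_gate and mb).comp_gate or ((ma.comp_gate or mb).comp_gate and mc)))
  refine (hchain.trans (H := bitFns w (fun x => a x + b x + e)) (m := w * 2) ?_).mono
    (by omega) Set.subset_union_right
  refine (CircuitCost.iUnion_lt w 2 (fun i => {bitFn (fun x => a x + b x + e) i})
    fun i hi => ?_).mono le_rfl ?_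
  · have ma : CircuitCost (S ∪ {f | ∃ i ≤ w, f ∈ ({c i} : Set (X → Bool))}) 0 {bitFn a i} :=
      .mem (Or.inl (Or.inl (Or.inl (bitFn_mem a hi))))
    have mb : CircuitCost (S ∪ {f | ∃ i ≤ w, f ∈ ({c i} : Set (X → Bool))}) 0 {bitFn b i} :=
      .mem (Or.inl (Or.inl (Or.inr (bitFn_mem b hi))))
    have mc : CircuitCost (S ∪ {f | ∃ i ≤ w, f ∈ ({c i} : Set (X → Bool))}) 0 {c i} :=
      .mem (Or.inl (Or.inr ⟨i, hi.le, rfl⟩))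
    rw [hsum i]
    exact ((ma.comp_gate xor mb).comp_gate xor mc)
  · rintro f ⟨i, hi, rfl⟩
    exact ⟨i, hi, rfl⟩

theorem circuitCost_not (w : ℕ) (a : X → ℤ) :
    CircuitCost (bitFns w a) w (bitFns w (fun x => -a x - 1)) := by
  refine (CircuitCost.iUnion_lt w 1 (fun i => {bitFn (fun x => -a x - 1) i})
    fun i hi => ?_).mono (by omega) ?_
  · have : bitFn (fun x => -a x - 1) i = fun x => (fun p _ => !p) (bitFn a i x) (bitFn a i x) := by
      funext x
      simp only [bitFn, int_testBit_eq]
      have hp : (0 : ℤ) < 2 ^ i := by positivity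
      have h1 := Int.emod_add_mul_ediv (a x) (2 ^ i)
      have h3 := Int.emod_nonneg (a x) hp.ne'
      have h5 := Int.emod_lt_of_pos (a x) hp
      have : (-a x - 1) / 2 ^ i = -(a x / 2 ^ i) - 1 := by
        have h7 : -a x - 1 = (2 ^ i - 1 - a x % 2 ^ i) + (-(a x / 2 ^ i) - 1) * 2 ^ i := by
          linarith
        rw [h7, Int.add_mul_ediv_right _ _ hp.ne',
          Int.ediv_eq_zero_of_lt (by omega) (by omega), zero_add]
      rw [this, ← decide_not, decide_eq_decide]
      omega
    rw [this]
    exact .gate (fun p _ => !p) (Or.inl (bitFn_mem a hi)) (Or.inl (bitFn_mem a hi))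
  · rintro f ⟨i, hi, rfl⟩
    exact ⟨i, hi, rfl⟩

theorem circuitCost_sub (w : ℕ) (a b : X → ℤ) :
    CircuitCost (bitFns w a ∪ bitFns w b) (w * 7) (bitFns w (fun x => a x - b x)) := by
  have h1 : CircuitCost (bitFns w a ∪ bitFns w b) w (bitFns w (fun x => -b x - 1)) :=
    (circuitCost_not w b).mono_left (Set.subset_union_right.trans Set.subset_union_left)
  have h2 := circuitCost_add w a (fun x => -b x - 1) 1 (Or.inr rfl)
  have e : (fun x => a x + (-b x - 1) + 1) = fun x => a x - b x := by funext x; ring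
  rw [e] at h2
  refine (h1.trans (h2.mono_left ?_)).mono (by omega) Set.subset_union_right
  rintro f (hf | hf)
  · exact Or.inl (Or.inl (Or.inl hf))
  · exact Or.inl (Or.inr hf)

theorem circuitCost_natMul (w : ℕ) (a : X → ℤ) (k : ℕ) :
    CircuitCost (bitFns w a) (k * (w * 6)) (bitFns w (fun x => (k : ℤ) * a x)) := by
  induction k with
  | zero =>
    refine (CircuitCost.of_subset ?_).mono (by omega) subset_rfl
    rintro f ⟨i, hi, rfl⟩
    refine Or.inr ⟨false, funext fun x => ?_⟩
    simp [bitFn, int_testBit_eq]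
  | succ k ih =>
    have h2 := circuitCost_add w (fun x => (k : ℤ) * a x) a 0 (Or.inl rfl)
    have e : (fun x => (k : ℤ) * a x + a x + 0) = fun x => ((k + 1 : ℕ) : ℤ) * a x := by
      funext x; push_cast; ring
    rw [e] at h2
    refine (ih.trans (h2.mono_left ?_)).mono (by rw [Nat.succ_mul]) Set.subset_union_right
    rintro f (hf | hf)
    · exact Or.inl (Or.inr hf)
    · exact Or.inl (Or.inl hf)

theorem circuitCost_intMul (w : ℕ) (a : X → ℤ) (k : ℤ) :
    CircuitCost (bitFns w a) (w * (6 * k.natAbs + 7)) (bitFns w (fun x => k * a x)) := by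
  rcases Int.natAbs_eq k with h | h
  · have := circuitCost_natMul w a k.natAbs
    rw [← h] at this
    exact this.mono (by nlinarith) subset_rfl
  · have h1 := circuitCost_natMul w a k.natAbs
    have h2 := circuitCost_sub w (fun _ => 0) (fun x => (k.natAbs : ℤ) * a x)
    have e : (fun x => 0 - (k.natAbs : ℤ) * a x) = fun x => k * a x := by
      funext x
      conv_rhs => rw [h]
      ring
    rw [e] at h2
    refine (h1.comp (h2.mono_left ?_)).mono (le_of_eq (by ring)) subset_rfl
    rintro f (⟨i, hi, rfl⟩ | hf)
    · refine Or.inr ⟨false, funext fun x => ?_⟩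
      simp [bitFn, int_testBit_eq]
    · exact Or.inl hf

theorem circuitCost_sum {S : Set (X → Bool)} (w r N : ℕ) (a : ℕ → X → ℤ)
    (h : ∀ t < r, CircuitCost S N (bitFns w (a t))) :
    CircuitCost S (r * (N + w * 6)) (bitFns w (fun x => ∑ t ∈ Finset.range r, a t x)) := by
  induction r with
  | zero =>
    refine (CircuitCost.of_subset ?_).mono (by omega) subset_rfl
    rintro f ⟨i, hi, rfl⟩
    refine Or.inr ⟨false, funext fun x => ?_⟩
    simp [bitFn, int_testBit_eq]
  | succ r ih =>
    have h2 := circuitCost_add w (fun x => ∑ t ∈ Finset.range r, a t x) (a r) 0 (Or.inl rfl)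
    have e : (fun x => ∑ t ∈ Finset.range r, a t x + a r x + 0) =
        fun x => ∑ t ∈ Finset.range (r + 1), a t x := by
      funext x; rw [Finset.sum_range_succ, add_zero]
    rw [e] at h2
    exact (((ih fun t ht => h t (by omega)).union (h r (by omega))).comp h2).mono
      (by rw [Nat.succ_mul]; omega) subset_rfl

/-- Schoolbook division by a fixed number `D`, with the running remainder in one-hot encoding. -/
theorem circuitCost_div (w D : ℕ) (hD : 0 < D) (y : X → ℤ) (hy : ∀ x, 0 ≤ y x ∧ y x < 2 ^ w) :
    CircuitCost (bitFns w y) (w * (2 * (D + 1) * (2 * D))) (bitFns w (fun x => y x / D)) := by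
  have hDz : (0 : ℤ) < D := by exact_mod_cast hD
  -- `R i v`: the remainder of the number formed by the bits from position `i` on is `v`
  let R : ℕ → ℕ → X → Bool := fun i v x => decide (y x / 2 ^ i % D = v)
  have hhalf : ∀ x i, y x / 2 ^ i = 2 * (y x / 2 ^ (i + 1)) + y x / 2 ^ i % 2 := by
    intro x i
    rw [pow_succ, ← Int.ediv_ediv_of_nonneg (by positivity)]
    omega
  have hbit : ∀ x i, y x / 2 ^ i % 2 = if bitFn y i x then 1 else 0 := by
    intro x i
    simp only [bitFn, int_testBit_eq, decide_eq_true_eq]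
    split_ifs <;> omega
  have hrem : ∀ x i, ∃ v < D, y x / 2 ^ (i + 1) % D = v := by
    intro x i
    have h1 := Int.emod_nonneg (y x / 2 ^ (i + 1)) hDz.ne'
    have h2 := Int.emod_lt_of_pos (y x / 2 ^ (i + 1)) hDz
    exact ⟨(y x / 2 ^ (i + 1) % D).toNat, by omega, by omega⟩
  have hR : ∀ i v', R i v' = fun x => decide (∃ v < D,
      (R (i + 1) v x && decide ((2 * v + if bitFn y i x then 1 else 0) % D = v')) = true) := by
    intro i v'
    funext x
    simp only [R, Bool.and_eq_true, decide_eq_true_eq, decide_eq_decide]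
    obtain ⟨v, hv, hvr⟩ := hrem x i
    have e : y x / 2 ^ i % D = (((2 * v + if bitFn y i x then 1 else 0) % D : ℕ) : ℤ) := by
      rw [hhalf x i, hbit x i, Int.add_emod, Int.mul_emod, hvr]
      push_cast
      simp [Int.add_emod, Int.mul_emod]
    rw [e]
    constructor
    · intro h
      exact ⟨v, hv, hvr, by exact_mod_cast h⟩
    · rintro ⟨u, hu, hur, h⟩
      rw [hvr] at hur
      have : v = u := by exact_mod_cast hur
      rw [this]; exact_mod_cast h
  have hQ : ∀ i, bitFn (fun x => y x / D) i = fun x => decide (∃ v < D,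
      (R (i + 1) v x && decide (D ≤ 2 * v + if bitFn y i x then 1 else 0)) = true) := by
    intro i
    funext x
    simp only [R, Bool.and_eq_true, decide_eq_true_eq]
    obtain ⟨v, hv, hvr⟩ := hrem x i
    have hq := Int.emod_add_mul_ediv (y x / 2 ^ (i + 1)) D
    have e1 : y x / D / 2 ^ i = y x / 2 ^ i / D := by
      rw [Int.ediv_ediv_of_nonneg hDz.le, mul_comm, ← Int.ediv_ediv_of_nonneg (by positivity)]
    have e2 : y x / 2 ^ i / D = (2 * v + if bitFn y i x then 1 else 0 : ℕ) / (D : ℤ) +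
        2 * (y x / 2 ^ (i + 1) / D) := by
      rw [← Int.add_mul_ediv_right _ _ hDz.ne', hhalf x i, hbit x i]
      congr 1
      push_cast
      rw [hvr] at hq
      linarith
    have e3 : ((2 * v + if bitFn y i x then 1 else 0 : ℕ) : ℤ) / (D : ℤ) =
        if D ≤ 2 * v + (if bitFn y i x then 1 else 0) then 1 else 0 := by
      have hb : (if bitFn y i x then 1 else 0) ≤ 1 := by split_ifs <;> omega
      generalize (if bitFn y i x then 1 else 0) = β at hb ⊢
      have : (((2 * v + β : ℕ) : ℤ)) / (D : ℤ) = (((2 * v + β) / D : ℕ) : ℤ) := by push_cast; rfl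
      rw [this]
      split_ifs with h
      · have : (2 * v + β) / D = 1 := by
          rw [Nat.div_eq_iff (by omega)]; constructor <;> omega
        rw [this]; rfl
      · rw [Nat.div_eq_of_lt (by omega)]; rfl
    conv_lhs => rw [bitFn, int_testBit_eq, e1, e2, e3]
    rw [decide_eq_decide]
    constructor
    · intro h
      refine ⟨v, hv, hvr, ?_⟩
      by_contra hc
      rw [if_neg hc] at h
      omega
    · rintro ⟨u, hu, hur, h⟩
      rw [hvr] at hur
      have : v = u := by exact_mod_cast hur
      rw [this, if_pos h]
      omega
  let F : ℕ → Set (X → Bool) := fun j =>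
    {f | (∃ v < D, f = R (w - j) v) ∨ (0 < j ∧ f = bitFn (fun x => y x / D) (w - j))}
  have hchain := CircuitCost.chain (S := bitFns w y) w (2 * (D + 1) * (2 * D)) F (by
    rintro f (⟨v, hv, rfl⟩ | ⟨h, -⟩)
    · refine Or.inr ⟨decide (0 = v), funext fun x => ?_⟩
      simp only [R, Nat.sub_zero, decide_eq_decide]
      rw [Int.ediv_eq_zero_of_lt (hy x).1 (hy x).2, Int.zero_emod]
      omega
    · omega) (by
    intro j hj
    obtain ⟨i, hi⟩ : ∃ i, w - j = i + 1 := ⟨w - j - 1, by omega⟩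
    have hi' : w - (j + 1) = i := by omega
    have hiw : i < w := by omega
    have hmem : ∀ v < D, R (i + 1) v ∈ bitFns w y ∪ F j ∪ constFns X := fun v hv =>
      Or.inl (Or.inr (Or.inl ⟨v, hv, by rw [hi]⟩))
    have hmemb : bitFn y i ∈ bitFns w y ∪ F j ∪ constFns X :=
      Or.inl (Or.inl (bitFn_mem y hiw))
    have c1 : CircuitCost (bitFns w y ∪ F j) (D * (D * (1 + 1)))
        {f | ∃ v < D, f ∈ ({R i v} : Set (X → Bool))} :=
      CircuitCost.iUnion_lt D _ _ fun v' _ => by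
        rw [hR i v']
        exact CircuitCost.exists_lt D (fun v x => R (i + 1) v x &&
            decide ((2 * v + if bitFn y i x then 1 else 0) % D = v')) 1 fun v hv =>
          CircuitCost.gate (fun p b => p && decide ((2 * v + if b then 1 else 0) % D = v'))
            (hmem v hv) hmemb
    have c2 : CircuitCost (bitFns w y ∪ F j) (D * (1 + 1)) {bitFn (fun x => y x / D) i} := by
      rw [hQ i]
      exact CircuitCost.exists_lt D (fun v x => R (i + 1) v x &&
            decide (D ≤ 2 * v + if bitFn y i x then 1 else 0)) 1 fun v hv =>
          CircuitCost.gate (fun p b => p && decide (D ≤ 2 * v + if b then 1 else 0))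
            (hmem v hv) hmemb
    refine (c1.union c2).mono (by nlinarith) ?_
    rintro f (⟨v, hv, rfl⟩ | ⟨-, rfl⟩)
    · exact Or.inl ⟨v, hv, by rw [hi']; rfl⟩
    · exact Or.inr (by rw [hi']; rfl))
  refine hchain.mono le_rfl ?_
  rintro f ⟨i, hi, rfl⟩
  exact ⟨w - i, by omega, Or.inr ⟨by omega, by congr 1; omega⟩⟩

/-! ### Fast multiplication -/

/-- `N` gates suffice to multiply two natural numbers of `k` bits. -/
def MulBound (k N : ℕ) : Prop :=
  ∀ (X : Type) (a b : X → ℤ), (∀ x, 0 ≤ a x ∧ a x < 2 ^ k) → (∀ x, 0 ≤ b x ∧ b x < 2 ^ k) →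
    CircuitCost (bitFns k a ∪ bitFns k b) N (bitFns (2 * k) (fun x => a x * b x))

theorem MulBound.mono {k k' N N' : ℕ} (h : MulBound k N) (hk : k' ≤ k) (hN : N ≤ N') :
    MulBound k' N' := by
  intro X a b ha hb
  have up : ∀ {c : ℤ}, 0 ≤ c ∧ c < 2 ^ k' → 0 ≤ c ∧ c < 2 ^ k := fun hc =>
    ⟨hc.1, hc.2.trans_le (pow_le_pow_right₀ (by norm_num) hk)⟩
  refine ((h X a b (fun x => up (ha x)) (fun x => up (hb x))).mono_left ?_).mono hN
    (bitFns_mono _ (by omega))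
  rintro f (hf | hf)
  · rcases bitFns_subset_of_lt ha k hf with hf | hf
    exacts [Or.inl (Or.inl hf), Or.inr hf]
  · rcases bitFns_subset_of_lt hb k hf with hf | hf
    exacts [Or.inl (Or.inr hf), Or.inr hf]

/-- The bits of a number that is switched on or off by a control bit. -/
theorem circuitCost_and {S : Set (X → Bool)} (w : ℕ) (σ : X → Bool) (b : X → ℤ)
    (hσ : σ ∈ S ∪ constFns X) (hb : bitFns w b ⊆ S ∪ constFns X) :
    CircuitCost S w (bitFns w (fun x => if σ x then b x else 0)) := by
  refine (CircuitCost.iUnion_lt w 1 (fun i => {bitFn (fun x => if σ x then b x else 0) i})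
    fun i hi => ?_).mono (by omega) ?_
  · have : bitFn (fun x => if σ x then b x else 0) i = fun x => and (σ x) (bitFn b i x) := by
      funext x
      cases h : σ x <;> simp [bitFn, int_testBit_eq, h]
    rw [this]
    exact .gate and hσ (hb (bitFn_mem b hi))
  · rintro f ⟨i, hi, rfl⟩
    exact ⟨i, hi, rfl⟩

theorem sum_testBit {k : ℕ} {a : ℤ} (h : 0 ≤ a ∧ a < 2 ^ k) :
    a = ∑ i ∈ Finset.range k, if a.testBit i then 2 ^ i else 0 := by
  have key : ∀ k, a % 2 ^ k = ∑ i ∈ Finset.range k, if a.testBit i then 2 ^ i else 0 := by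
    intro k
    induction k with
    | zero => simp
    | succ k ih =>
      have hp : (0 : ℤ) < 2 ^ k := by positivity
      have h := Int.ediv_ediv_of_nonneg (x := a) (z := 2) hp.le
      rw [Finset.sum_range_succ, ← ih, int_testBit_eq, pow_succ, Int.emod_def a (2 ^ k * 2),
        Int.emod_def a (2 ^ k), ← h]
      simp only [decide_eq_true_eq]
      split_ifs with h1
      · have : a / 2 ^ k = 2 * (a / 2 ^ k / 2) + 1 := by omega
        linear_combination (2 : ℤ) ^ k * this
      · have : a / 2 ^ k = 2 * (a / 2 ^ k / 2) := by omega
        linear_combination (2 : ℤ) ^ k * this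
  rw [← key, Int.emod_eq_of_lt h.1 h.2]

theorem exists_mulBound (k : ℕ) : ∃ N, MulBound k N := by
  refine ⟨k * (2 * k + 2 * k * 6), fun X a b ha hb => ?_⟩
  have := circuitCost_sum (S := bitFns k a ∪ bitFns k b) (2 * k) k (2 * k)
    (fun i x => if bitFn a i x then 2 ^ i * b x else 0) (fun i hi =>
      circuitCost_and (2 * k) (bitFn a i) (fun x => 2 ^ i * b x)
        (Or.inl (Or.inl (bitFn_mem a hi))) (by
          intro f hf
          rcases bitFns_shift_subset _ _ _ hf with hf | hf
          · rcases bitFns_subset_of_lt hb _ hf with hf | hf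
            exacts [Or.inl (Or.inr hf), Or.inr hf]
          · exact Or.inr hf))
  have e : (fun x => ∑ i ∈ Finset.range k, if bitFn a i x then 2 ^ i * b x else 0) =
      fun x => a x * b x := by
    funext x
    conv_rhs => rw [sum_testBit (ha x), Finset.sum_mul]
    exact Finset.sum_congr rfl fun i _ => by simp only [ite_mul, zero_mul]; rfl
  rwa [e] at this

/-- Interpolation at the points `0, …, n - 1` with integral weights and a common denominator. -/
theorem exists_interpolation (n : ℕ) : ∃ (Δ : ℕ) (w : ℕ → ℕ → ℤ), 0 < Δ ∧
    ∀ P : Polynomial ℤ, P.natDegree < n → ∀ z : ℤ, Δ * P.eval z =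
      ∑ t ∈ Finset.range n, ∑ m ∈ Finset.range n, w t m * (z ^ m * P.eval (t : ℤ)) := by
  let V : Matrix (Fin n) (Fin n) ℤ := vandermonde fun t : Fin n => ((t : ℕ) : ℤ)
  have hV : V.det ≠ 0 := by
    rw [det_vandermonde_ne_zero_iff]
    intro i j h
    have h' : ((i : ℕ) : ℤ) = ((j : ℕ) : ℤ) := h
    exact Fin.ext (by exact_mod_cast h')
  refine ⟨(V.det ^ 2).toNat, fun t m => if h : t < n ∧ m < n then
    V.det * V.adjugate ⟨m, h.2⟩ ⟨t, h.1⟩ else 0, ?_, fun P hP z => ?_⟩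
  · have : 0 < V.det ^ 2 := by positivity
    omega
  · have hΔ : (((V.det ^ 2).toNat : ℕ) : ℤ) = V.det ^ 2 := Int.toNat_of_nonneg (by positivity)
    rw [hΔ]
    let p : Fin n → ℤ := fun m => P.coeff m
    have hev : ∀ z : ℤ, P.eval z = ∑ m : Fin n, p m * z ^ (m : ℕ) := by
      intro z
      rw [Polynomial.eval_eq_sum_range' hP, Finset.sum_range]
    have hVp : V *ᵥ p = fun t : Fin n => P.eval ((t : ℕ) : ℤ) := by
      funext t
      rw [hev]
      simp [V, vandermonde_apply, mulVec, dotProduct, mul_comm]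
    have hp : V.det • p = V.adjugate *ᵥ fun t : Fin n => P.eval ((t : ℕ) : ℤ) := by
      rw [← hVp, mulVec_mulVec, adjugate_mul, smul_mulVec, one_mulVec]
    rw [hev z, Finset.sum_range, Finset.mul_sum, Finset.sum_congr rfl fun t _ => Finset.sum_range _,
      Finset.sum_comm]
    refine Finset.sum_congr rfl fun m _ => ?_
    have := congrFun hp m
    simp only [Pi.smul_apply, smul_eq_mul, mulVec, dotProduct] at this
    rw [show V.det ^ 2 * (p m * z ^ (m : ℕ)) = V.det * z ^ (m : ℕ) * (V.det * p m) by ring, this,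
      Finset.mul_sum]
    refine Finset.sum_congr rfl fun t _ => ?_
    simp only [t.2, m.2, and_self, dite_true, Fin.eta]
    ring

theorem sum_blocks {r l : ℕ} {a : ℤ} (h : 0 ≤ a ∧ a < 2 ^ (r * l)) :
    a = ∑ i ∈ Finset.range r, a / 2 ^ (l * i) % 2 ^ l * (2 ^ l) ^ i := by
  have key : ∀ r, a % 2 ^ (r * l) = ∑ i ∈ Finset.range r, a / 2 ^ (l * i) % 2 ^ l * (2 ^ l) ^ i := by
    intro r
    induction r with
    | zero => simp
    | succ r ih =>
      have hp : (0 : ℤ) < 2 ^ (l * r) := by positivity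
      have h := Int.ediv_ediv_of_nonneg (x := a) (z := 2 ^ l) hp.le
      rw [Finset.sum_range_succ, ← ih, Nat.succ_mul, mul_comm r l, pow_add, ← pow_mul,
        Int.emod_def a (2 ^ (l * r) * 2 ^ l), Int.emod_def a (2 ^ (l * r)), ← h,
        Int.emod_def (a / 2 ^ (l * r))]
      ring
  rw [← key, Int.emod_eq_of_lt h.1 h.2]

/-- One level of the Toom–Cook algorithm: split both factors into `r` blocks of `l` bits, evaluate
the two polynomials at `2 r - 1` points, multiply the values, and combine the products by
interpolation, which includes one exact division by a constant. -/
theorem toomCook_step (r : ℕ) (hr : 0 < r) : ∃ c D₀ : ℕ, ∀ l N : ℕ, MulBound (l + c) N →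
    MulBound (r * l) ((2 * r - 1) * N + D₀ * (l + 1)) := by
  obtain ⟨Δ, w, hΔ, hw⟩ := exists_interpolation (2 * r - 1)
  set n := 2 * r - 1 with hn
  -- bounds for the weights, for the evaluation points, and for the growth of the numbers
  let ω := ∑ t ∈ Finset.range n, ∑ m ∈ Finset.range n, (w t m).natAbs
  have hω : ∀ t < n, ∀ m < n, (w t m).natAbs ≤ ω := fun t ht m hm =>
    (Finset.single_le_sum (f := fun m => (w t m).natAbs) (fun _ _ => Nat.zero_le _)
      (Finset.mem_range.2 hm)).trans
    (Finset.single_le_sum (f := fun t => ∑ m ∈ Finset.range n, (w t m).natAbs)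
      (fun _ _ => Nat.zero_le _) (Finset.mem_range.2 ht))
  let c := r * (2 * r) ^ r
  let E := r * (6 * (2 * r) ^ r + 7 + 6)
  let D₁ := n * (n * (6 * ω + 7 + 6) + 6) + 2 * (Δ + 1) * (2 * Δ)
  refine ⟨c, n * (2 * (E * (c + 1))) + (2 * r + Δ) * D₁, fun l N hM X a b ha hb => ?_⟩
  let W := 2 * (r * l) + Δ
  have evalpt : ∀ (u : X → ℤ), (∀ x, 0 ≤ u x ∧ u x < 2 ^ (r * l)) → ∀ t < n,
      CircuitCost (bitFns (r * l) u) ((l + c) * E)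
        (bitFns (l + c) (fun x => ∑ i ∈ Finset.range r, (t : ℤ) ^ i * (u x / 2 ^ (l * i) % 2 ^ l))) ∧
      ∀ x, 0 ≤ ∑ i ∈ Finset.range r, (t : ℤ) ^ i * (u x / 2 ^ (l * i) % 2 ^ l) ∧
        ∑ i ∈ Finset.range r, (t : ℤ) ^ i * (u x / 2 ^ (l * i) % 2 ^ l) < 2 ^ (l + c) := by
    intro u hu t ht
    have htr : ∀ i < r, t ^ i ≤ (2 * r) ^ r := fun i hi =>
      (Nat.pow_le_pow_left (by omega) i).trans (Nat.pow_le_pow_right (by omega) hi.le)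
    refine ⟨?_, fun x => ⟨Finset.sum_nonneg fun i _ => mul_nonneg (by positivity)
      (Int.emod_nonneg _ (by positivity)), ?_⟩⟩
    · refine (circuitCost_sum (l + c) r ((l + c) * (6 * (2 * r) ^ r + 7))
        (fun i x => (t : ℤ) ^ i * (u x / 2 ^ (l * i) % 2 ^ l)) fun i hi => ?_).mono
        (le_of_eq (by simp only [E]; ring)) subset_rfl
      have h1 := circuitCost_intMul (l + c) (fun x => u x / 2 ^ (l * i) % 2 ^ l) ((t : ℤ) ^ i)
      refine (h1.mono_left (bitFns_block_subset u (l * i) l (l + c) ?_)).mono ?_ subset_rfl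
      · have : l * (i + 1) ≤ l * r := Nat.mul_le_mul_left l hi
        rw [mul_comm r l]; linarith
      · have : ((t : ℤ) ^ i).natAbs = t ^ i := by rw [Int.natAbs_pow, Int.natAbs_natCast]
        rw [this]
        have := htr i hi
        gcongr
    · have h1 : ∑ i ∈ Finset.range r, (t : ℤ) ^ i * (u x / 2 ^ (l * i) % 2 ^ l) ≤
          ∑ i ∈ Finset.range r, (((2 * r) ^ r : ℕ) : ℤ) * (2 ^ l - 1) := by
        refine Finset.sum_le_sum fun i hi => mul_le_mul ?_ ?_
          (Int.emod_nonneg _ (by positivity)) (by positivity)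
        · exact_mod_cast htr i (Finset.mem_range.1 hi)
        · have := Int.emod_lt_of_pos (u x / 2 ^ (l * i)) (by positivity : (0 : ℤ) < 2 ^ l)
          omega
      rw [Finset.sum_const, Finset.card_range, nsmul_eq_mul, ← mul_assoc] at h1
      have h2 : ((r : ℤ) * (((2 * r) ^ r : ℕ) : ℤ)) = ((c : ℕ) : ℤ) := by simp [c]
      rw [h2] at h1
      have h3 : ((c : ℕ) : ℤ) < 2 ^ c := by exact_mod_cast Nat.lt_two_pow_self
      have h4 : (0 : ℤ) < 2 ^ l := by positivity
      have h5 : (0 : ℤ) ≤ ((c : ℕ) : ℤ) := by positivity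
      rw [pow_add]
      nlinarith
  let Av : ℕ → X → ℤ := fun t x => ∑ i ∈ Finset.range r, (t : ℤ) ^ i * (a x / 2 ^ (l * i) % 2 ^ l)
  let Bv : ℕ → X → ℤ := fun t x => ∑ i ∈ Finset.range r, (t : ℤ) ^ i * (b x / 2 ^ (l * i) % 2 ^ l)
  set S := bitFns (r * l) a ∪ bitFns (r * l) b
  have hprod : ∀ t < n, CircuitCost S (2 * ((l + c) * E) + N)
      (bitFns (2 * (l + c)) (fun x => Av t x * Bv t x)) := by
    intro t ht
    obtain ⟨a1, a2⟩ := evalpt a ha t ht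
    obtain ⟨b1, b2⟩ := evalpt b hb t ht
    have h1 := (a1.mono_left (S' := S) (Set.subset_union_left.trans Set.subset_union_left)).union
      (b1.mono_left (S' := S) (Set.subset_union_right.trans Set.subset_union_left))
    exact (h1.comp (hM X (Av t) (Bv t) a2 b2)).mono (by omega) subset_rfl
  have hprodlt : ∀ t < n, ∀ x, 0 ≤ Av t x * Bv t x ∧ Av t x * Bv t x < 2 ^ (2 * (l + c)) := by
    intro t ht x
    obtain ⟨a1, a2⟩ := (evalpt a ha t ht).2 x
    obtain ⟨b1, b2⟩ := (evalpt b hb t ht).2 x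
    refine ⟨mul_nonneg a1 b1, ?_⟩
    rw [two_mul, pow_add]
    exact mul_lt_mul'' a2 b2 a1 b1
  have hall := CircuitCost.iUnion_lt (S := S) n _
    (fun t => bitFns (2 * (l + c)) (fun x => Av t x * Bv t x)) hprod
  -- the interpolated value is `Δ * (a * b)`
  have hval : ∀ x, ∑ t ∈ Finset.range n, ∑ m ∈ Finset.range n,
      w t m * (2 ^ (l * m) * (Av t x * Bv t x)) = Δ * (a x * b x) := by
    intro x
    let PA : Polynomial ℤ := ∑ i ∈ Finset.range r,
      Polynomial.monomial i (a x / 2 ^ (l * i) % 2 ^ l)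
    let PB : Polynomial ℤ := ∑ i ∈ Finset.range r,
      Polynomial.monomial i (b x / 2 ^ (l * i) % 2 ^ l)
    have hdeg : ∀ u : ℕ → ℤ, (∑ i ∈ Finset.range r, Polynomial.monomial i (u i)).natDegree ≤ r - 1 :=
      fun u => Polynomial.natDegree_sum_le_of_forall_le _ _ fun i hi =>
        (Polynomial.natDegree_monomial_le _).trans (by have := Finset.mem_range.1 hi; omega)
    have hd : (PA * PB).natDegree < n :=
      (Polynomial.natDegree_mul_le_of_le (hdeg _) (hdeg _)).trans_lt (by omega)
    have hA : ∀ t : ℕ, PA.eval (t : ℤ) = Av t x := fun t => by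
      simp only [PA, Av, Polynomial.eval_finsetSum, Polynomial.eval_monomial]
      exact Finset.sum_congr rfl fun i _ => mul_comm _ _
    have hB : ∀ t : ℕ, PB.eval (t : ℤ) = Bv t x := fun t => by
      simp only [PB, Bv, Polynomial.eval_finsetSum, Polynomial.eval_monomial]
      exact Finset.sum_congr rfl fun i _ => mul_comm _ _
    have hA2 : PA.eval (2 ^ l) = a x := by
      simp only [PA, Polynomial.eval_finsetSum, Polynomial.eval_monomial]
      exact (sum_blocks (ha x)).symm
    have hB2 : PB.eval (2 ^ l) = b x := by
      simp only [PB, Polynomial.eval_finsetSum, Polynomial.eval_monomial]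
      exact (sum_blocks (hb x)).symm
    have := hw (PA * PB) hd (2 ^ l)
    simp only [Polynomial.eval_mul, hA, hB, hA2, hB2, ← pow_mul] at this
    exact this.symm
  have habn : ∀ x, 0 ≤ a x * b x ∧ a x * b x < 2 ^ (2 * (r * l)) := by
    intro x
    refine ⟨mul_nonneg (ha x).1 (hb x).1, ?_⟩
    rw [two_mul, pow_add]
    exact mul_lt_mul'' (ha x).2 (hb x).2 (ha x).1 (hb x).1
  have hlin : CircuitCost {f | ∃ t < n, f ∈ bitFns (2 * (l + c)) (fun x => Av t x * Bv t x)}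
      (n * (n * (W * (6 * ω + 7) + W * 6) + W * 6)) (bitFns W (fun x => Δ * (a x * b x))) := by
    have e : (fun x => (Δ : ℤ) * (a x * b x)) = fun x => ∑ t ∈ Finset.range n,
        ∑ m ∈ Finset.range n, w t m * (2 ^ (l * m) * (Av t x * Bv t x)) :=
      funext fun x => (hval x).symm
    rw [e]
    refine circuitCost_sum W n _ (fun t x => ∑ m ∈ Finset.range n,
      w t m * (2 ^ (l * m) * (Av t x * Bv t x))) fun t ht => ?_
    refine circuitCost_sum W n _ (fun m x => w t m * (2 ^ (l * m) * (Av t x * Bv t x)))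
      fun m hm => ?_
    refine ((circuitCost_intMul W (fun x => 2 ^ (l * m) * (Av t x * Bv t x)) (w t m)).mono_left
      ?_).mono (by have := hω t ht m hm; gcongr) subset_rfl
    intro f hf
    rcases bitFns_shift_subset _ _ _ hf with hf | hf
    · rcases bitFns_subset_of_lt (hprodlt t ht) _ hf with hf | hf
      exacts [Or.inl ⟨t, ht, hf⟩, Or.inr hf]
    · exact Or.inr hf
  have hdiv := circuitCost_div W Δ hΔ (fun x => (Δ : ℤ) * (a x * b x)) (fun x => by
    refine ⟨mul_nonneg (by positivity) (habn x).1, ?_⟩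
    rw [pow_add, mul_comm]
    refine mul_lt_mul'' (habn x).2 ?_ (habn x).1 (by positivity)
    exact_mod_cast Nat.lt_two_pow_self)
  have e : (fun x => (Δ : ℤ) * (a x * b x) / Δ) = fun x => a x * b x := by
    funext x
    exact Int.mul_ediv_cancel_left _ (by exact_mod_cast hΔ.ne')
  rw [e] at hdiv
  refine ((hall.comp hlin).comp hdiv).mono ?_ (bitFns_mono _ (by omega))
  have h1 : l + c ≤ (c + 1) * (l + 1) := by nlinarith
  have h2 : W ≤ (2 * r + Δ) * (l + 1) := by
    simp only [W]; nlinarith [Nat.zero_le (Δ * l), Nat.zero_le r]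
  have e2 : n * (2 * ((l + c) * E) + N) + n * (n * (W * (6 * ω + 7) + W * 6) + W * 6) +
      W * (2 * (Δ + 1) * (2 * Δ)) = n * N + (n * (2 * E)) * (l + c) + W * D₁ := by
    simp only [D₁]; ring
  rw [e2]
  calc n * N + (n * (2 * E)) * (l + c) + W * D₁
      ≤ n * N + (n * (2 * E)) * ((c + 1) * (l + 1)) + ((2 * r + Δ) * (l + 1)) * D₁ := by gcongr
    _ = _ := by ring

/-- Iterating the Toom–Cook step: numbers of `r ^ i` bits are multiplied by `O((2 r) ^ i)` gates. -/
theorem exists_mulBound_pow (r : ℕ) (hr : 2 ≤ r) :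
    ∃ E : ℕ, ∀ i, MulBound (r ^ i) (E * (2 * r) ^ i) := by
  obtain ⟨c, D₀, hstep⟩ := toomCook_step r (by omega)
  obtain ⟨N₀, hN₀⟩ := exists_mulBound (1 + 2 * c)
  let E := N₀ + D₀ * (2 + 2 * c)
  -- sizes slightly larger than `r ^ i` make up for the additive growth of the numbers
  have key : ∀ i, ∃ K, r ^ i + 2 * c ≤ K ∧ K ≤ r ^ i * (1 + 2 * c) ∧
      MulBound K (E * (2 * r) ^ i) := by
    intro i
    induction i with
    | zero =>
      refine ⟨1 + 2 * c, by simp, by simp, hN₀.mono le_rfl ?_⟩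
      simp only [E, pow_zero]; omega
    | succ i ih =>
      obtain ⟨K, h1, h2, h3⟩ := ih
      have hri : 1 ≤ r ^ i := Nat.one_le_pow _ _ (by omega)
      obtain ⟨l, rfl⟩ : ∃ l, K = l + c := ⟨K - c, by omega⟩
      refine ⟨r * l, ?_, ?_, (hstep l _ h3).mono le_rfl ?_⟩
      · have : r ^ i + c ≤ l := by omega
        calc r ^ (i + 1) + 2 * c ≤ r * (r ^ i + c) := by rw [pow_succ]; nlinarith
          _ ≤ r * l := Nat.mul_le_mul_left r this
      · have : l ≤ r ^ i * (1 + 2 * c) := by omega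
        calc r * l ≤ r * (r ^ i * (1 + 2 * c)) := Nat.mul_le_mul_left r this
          _ = _ := by ring
      · have hl : l + 1 ≤ (2 * r) ^ i * (2 + 2 * c) := by
          have : r ^ i ≤ (2 * r) ^ i := Nat.pow_le_pow_left (by omega) i
          calc l + 1 ≤ r ^ i * (2 + 2 * c) := by nlinarith
            _ ≤ _ := Nat.mul_le_mul_right _ this
        have hD : D₀ * (l + 1) ≤ E * (2 * r) ^ i := by
          calc D₀ * (l + 1) ≤ D₀ * ((2 * r) ^ i * (2 + 2 * c)) := Nat.mul_le_mul_left _ hl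
            _ = (D₀ * (2 + 2 * c)) * (2 * r) ^ i := by ring
            _ ≤ E * (2 * r) ^ i := Nat.mul_le_mul_right _ (by simp only [E]; omega)
        obtain ⟨s, hs⟩ : ∃ s, 2 * r = s + 1 := ⟨2 * r - 1, by omega⟩
        have hs' : 2 * r - 1 = s := by omega
        calc (2 * r - 1) * (E * (2 * r) ^ i) + D₀ * (l + 1)
            ≤ (2 * r - 1) * (E * (2 * r) ^ i) + E * (2 * r) ^ i := by gcongr
          _ = E * (2 * r) ^ (i + 1) := by rw [hs', hs]; ring
  refine ⟨E, fun i => ?_⟩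
  obtain ⟨K, h1, -, h3⟩ := key i
  exact h3.mono (by omega) le_rfl

theorem exists_mulBound_rpow (ε : ℝ) (hε : 0 < ε) :
    ∃ C : ℝ, 0 ≤ C ∧ ∀ k : ℕ, ∃ N : ℕ, MulBound k N ∧ (N : ℝ) ≤ C * ((k : ℝ) + 1) ^ (1 + ε) := by
  obtain ⟨j, hj⟩ := exists_nat_one_div_lt hε
  set r := 2 ^ (j + 1) with hr
  have hr2 : 2 ≤ r := by
    rw [hr, pow_succ]; have := Nat.one_le_two_pow (n := j); omega
  obtain ⟨E, hE⟩ := exists_mulBound_pow r hr2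
  refine ⟨E * (r : ℝ) ^ (1 + ε), by positivity, fun k => ?_⟩
  set i := Nat.clog r (k + 1)
  have hk : k + 1 ≤ r ^ i := Nat.le_pow_clog (by omega) _
  have hk' : r ^ i ≤ r * (k + 1) := by
    by_cases h : i = 0
    · rw [h, pow_zero]; nlinarith
    · have h1 : r ^ i.pred < k + 1 := by
        rcases Nat.lt_or_ge 1 (k + 1) with h2 | h2
        · exact Nat.pow_pred_clog_lt_self (by omega) h2
        · exact absurd (Nat.clog_of_right_le_one h2 r) h
      have h2 : i.pred + 1 = i := Nat.succ_pred_eq_of_ne_zero h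
      calc r ^ i = r * r ^ i.pred := by rw [← pow_succ', h2]
        _ ≤ r * (k + 1) := Nat.mul_le_mul_left _ h1.le
  refine ⟨_, (hE i).mono (by omega) le_rfl, ?_⟩
  have h2r : ((2 * r : ℕ) : ℝ) ≤ (r : ℝ) ^ (1 + ε) := by
    have h2 : (2 : ℝ) ≤ (r : ℝ) ^ ε := by
      rw [hr]; push_cast
      rw [← Real.rpow_natCast, ← Real.rpow_mul (by norm_num)]
      calc (2 : ℝ) = 2 ^ (1 : ℝ) := (Real.rpow_one 2).symm
        _ ≤ _ := by
          refine Real.rpow_le_rpow_of_exponent_le (by norm_num) ?_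
          have : (0 : ℝ) < ((j + 1 : ℕ) : ℝ) := by positivity
          rw [div_lt_iff₀ (by positivity)] at hj
          push_cast; linarith
    have hr0 : (0 : ℝ) < r := by positivity
    rw [Real.rpow_add hr0, Real.rpow_one]
    push_cast
    nlinarith
  calc (((E * (2 * r) ^ i : ℕ)) : ℝ) = E * ((2 * r : ℕ) : ℝ) ^ i := by push_cast; ring
    _ ≤ E * ((r : ℝ) ^ (1 + ε)) ^ i := by gcongr
    _ = E * ((r : ℝ) ^ i) ^ (1 + ε) := by
      rw [← Real.rpow_natCast, ← Real.rpow_natCast, ← Real.rpow_mul (by positivity),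
        ← Real.rpow_mul (by positivity), mul_comm (1 + ε)]
    _ ≤ E * ((r : ℝ) * (k + 1)) ^ (1 + ε) := by
      gcongr
      exact_mod_cast hk'
    _ = E * (r : ℝ) ^ (1 + ε) * ((k : ℝ) + 1) ^ (1 + ε) := by
      rw [Real.mul_rpow (by positivity) (by positivity)]; ring

/-! ### The cost of arithmetic instructions -/

theorem runGates_append {σ α : Type} [Inhabited α] (ev : σ → α → α → α) (x : List α)
    (G : List (Gate σ α)) (g : Gate σ α) : runGates ev x (G ++ [g]) =
      runGates ev x G ++ [ev g.op (operandVal (runGates ev x G) g.lhs)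
        (operandVal (runGates ev x G) g.rhs)] := by
  simp [runGates]

theorem runGates_length {σ α : Type} [Inhabited α] (ev : σ → α → α → α) (x : List α)
    (G : List (Gate σ α)) : (runGates ev x G).length = x.length + G.length := by
  induction G using List.reverseRecOn with
  | nil => simp [runGates]
  | append_singleton G g ih => rw [runGates_append]; simp [ih]; omega

/-- Numbering of wires: the functions produced by `Gen` are wires of an actual circuit. -/
theorem Gen.exists_gates {S T : Set (X → Bool)} {n : ℕ} (h : Gen S n T) (L : ℕ)
    (ins : X → List Bool) (hL : ∀ x, (ins x).length = L)
    (hS : ∀ f ∈ S, ∃ i < L, ∀ x, (ins x).getD i default = f x) :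
    ∃ G : List (Gate (Bool → Bool → Bool) Bool), G.length = n ∧
      ∀ f ∈ T, ∃ o : ℕ ⊕ Bool, (∀ i, o = Sum.inl i → i < L + n) ∧
        ∀ x, operandVal (runGates id (ins x) G) o = f x := by
  induction h with
  | base =>
    refine ⟨[], rfl, ?_⟩
    rintro f (hf | ⟨b, rfl⟩)
    · obtain ⟨i, hi, h⟩ := hS f hf
      exact ⟨Sum.inl i, by rintro j ⟨⟩; simpa using hi, h⟩
    · exact ⟨Sum.inr b, by rintro i ⟨⟩, fun x => rfl⟩
  | @step n T op f g _ hf hg ih =>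
    obtain ⟨G, hG, hT⟩ := ih
    obtain ⟨o, ho, hof⟩ := hT f hf
    obtain ⟨o', ho', hog⟩ := hT g hg
    refine ⟨G ++ [⟨op, o, o'⟩], by simp [hG], ?_⟩
    have hlen : ∀ x, (runGates id (ins x) G).length = L + n := fun x => by
      rw [runGates_length, hL, hG]
    rintro u (rfl | hu)
    · refine ⟨Sum.inl (L + n), by rintro i ⟨⟩; omega, fun x => ?_⟩
      rw [runGates_append, hof, hog]
      simp only [operandVal, id]
      rw [List.getD_append_right _ _ _ _ (by rw [hlen]), hlen]
      simp
    · obtain ⟨o'', hi, hu'⟩ := hT u hu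
      refine ⟨o'', fun i h => by have := hi i h; omega, fun x => ?_⟩
      rw [← hu' x, runGates_append]
      rcases o'' with i | b
      · simp only [operandVal]
        rw [List.getD_append _ _ _ _ (by rw [hlen]; exact hi i rfl)]
      · rfl

/-- The pairs of integers of absolute value less than `2 ^ k`. -/
def BoundedPair (k : ℕ) : Type := {ab : ℤ × ℤ // ab.1.natAbs < 2 ^ k ∧ ab.2.natAbs < 2 ^ k}

theorem getD_intBits {w i : ℕ} (a : ℤ) (b : Bool) (hi : i < w) :
    (intBits w a).getD i b = a.testBit i := by
  unfold intBits
  rw [List.getD_eq_getElem _ _ (by simpa using hi), List.getElem_ofFn]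

theorem opCost_le (op : IntOp) (k N : ℕ)
    (h : CircuitCost (X := BoundedPair k)
      (bitFns (k + 1) (fun x => x.1.1) ∪ bitFns (k + 1) (fun x => x.1.2)) N
      (bitFns (2 * k + 2) (fun x => op.eval x.1.1 x.1.2))) : opCost op k ≤ N := by
  obtain ⟨n, hn, T, hT, hF⟩ := h
  obtain ⟨G, hG, hG'⟩ := hT.exists_gates (2 * (k + 1))
    (fun x => intBits (k + 1) x.1.1 ++ intBits (k + 1) x.1.2)
    (fun x => by simp [intBits]; ring) (by
      rintro f (⟨i, hi, rfl⟩ | ⟨i, hi, rfl⟩)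
      · refine ⟨i, by omega, fun x => ?_⟩
        rw [List.getD_append _ _ _ _ (by simpa [intBits] using hi)]
        exact getD_intBits _ _ hi
      · refine ⟨k + 1 + i, by omega, fun x => ?_⟩
        have hl : (intBits (k + 1) x.1.1).length = k + 1 := by simp [intBits]
        rw [List.getD_append_right _ _ _ _ (by omega), hl, Nat.add_sub_cancel_left]
        exact getD_intBits _ _ hi)
  refine (Nat.sInf_le ?_).trans hn
  have hex : ∀ j, ∃ o : ℕ ⊕ Bool, j < 2 * k + 2 → ∀ x : BoundedPair k,
      operandVal (runGates id (intBits (k + 1) x.1.1 ++ intBits (k + 1) x.1.2) G) o =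
        (op.eval x.1.1 x.1.2).testBit j := by
    intro j
    by_cases hj : j < 2 * k + 2
    · obtain ⟨o, -, ho⟩ := hG' _ (hF (bitFn_mem _ hj))
      exact ⟨o, fun _ => ho⟩
    · exact ⟨Sum.inr false, fun h => absurd h hj⟩
  choose out hout using hex
  exact ⟨G, out, hG, fun a b ha hb j hj => hout j hj ⟨(a, b), ha, hb⟩⟩

theorem opCost_add_le (k : ℕ) : opCost .add k ≤ (2 * k + 2) * 6 := by
  refine opCost_le _ _ _ ?_
  have h := circuitCost_add (X := BoundedPair k) (2 * k + 2) (fun x => x.1.1) (fun x => x.1.2) 0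
    (Or.inl rfl)
  refine (h.mono_left ((Set.union_subset_union ?_ ?_).trans Set.subset_union_left)).mono le_rfl ?_
  · exact bitFns_subset_of_abs_lt (fun x => x.2.1) _
  · exact bitFns_subset_of_abs_lt (fun x => x.2.2) _
  · simp only [add_zero]; exact subset_rfl

theorem opCost_sub_le (k : ℕ) : opCost .sub k ≤ (2 * k + 2) * 7 := by
  refine opCost_le _ _ _ ?_
  have h := circuitCost_sub (X := BoundedPair k) (2 * k + 2) (fun x => x.1.1) (fun x => x.1.2)
  refine (h.mono_left ((Set.union_subset_union ?_ ?_).trans Set.subset_union_left)).mono le_rfl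
    subset_rfl
  · exact bitFns_subset_of_abs_lt (fun x => x.2.1) _
  · exact bitFns_subset_of_abs_lt (fun x => x.2.2) _

/-- Signed multiplication from unsigned multiplication: in two's complement, with sign bits `σ` and
`τ`, the product is `a' b' - 2 ^ (k + 1) (σ b' + τ a')` modulo `2 ^ (2 k + 2)`. -/
theorem opCost_mul_le (k N : ℕ) (h : MulBound (k + 1) N) :
    opCost .mul k ≤ N + (2 * k + 2) * 16 := by
  refine opCost_le _ _ _ ?_
  let Y := BoundedPair k
  let a : Y → ℤ := fun x => x.1.1
  let b : Y → ℤ := fun x => x.1.2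
  let a' : Y → ℤ := fun x => a x / 2 ^ 0 % 2 ^ (k + 1)
  let b' : Y → ℤ := fun x => b x / 2 ^ 0 % 2 ^ (k + 1)
  set S := bitFns (k + 1) a ∪ bitFns (k + 1) b with hS
  change CircuitCost S _ (bitFns (2 * k + 2) (fun x => a x * b x))
  have ha' : ∀ w, bitFns w a' ⊆ S ∪ constFns Y := by
    intro w f hf
    rcases bitFns_block_subset (w := k + 1) a 0 (k + 1) w (by omega) hf with hf | hf
    exacts [Or.inl (Or.inl hf), Or.inr hf]
  have hb' : ∀ w, bitFns w b' ⊆ S ∪ constFns Y := by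
    intro w f hf
    rcases bitFns_block_subset (w := k + 1) b 0 (k + 1) w (by omega) hf with hf | hf
    exacts [Or.inl (Or.inr hf), Or.inr hf]
  have hmod : ∀ u : ℤ, 0 ≤ u / 2 ^ 0 % 2 ^ (k + 1) ∧ u / 2 ^ 0 % 2 ^ (k + 1) < 2 ^ (k + 1) := fun u =>
    ⟨Int.emod_nonneg _ (by positivity), Int.emod_lt_of_pos _ (by positivity)⟩
  have h1 : CircuitCost S N (bitFns (2 * k + 2) (fun x => a' x * b' x)) :=
    (h Y a' b' (fun x => hmod _) (fun x => hmod _)).mono_left (Set.union_subset (ha' _) (hb' _))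
  have h2 : CircuitCost S (2 * k + 2) (bitFns (2 * k + 2) (fun x => if bitFn a k x then b' x else 0)) :=
    circuitCost_and _ _ _ (Or.inl (Or.inl (bitFn_mem a (by omega)))) (hb' _)
  have h3 : CircuitCost S (2 * k + 2) (bitFns (2 * k + 2) (fun x => if bitFn b k x then a' x else 0)) :=
    circuitCost_and _ _ _ (Or.inl (Or.inr (bitFn_mem b (by omega)))) (ha' _)
  have h4 := (h1.union h2).comp ((circuitCost_sub (2 * k + 2) (fun x => a' x * b' x)
    (fun x => 2 ^ (k + 1) * if bitFn a k x then b' x else 0)).mono_left (by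
      rintro f (hf | hf)
      · exact Or.inl (Or.inl hf)
      · rcases bitFns_shift_subset _ _ _ hf with hf | hf
        exacts [Or.inl (Or.inr hf), Or.inr hf]))
  have h5 := (h4.union h3).comp ((circuitCost_sub (2 * k + 2)
    (fun x => a' x * b' x - 2 ^ (k + 1) * if bitFn a k x then b' x else 0)
    (fun x => 2 ^ (k + 1) * if bitFn b k x then a' x else 0)).mono_left (by
      rintro f (hf | hf)
      · exact Or.inl (Or.inl hf)
      · rcases bitFns_shift_subset _ _ _ hf with hf | hf
        exacts [Or.inl (Or.inr hf), Or.inr hf]))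
  refine h5.mono (by omega) (le_of_eq (bitFns_congr fun x => ?_))
  have sgn : ∀ u : ℤ, u.natAbs < 2 ^ k →
      u = u / 2 ^ 0 % 2 ^ (k + 1) - 2 ^ (k + 1) * if u.testBit k then 1 else 0 := by
    intro u hu
    have hu' : (u.natAbs : ℤ) < 2 ^ k := by exact_mod_cast hu
    have hp : (0 : ℤ) < 2 ^ k := by positivity
    rw [pow_zero, Int.ediv_one, int_testBit_eq, pow_succ]
    by_cases h0 : 0 ≤ u
    · rw [Int.ediv_eq_zero_of_lt h0 (by omega), Int.emod_eq_of_lt h0 (by omega)]; simp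
    · have e1 : u / 2 ^ k = -1 := by
        have h3 : (u + 1 * 2 ^ k) / 2 ^ k = 0 := Int.ediv_eq_zero_of_lt (by omega) (by omega)
        rw [Int.add_mul_ediv_right _ _ hp.ne'] at h3
        omega
      have e2 : u % (2 ^ k * 2) = u + 2 ^ k * 2 := by
        rw [← Int.add_emod_right, Int.emod_eq_of_lt (by omega) (by omega)]
      rw [e1, e2]; simp
  have hA := sgn (a x) x.2.1
  have hB := sgn (b x) x.2.2
  have hσ : ∀ (σ : Bool) (u : ℤ), (if σ then u else 0) = (if σ then 1 else 0) * u := by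
    intro σ u; cases σ <;> simp
  have e1 : (if bitFn a k x then b' x else 0) = (if (a x).testBit k then 1 else 0) * b' x :=
    hσ (bitFn a k x) _
  have e2 : (if bitFn b k x then a' x else 0) = (if (b x).testBit k then 1 else 0) * a' x :=
    hσ (bitFn b k x) _
  rw [e1, e2]
  refine ⟨(if (a x).testBit k then 1 else 0) * (if (b x).testBit k then 1 else 0), ?_⟩
  linear_combination (b x) * hA +
    (a' x - 2 ^ (k + 1) * (if (a x).testBit k then 1 else 0)) * hB

/-- Addition, subtraction and multiplication of `k`-bit integers take `O(k ^ (1 + ε))` bit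
operations. -/
theorem exists_opCost_bound (ε : ℝ) (hε : 0 < ε) : ∃ C : ℝ, 0 ≤ C ∧ ∀ k : ℕ,
    ((opCost .add k + opCost .sub k + opCost .mul k : ℕ) : ℝ) ≤ C * ((k : ℝ) + 1) ^ (1 + ε) := by
  obtain ⟨C, hC, h⟩ := exists_mulBound_rpow ε hε
  refine ⟨C * 2 ^ (1 + ε) + 58, by positivity, fun k => ?_⟩
  obtain ⟨N, hN, hNC⟩ := h (k + 1)
  have h1 := opCost_add_le k
  have h2 := opCost_sub_le k
  have h3 := opCost_mul_le k N hN
  have h4 : ((opCost .add k + opCost .sub k + opCost .mul k : ℕ) : ℝ) ≤ N + 58 * ((k : ℝ) + 1) := by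
    have : opCost .add k + opCost .sub k + opCost .mul k ≤ N + 58 * (k + 1) := by omega
    exact_mod_cast this
  have h5 : (k : ℝ) + 1 ≤ ((k : ℝ) + 1) ^ (1 + ε) := by
    conv_lhs => rw [← Real.rpow_one ((k : ℝ) + 1)]
    exact Real.rpow_le_rpow_of_exponent_le (by linarith [Nat.cast_nonneg (α := ℝ) k]) (by linarith)
  have h6 : (((k + 1 : ℕ) : ℝ) + 1) ^ (1 + ε) ≤ 2 ^ (1 + ε) * ((k : ℝ) + 1) ^ (1 + ε) := by
    rw [← Real.mul_rpow (by norm_num) (by positivity)]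
    refine Real.rpow_le_rpow (by positivity) ?_ (by linarith)
    push_cast; linarith [Nat.cast_nonneg (α := ℝ) k]
  calc _ ≤ (N : ℝ) + 58 * ((k : ℝ) + 1) := h4
    _ ≤ C * (2 ^ (1 + ε) * ((k : ℝ) + 1) ^ (1 + ε)) + 58 * ((k : ℝ) + 1) ^ (1 + ε) := by
      refine add_le_add (hNC.trans (mul_le_mul_of_nonneg_left h6 hC)) ?_
      linarith
    _ = _ := by ring

/-! ### Reasoning about random access programs -/

/-- A bound for the cost of one instruction on numbers of at most `β` bits. -/
noncomputable def unitCost (β : ℕ) : ℕ :=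
  1 + 2 * β + (Finset.range (β + 1)).sup fun k => opCost .add k + opCost .sub k + opCost .mul k

/-- `v` has at most `β` bits. -/
def HasBits (β : ℕ) (v : ℤ) : Prop := v.natAbs < 2 ^ β

theorem HasBits.bitLen_le {β : ℕ} {v : ℤ} (h : HasBits β v) : bitLen v ≤ β := Nat.size_le.2 h

/-- The register contents given by the scalar registers `0, …, 31` and the memory `m`, which begins
at register `32`. -/
def glue (s m : ℕ → ℤ) : ℕ → ℤ := fun a => if a < 32 then s a else m (a - 32)

theorem glue_scalar (s m : ℕ → ℤ) {a : ℕ} (h : a < 32) : glue s m a = s a := if_pos h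

theorem update_glue_scalar (s m : ℕ → ℤ) {a : ℕ} (h : a < 32) (v : ℤ) :
    Function.update (glue s m) a v = glue (Function.update s a v) m := by
  funext i
  by_cases hi : i = a
  · subst hi; simp [glue, h]
  · simp [glue, Function.update_of_ne hi]

theorem update_glue_memory (s m : ℕ → ℤ) {a : ℕ} (h : 32 ≤ a) (v : ℤ) :
    Function.update (glue s m) a v = glue s (Function.update m (a - 32) v) := by
  funext i
  by_cases hi : i = a
  · subst hi; simp [glue, not_lt.2 h]
  · rw [Function.update_of_ne hi]
    by_cases h2 : i < 32
    · simp [glue, h2]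
    · have : i - 32 ≠ a - 32 := by omega
      simp [glue, h2, Function.update_of_ne this]

/-- The instructions without branching. -/
inductive Ins
  | const (r : ℕ) (z : ℤ)
  | add (r a b : ℕ)
  | sub (r a b : ℕ)
  | mul (r a b : ℕ)
  | read (r a : ℕ)
  | load (r a : ℕ)
  | store (a r : ℕ)

def Ins.toCmd : Ins → Cmd
  | const r z => .const r z
  | add r a b => .arith .add r a b
  | sub r a b => .arith .sub r a b
  | mul r a b => .arith .mul r a b
  | read r a => .read r a
  | load r a => .load r a
  | store a r => .store a r

/-- The effect of an instruction on the scalar registers. -/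
def Ins.scalars (inp : ℕ → ℤ) : Ins → (ℕ → ℤ) → (ℕ → ℤ) → ℕ → ℤ
  | const r z, s, _ => Function.update s r z
  | add r a b, s, _ => Function.update s r (s a + s b)
  | sub r a b, s, _ => Function.update s r (s a - s b)
  | mul r a b, s, _ => Function.update s r (s a * s b)
  | read r a, s, _ => Function.update s r (inp (s a).toNat)
  | load r a, s, m => Function.update s r (m (s a - 32).toNat)
  | store _ _, s, _ => s

/-- The effect of an instruction on the memory. -/
def Ins.memory : Ins → (ℕ → ℤ) → (ℕ → ℤ) → ℕ → ℤ
  | store a r, s, m => Function.update m (s a - 32).toNat (s r)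
  | const _ _, _, m => m
  | add _ _ _, _, m => m
  | sub _ _ _, _, m => m
  | mul _ _ _, _, m => m
  | read _ _, _, m => m
  | load _ _, _, m => m

/-- The instruction refers to scalar registers and, indirectly, to the memory only, and handles
numbers of at most `β` bits. -/
def Ins.Ok (inp : ℕ → ℤ) (β : ℕ) : Ins → (ℕ → ℤ) → (ℕ → ℤ) → Prop
  | const r z, _, _ => r < 32 ∧ HasBits β z
  | add r a b, s, _ => (r < 32 ∧ a < 32 ∧ b < 32) ∧ HasBits β (s a) ∧ HasBits β (s b)
  | sub r a b, s, _ => (r < 32 ∧ a < 32 ∧ b < 32) ∧ HasBits β (s a) ∧ HasBits β (s b)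
  | mul r a b, s, _ => (r < 32 ∧ a < 32 ∧ b < 32) ∧ HasBits β (s a) ∧ HasBits β (s b)
  | read r a, s, _ => (r < 32 ∧ a < 32) ∧ HasBits β (s a) ∧ HasBits β (inp (s a).toNat)
  | load r a, s, m => (r < 32 ∧ a < 32) ∧ 32 ≤ s a ∧ HasBits β (s a) ∧ HasBits β (m (s a - 32).toNat)
  | store a r, s, _ => (r < 32 ∧ a < 32) ∧ 32 ≤ s a ∧ HasBits β (s a) ∧ HasBits β (s r)

theorem arith_le_unitCost {β : ℕ} {u v : ℤ} (hu : HasBits β u) (hv : HasBits β v) (op : IntOp)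
    (hop : ∀ k, opCost op k ≤ opCost .add k + opCost .sub k + opCost .mul k) :
    1 + bitLen u + bitLen v + opCost op (max (bitLen u) (bitLen v)) ≤ unitCost β := by
  have h1 := hu.bitLen_le
  have h2 := hv.bitLen_le
  have h3 := Finset.le_sup (f := fun k => opCost .add k + opCost .sub k + opCost .mul k)
    (Finset.mem_range.2 (show max (bitLen u) (bitLen v) < β + 1 by omega))
  have h4 := hop (max (bitLen u) (bitLen v))
  simp only [unitCost] at *
  omega

theorem le_unitCost (β : ℕ) : 1 + 2 * β ≤ unitCost β := Nat.le_add_right _ _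

theorem Ins.run (inp : ℕ → ℤ) (β : ℕ) (i : Ins) (s m : ℕ → ℤ) (h : i.Ok inp β s m) :
    ∃ t ≤ unitCost β, Runs inp i.toCmd (glue s m) t (glue (i.scalars inp s m) (i.memory s m)) := by
  have hU := le_unitCost β
  cases i with
  | const r z =>
    obtain ⟨hr, hz⟩ := h
    have := hz.bitLen_le
    refine ⟨1 + bitLen z, by omega, ?_⟩
    rw [scalars, memory, ← update_glue_scalar _ _ hr]
    exact Runs.const _ r z
  | add r a b =>
    obtain ⟨⟨hr, ha, hb⟩, h1, h2⟩ := h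
    refine ⟨_, arith_le_unitCost h1 h2 .add fun k => by omega, ?_⟩
    rw [scalars, memory, ← update_glue_scalar _ _ hr, ← glue_scalar s m ha, ← glue_scalar s m hb]
    exact Runs.arith _ .add r a b
  | sub r a b =>
    obtain ⟨⟨hr, ha, hb⟩, h1, h2⟩ := h
    refine ⟨_, arith_le_unitCost h1 h2 .sub fun k => by omega, ?_⟩
    rw [scalars, memory, ← update_glue_scalar _ _ hr, ← glue_scalar s m ha, ← glue_scalar s m hb]
    exact Runs.arith _ .sub r a b
  | mul r a b =>
    obtain ⟨⟨hr, ha, hb⟩, h1, h2⟩ := h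
    refine ⟨_, arith_le_unitCost h1 h2 .mul fun k => by omega, ?_⟩
    rw [scalars, memory, ← update_glue_scalar _ _ hr, ← glue_scalar s m ha, ← glue_scalar s m hb]
    exact Runs.arith _ .mul r a b
  | read r a =>
    obtain ⟨⟨hr, ha⟩, h1, h2⟩ := h
    have := h1.bitLen_le
    have := h2.bitLen_le
    refine ⟨1 + bitLen (s a) + bitLen (inp (s a).toNat), by omega, ?_⟩
    rw [scalars, memory, ← update_glue_scalar _ _ hr, ← glue_scalar s m ha]
    exact Runs.read _ r a
  | load r a =>
    obtain ⟨⟨hr, ha⟩, h0, h1, h2⟩ := h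
    have := h1.bitLen_le
    have := h2.bitLen_le
    refine ⟨1 + bitLen (s a) + bitLen (m (s a - 32).toNat), by omega, ?_⟩
    have e : m (s a - 32).toNat = glue s m (s a).toNat := by
      have h3 : ¬ (s a).toNat < 32 := by omega
      rw [glue, if_neg h3]; congr 1; omega
    rw [scalars, memory, ← update_glue_scalar _ _ hr, e, ← glue_scalar s m ha]
    exact Runs.load _ r a
  | store a r =>
    obtain ⟨⟨hr, ha⟩, h0, h1, h2⟩ := h
    have := h1.bitLen_le
    have := h2.bitLen_le
    refine ⟨1 + bitLen (s a) + bitLen (s r), by omega, ?_⟩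
    have e : (s a - 32).toNat = (s a).toNat - 32 := by omega
    rw [scalars, memory, e, ← update_glue_memory _ _ (by omega), ← glue_scalar s m ha,
      ← glue_scalar s m hr]
    exact Runs.store _ a r

/-- From the given state the program halts after at most `N * unitCost β` bit operations in a state
that satisfies `Q`. -/
def Reaches (inp : ℕ → ℤ) (β : ℕ) (c : Cmd) (N : ℕ) (s m : ℕ → ℤ)
    (Q : (ℕ → ℤ) → (ℕ → ℤ) → Prop) : Prop :=
  ∃ t s' m', t ≤ N * unitCost β ∧ Runs inp c (glue s m) t (glue s' m') ∧ Q s' m'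

/-- A straight-line sequence of instructions. -/
def block : List Ins → Cmd
  | [] => .skip
  | i :: l => .seq i.toCmd (block l)

/-- Every instruction of the sequence is admissible, and the final state satisfies `Q`. -/
def blockPost (inp : ℕ → ℤ) (β : ℕ) : List Ins → (ℕ → ℤ) → (ℕ → ℤ) →
    ((ℕ → ℤ) → (ℕ → ℤ) → Prop) → Prop
  | [], s, m, Q => Q s m
  | i :: l, s, m, Q => i.Ok inp β s m ∧ blockPost inp β l (i.scalars inp s m) (i.memory s m) Q

namespace Reaches

variable {inp : ℕ → ℤ} {β : ℕ} {c c₁ c₂ : Cmd} {N N₁ N₂ : ℕ} {s m : ℕ → ℤ}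
  {Q Q' : (ℕ → ℤ) → (ℕ → ℤ) → Prop}

theorem mono (h : Reaches inp β c N s m Q) {N' : ℕ} (hN : N ≤ N')
    (hQ : ∀ s m, Q s m → Q' s m) : Reaches inp β c N' s m Q' := by
  obtain ⟨t, s', m', ht, hr, hq⟩ := h
  exact ⟨t, s', m', ht.trans (Nat.mul_le_mul_right _ hN), hr, hQ _ _ hq⟩

theorem seq (h : Reaches inp β c₁ N₁ s m fun s' m' => Reaches inp β c₂ N₂ s' m' Q) :
    Reaches inp β (.seq c₁ c₂) (N₁ + N₂) s m Q := by
  obtain ⟨t, s', m', ht, hr, t', s'', m'', ht', hr', hq⟩ := h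
  exact ⟨t + t', s'', m'', by rw [Nat.add_mul]; omega, hr.seq hr', hq⟩

theorem ofBlock (l : List Ins) (h : blockPost inp β l s m Q) :
    Reaches inp β (block l) (l.length + 1) s m Q := by
  induction l generalizing s m with
  | nil =>
    have := le_unitCost β
    refine ⟨1, s, m, ?_, Runs.skip _, h⟩
    simp only [List.length_nil]
    omega
  | cons i l ih =>
    obtain ⟨t, ht, hr⟩ := i.run inp β s m h.1
    obtain ⟨t', s', m', ht', hr', hq⟩ := ih h.2
    refine ⟨t + t', s', m', ?_, hr.seq hr', hq⟩
    rw [List.length_cons, Nat.succ_mul]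
    omega

theorem ite {a : ℕ} (ha : a < 32) (hs : HasBits β (s a))
    (h₁ : s a ≠ 0 → Reaches inp β c₁ N s m Q) (h₂ : s a = 0 → Reaches inp β c₂ N s m Q) :
    Reaches inp β (.ite a c₁ c₂) (N + 1) s m Q := by
  have hb := hs.bitLen_le
  have hU := le_unitCost β
  rw [← glue_scalar s m ha] at hb
  by_cases h : s a = 0
  · obtain ⟨t, s', m', ht, hr, hq⟩ := h₂ h
    exact ⟨_, s', m', by rw [Nat.succ_mul]; omega,
      Runs.ite_eq (by rw [glue_scalar s m ha, h]) hr, hq⟩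
  · obtain ⟨t, s', m', ht, hr, hq⟩ := h₁ h
    exact ⟨_, s', m', by rw [Nat.succ_mul]; omega,
      Runs.ite_ne (by rw [glue_scalar s m ha]; exact h) hr, hq⟩

/-- A loop whose control register counts down to zero. -/
theorem loop {a : ℕ} (ha : a < 32) (I : ℕ → (ℕ → ℤ) → (ℕ → ℤ) → Prop)
    (hI : ∀ k s m, I k s m → s a = k ∧ HasBits β (s a))
    (hstep : ∀ k s m, I (k + 1) s m → Reaches inp β c N s m (I k)) (k : ℕ) (h : I k s m) :
    Reaches inp β (.loop a c) (k * (N + 1) + 1) s m (I 0) := by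
  have hU := le_unitCost β
  induction k generalizing s m with
  | zero =>
    obtain ⟨h1, h2⟩ := hI _ _ _ h
    have hb := h2.bitLen_le
    rw [← glue_scalar s m ha] at hb h1
    exact ⟨_, s, m, by simp only [Nat.zero_mul]; omega, Runs.loop_eq (by simpa using h1), h⟩
  | succ k ih =>
    obtain ⟨h1, h2⟩ := hI _ _ _ h
    have hb := h2.bitLen_le
    rw [← glue_scalar s m ha] at hb h1
    obtain ⟨t, s', m', ht, hr, hq⟩ := hstep _ _ _ h
    obtain ⟨t', s'', m'', ht', hr', hq'⟩ := ih hq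
    refine ⟨_, s'', m'', ?_, Runs.loop_ne (by rw [h1]; exact_mod_cast k.succ_ne_zero) hr hr', hq'⟩
    have : ((k + 1) * (N + 1) + 1) * unitCost β =
        unitCost β + N * unitCost β + (k * (N + 1) + 1) * unitCost β := by ring
    rw [this]
    omega

end Reaches

/-! ### Rows in memory -/

/-- The memory `m` with the `w` cells from `o` on replaced by the values of `f`. -/
def setRow (m : ℕ → ℤ) (o w : ℕ) (f : ℕ → ℤ) : ℕ → ℤ :=
  fun a => if o ≤ a ∧ a < o + w then f (a - o) else m a

theorem setRow_self (m : ℕ → ℤ) (o w : ℕ) : setRow m o w (fun i => m (o + i)) = m := by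
  funext a
  unfold setRow
  split_ifs with h
  · exact congrArg m (by omega)
  · rfl

theorem setRow_apply (m : ℕ → ℤ) (o w : ℕ) (f : ℕ → ℤ) {i : ℕ} (hi : i < w) :
    setRow m o w f (o + i) = f i := by
  unfold setRow
  rw [if_pos ⟨by omega, by omega⟩]
  congr 1; omega

theorem setRow_of_notMem (m : ℕ → ℤ) (o w : ℕ) (f : ℕ → ℤ) {a : ℕ} (h : a < o ∨ o + w ≤ a) :
    setRow m o w f a = m a := if_neg (by omega)

theorem update_setRow (m : ℕ → ℤ) (o w : ℕ) (f g : ℕ → ℤ) {i : ℕ} (hi : i < w) (v : ℤ)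
    (hv : g i = v) (hg : ∀ j < w, j ≠ i → g j = f j) :
    Function.update (setRow m o w f) (o + i) v = setRow m o w g := by
  funext a
  by_cases h : a = o + i
  · subst h
    rw [Function.update_self, setRow_apply _ _ _ _ hi, hv]
  · rw [Function.update_of_ne h]
    unfold setRow
    split_ifs with h2
    · rw [hg _ (by omega) (by omega)]
    · rfl

theorem setRow_congr (m : ℕ → ℤ) (o w : ℕ) {f g : ℕ → ℤ} (h : ∀ i < w, f i = g i) :
    setRow m o w f = setRow m o w g := by
  funext a
  unfold setRow
  split_ifs with h2
  · exact h _ (by omega)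
  · rfl

theorem HasBits.of_two_pow {β e : ℕ} {v : ℤ} (h : v.natAbs ≤ 2 ^ e) (he : e < β) : HasBits β v :=
  h.trans_lt (Nat.pow_lt_pow_right (by norm_num) he)

/-! ### Row operations as programs -/

/-- Copy the row at address `R[13]` to address `R[15]`. -/
def copyCmd : Cmd :=
  .seq (block [.add 7 2 31, .add 8 15 31, .add 9 13 31])
    (.loop 7 (block [.load 11 9, .store 8 11, .add 8 8 1, .add 9 9 1, .sub 7 7 1]))

theorem copyCmd_reaches {inp : ℕ → ℤ} {β w x y : ℕ} {s m : ℕ → ℤ}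
    (h1 : s 1 = 1) (h2 : s 2 = w) (h31 : s 31 = 0) (h13 : s 13 = 32 + (x : ℕ))
    (h15 : s 15 = 32 + (y : ℕ)) (hdisj : x + w ≤ y)
    (hm : ∀ i < w, HasBits β (m (x + i))) (hβ : 64 + y + w < 2 ^ β) :
    Reaches inp β copyCmd (w * 7 + 5) s m fun s' m' =>
      (∀ i, i < 7 ∨ 12 < i → s' i = s i) ∧ m' = setRow m y w fun i => m (x + i) := by
  have sm : ∀ z : ℤ, z.natAbs < 64 + y + w → HasBits β z := fun z hz => hz.trans hβ
  refine (Reaches.seq (N₁ := 4) (N₂ := w * 7 + 1) ?_).mono (by omega) fun _ _ h => h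
  refine Reaches.ofBlock [_, _, _] ?_
  simp only [blockPost, Ins.Ok, Ins.scalars, Ins.memory, Function.update_apply, Nat.reduceEqDiff,
    reduceIte, Nat.reduceLT, true_and, h31, h2, h13, h15, add_zero]
  refine ⟨⟨?_, ?_⟩, ⟨?_, ?_⟩, ⟨?_, ?_⟩, ?_⟩
  iterate 6 exact sm _ (by omega)
  refine (Reaches.loop (a := 7) (by norm_num) (fun k s' m' => ∃ j, j + k = w ∧ s' 7 = k ∧
    s' 8 = 32 + (y + j : ℕ) ∧ s' 9 = 32 + (x + j : ℕ) ∧ (∀ i, i < 7 ∨ 12 < i → s' i = s i) ∧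
    m' = setRow m y w fun i => if i < j then m (x + i) else m (y + i)) ?_ ?_ w ?_).mono le_rfl ?_
  · rintro k s' m' ⟨j, hj, h7, -⟩
    exact ⟨h7, sm _ (by omega)⟩
  · rintro k s' m' ⟨j, hj, h7, h8, h9, hs, rfl⟩
    refine Reaches.ofBlock [_, _, _, _, _] ?_
    have e1 := (hs 1 (by norm_num)).trans h1
    have hjw : j < w := by omega
    have e2 : setRow m y w (fun i => if i < j then m (x + i) else m (y + i)) (x + j) = m (x + j) :=
      setRow_of_notMem _ _ _ _ (by omega)
    simp only [blockPost, Ins.Ok, Ins.scalars, Ins.memory, Function.update_apply, Nat.reduceEqDiff,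
      reduceIte, Nat.reduceLT, true_and, h7, h8, h9, e1, e2, add_sub_cancel_left,
      Int.toNat_natCast]
    refine ⟨⟨by omega, sm _ (by omega), hm j hjw⟩, ⟨by omega, sm _ (by omega), hm j hjw⟩,
      ⟨sm _ (by omega), sm _ (by omega)⟩, ⟨sm _ (by omega), sm _ (by omega)⟩,
      ⟨sm _ (by omega), sm _ (by omega)⟩, j + 1, by omega, by omega, by omega, by omega,
      fun i hi => ?_, ?_⟩
    · simp (disch := omega) only [if_neg, hs i hi]
    · exact update_setRow _ _ _ _ _ hjw _ (if_pos (by omega)) fun i _ hij => by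
        simp only [show i < j + 1 ↔ i < j by omega]
  · refine ⟨0, by simp, ?_⟩
    simp only [Function.update_apply, Nat.reduceEqDiff, reduceIte, true_and, add_zero,
      not_lt_zero, if_false]
    refine ⟨fun i hi => ?_, (setRow_self m y w).symm⟩
    simp (disch := omega) only [if_neg]
  · rintro s' m' ⟨j, hj, -, -, -, hs, rfl⟩
    exact ⟨hs, setRow_congr _ _ _ fun i hi => if_pos (by omega)⟩

/-- Replace the row `r` at address `R[13]` by `R[21] r - R[19] b`, with `b` at address `R[15]`. -/
def reduceCmd : Cmd :=
  .seq (block [.add 7 2 31, .add 8 15 31, .add 9 13 31])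
    (.loop 7 (block [.load 11 9, .mul 11 11 21, .load 12 8, .mul 12 12 19, .sub 11 11 12,
      .store 9 11, .add 8 8 1, .add 9 9 1, .sub 7 7 1]))

theorem reduceCmd_reaches {inp : ℕ → ℤ} {β w x y : ℕ} {s m : ℕ → ℤ}
    (h1 : s 1 = 1) (h2 : s 2 = w) (h31 : s 31 = 0) (h13 : s 13 = 32 + (x : ℕ))
    (h15 : s 15 = 32 + (y : ℕ)) (hdisj : x + w ≤ y)
    (hm : ∀ i < w, HasBits β (m (x + i)) ∧ HasBits β (m (y + i)) ∧
      HasBits β (m (x + i) * s 21) ∧ HasBits β (m (y + i) * s 19) ∧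
      HasBits β (m (x + i) * s 21 - m (y + i) * s 19))
    (h19 : HasBits β (s 19)) (h21 : HasBits β (s 21)) (hβ : 64 + y + w < 2 ^ β) :
    Reaches inp β reduceCmd (w * 11 + 5) s m fun s' m' =>
      (∀ i, i < 7 ∨ 12 < i → s' i = s i) ∧
      m' = setRow m x w fun i => m (x + i) * s 21 - m (y + i) * s 19 := by
  have sm : ∀ z : ℤ, z.natAbs < 64 + y + w → HasBits β z := fun z hz => hz.trans hβ
  refine (Reaches.seq (N₁ := 4) (N₂ := w * 11 + 1) ?_).mono (by omega) fun _ _ h => h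
  refine Reaches.ofBlock [_, _, _] ?_
  simp only [blockPost, Ins.Ok, Ins.scalars, Ins.memory, Function.update_apply, Nat.reduceEqDiff,
    reduceIte, Nat.reduceLT, true_and, h31, h2, h13, h15, add_zero]
  refine ⟨⟨?_, ?_⟩, ⟨?_, ?_⟩, ⟨?_, ?_⟩, ?_⟩
  iterate 6 exact sm _ (by omega)
  refine (Reaches.loop (a := 7) (by norm_num) (fun k s' m' => ∃ j, j + k = w ∧ s' 7 = k ∧
    s' 8 = 32 + (y + j : ℕ) ∧ s' 9 = 32 + (x + j : ℕ) ∧ (∀ i, i < 7 ∨ 12 < i → s' i = s i) ∧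
    m' = setRow m x w fun i => if i < j then m (x + i) * s 21 - m (y + i) * s 19 else m (x + i))
    ?_ ?_ w ?_).mono le_rfl ?_
  · rintro k s' m' ⟨j, hj, h7, -⟩
    exact ⟨h7, sm _ (by omega)⟩
  · rintro k s' m' ⟨j, hj, h7, h8, h9, hs, rfl⟩
    refine Reaches.ofBlock [_, _, _, _, _, _, _, _, _] ?_
    have e1 := (hs 1 (by norm_num)).trans h1
    have hjw : j < w := by omega
    have e2 : setRow m x w (fun i => if i < j then m (x + i) * s 21 - m (y + i) * s 19
        else m (x + i)) (x + j) = m (x + j) := by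
      rw [setRow_apply _ _ _ _ hjw, if_neg (by omega)]
    have e3 : setRow m x w (fun i => if i < j then m (x + i) * s 21 - m (y + i) * s 19
        else m (x + i)) (y + j) = m (y + j) := setRow_of_notMem _ _ _ _ (by omega)
    simp only [blockPost, Ins.Ok, Ins.scalars, Ins.memory, Function.update_apply, Nat.reduceEqDiff,
      reduceIte, Nat.reduceLT, true_and, h7, h8, h9, e1, e2, e3, hs 21 (by norm_num),
      hs 19 (by norm_num), add_sub_cancel_left, Int.toNat_natCast]
    obtain ⟨m1, m2, m3, m4, m5⟩ := hm j hjw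
    refine ⟨⟨by omega, sm _ (by omega), m1⟩, ⟨m1, h21⟩, ⟨by omega, sm _ (by omega), m2⟩, ⟨m2, h19⟩,
      ⟨m3, m4⟩, ⟨by omega, sm _ (by omega), m5⟩,
      ⟨sm _ (by omega), sm _ (by omega)⟩, ⟨sm _ (by omega), sm _ (by omega)⟩,
      ⟨sm _ (by omega), sm _ (by omega)⟩, j + 1, by omega, by omega, by omega, by omega,
      fun i hi => ?_, ?_⟩
    · simp (disch := omega) only [if_neg, hs i hi]
    · exact update_setRow _ _ _ _ _ hjw _ (if_pos (by omega)) fun i _ hij => by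
        simp only [show i < j + 1 ↔ i < j by omega]
  · refine ⟨0, by simp, ?_⟩
    simp only [Function.update_apply, Nat.reduceEqDiff, reduceIte, true_and, add_zero,
      not_lt_zero, if_false]
    refine ⟨fun i hi => ?_, (setRow_self m x w).symm⟩
    simp (disch := omega) only [if_neg]
  · rintro s' m' ⟨j, hj, -, -, -, hs, rfl⟩
    exact ⟨hs, setRow_congr _ _ _ fun i hi => if_pos (by omega)⟩

/-- Store the inner product of the rows at addresses `32` and `R[13]` in `R[14]`. -/
def dotCmd : Cmd :=
  .seq (block [.add 7 2 31, .const 8 32, .add 9 13 31, .const 14 0])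
    (.loop 7 (block [.load 11 8, .load 12 9, .mul 11 11 12, .add 14 14 11, .add 8 8 1,
      .add 9 9 1, .sub 7 7 1]))

theorem natAbs_sum_range_le {B : ℕ} (f : ℕ → ℤ) (j : ℕ) (h : ∀ i < j, (f i).natAbs ≤ B) :
    (∑ i ∈ Finset.range j, f i).natAbs ≤ j * B := by
  refine (Int.natAbs_sum_le _ _).trans ((Finset.sum_le_card_nsmul _ _ B fun i hi =>
    h i (Finset.mem_range.1 hi)).trans ?_)
  simp

theorem dotCmd_reaches {inp : ℕ → ℤ} {β w x B : ℕ} {s m : ℕ → ℤ}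
    (h1 : s 1 = 1) (h2 : s 2 = w) (h31 : s 31 = 0) (h13 : s 13 = 32 + (x : ℕ))
    (hm : ∀ i < w, (m (0 + i)).natAbs ≤ B ∧ (m (x + i)).natAbs ≤ B) (hB : w * B ^ 2 + B < 2 ^ β)
    (hβ : 64 + x + w < 2 ^ β) :
    Reaches inp β dotCmd (w * 9 + 6) s m fun s' m' =>
      (∀ i, (i < 7 ∨ 12 < i) ∧ i ≠ 14 → s' i = s i) ∧ m' = m ∧
      s' 14 = ∑ i ∈ Finset.range w, m (0 + i) * m (x + i) := by
  have sm : ∀ z : ℤ, z.natAbs < 64 + x + w → HasBits β z := fun z hz => hz.trans hβ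
  refine (Reaches.seq (N₁ := 5) (N₂ := w * 9 + 1) ?_).mono (by omega) fun _ _ h => h
  refine Reaches.ofBlock [_, _, _, _] ?_
  simp only [blockPost, Ins.Ok, Ins.scalars, Ins.memory, Function.update_apply, Nat.reduceEqDiff,
    reduceIte, Nat.reduceLT, true_and, h31, h2, h13, add_zero]
  refine ⟨⟨sm _ (by omega), sm _ (by omega)⟩, sm _ (by omega), ⟨sm _ (by omega), sm _ (by omega)⟩,
    sm _ (by omega), ?_⟩
  have hprod : ∀ i < w, (m (0 + i) * m (x + i)).natAbs ≤ B ^ 2 := fun i hi => by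
    rw [Int.natAbs_mul, sq]; exact Nat.mul_le_mul (hm i hi).1 (hm i hi).2
  have hsum : ∀ j ≤ w, HasBits β (∑ i ∈ Finset.range j, m (0 + i) * m (x + i)) := fun j hj =>
    (natAbs_sum_range_le _ j fun i hi => hprod i (by omega)).trans_lt
      ((Nat.mul_le_mul_right _ hj).trans_lt (by omega))
  refine (Reaches.loop (a := 7) (by norm_num) (fun k s' m' => ∃ j, j + k = w ∧ s' 7 = k ∧
    s' 8 = 32 + (0 + j : ℕ) ∧ s' 9 = 32 + (x + j : ℕ) ∧
    s' 14 = ∑ i ∈ Finset.range j, m (0 + i) * m (x + i) ∧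
    (∀ i, (i < 7 ∨ 12 < i) ∧ i ≠ 14 → s' i = s i) ∧ m' = m) ?_ ?_ w ?_).mono le_rfl ?_
  · rintro k s' m' ⟨j, hj, h7, -⟩
    exact ⟨h7, sm _ (by omega)⟩
  · rintro k s' m' ⟨j, hj, h7, h8, h9, h14, hs, rfl⟩
    refine Reaches.ofBlock [_, _, _, _, _, _, _] ?_
    have e1 := (hs 1 (by norm_num)).trans h1
    have hjw : j < w := by omega
    simp only [blockPost, Ins.Ok, Ins.scalars, Ins.memory, Function.update_apply, Nat.reduceEqDiff,
      reduceIte, Nat.reduceLT, true_and, h7, h8, h9, e1, h14, add_sub_cancel_left,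
      Int.toNat_natCast]
    obtain ⟨m1, m2⟩ := hm j hjw
    have hw1 : B ^ 2 ≤ w * B ^ 2 := Nat.le_mul_of_pos_left _ (by omega)
    have n1 : HasBits β (m' (0 + j)) := m1.trans_lt (by omega)
    have n2 : HasBits β (m' (x + j)) := m2.trans_lt (by omega)
    have n3 : HasBits β (m' (0 + j) * m' (x + j)) := (hprod j hjw).trans_lt (by omega)
    refine ⟨⟨by omega, sm _ (by omega), n1⟩, ⟨by omega, sm _ (by omega), n2⟩, ⟨n1, n2⟩,
      ⟨hsum j hjw.le, n3⟩, ⟨sm _ (by omega), sm _ (by omega)⟩, ⟨sm _ (by omega), sm _ (by omega)⟩,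
      ⟨sm _ (by omega), sm _ (by omega)⟩, j + 1, by omega, by omega, by omega, by omega,
      by rw [Finset.sum_range_succ], fun i hi => ?_, ?_⟩
    · simp (disch := omega) only [if_neg, hs i hi]
    · trivial
  · refine ⟨0, by simp, ?_⟩
    simp only [Function.update_apply, Nat.reduceEqDiff, reduceIte, true_and, add_zero,
      Finset.range_zero, Finset.sum_empty, Nat.cast_zero, and_true]
    intro i hi
    simp (disch := omega) only [if_neg]
  · rintro s' m' ⟨j, hj, -, -, -, h14, hs, rfl⟩
    obtain rfl : j = w := by omega
    exact ⟨hs, rfl, h14⟩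

/-- Read a row of rationals at the input position `R[5]`, multiply it by the product of its
denominators, and write the resulting integers to the address `R[6]`. The first pass multiplies each
numerator by the denominators before it, the second one by those after it. -/
def loadRowCmd : Cmd :=
  .seq (block [.add 7 2 31, .add 8 6 31, .add 9 5 31, .add 10 1 31])
    (.seq (.loop 7 (block [.read 11 9, .mul 11 11 10, .store 8 11, .add 9 9 1, .read 12 9,
        .mul 10 10 12, .add 9 9 1, .add 8 8 1, .sub 7 7 1]))
      (.seq (block [.add 7 2 31, .add 10 1 31, .add 5 9 31])
        (.loop 7 (block [.sub 8 8 1, .sub 9 9 1, .read 12 9, .sub 9 9 1, .load 11 8,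
          .mul 11 11 10, .store 8 11, .mul 10 10 12, .sub 7 7 1]))))

/-- The entry `i` of a row after multiplication by the product of the denominators. -/
def clearedEntry (num den : ℕ → ℤ) (w i : ℕ) : ℤ :=
  num i * (∏ j ∈ Finset.range i, den j) * ∏ j ∈ Finset.Ico (i + 1) w, den j

theorem natAbs_prod_le {b : ℕ} (den : ℕ → ℤ) (s : Finset ℕ)
    (h : ∀ i ∈ s, (den i).natAbs ≤ 2 ^ b) : (∏ j ∈ s, den j).natAbs ≤ 2 ^ (b * s.card) := by
  have : (∏ j ∈ s, den j).natAbs = ∏ j ∈ s, (den j).natAbs := map_prod Int.natAbsHom _ _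
  rw [this, pow_mul]
  exact Finset.prod_le_pow_card s _ _ h

theorem natAbs_clearedEntry_le {b w : ℕ} (num den : ℕ → ℤ)
    (hnum : ∀ i < w, (num i).natAbs ≤ 2 ^ b) (hden : ∀ i < w, (den i).natAbs ≤ 2 ^ b) {i : ℕ}
    (hi : i < w) : (clearedEntry num den w i).natAbs ≤ 2 ^ (b * w) := by
  unfold clearedEntry
  rw [Int.natAbs_mul, Int.natAbs_mul]
  have h1 := natAbs_prod_le den (Finset.range i) fun j hj => hden j (by
    have := Finset.mem_range.1 hj; omega)
  have h2 := natAbs_prod_le den (Finset.Ico (i + 1) w) fun j hj => hden j (by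
    have := Finset.mem_Ico.1 hj; omega)
  rw [Finset.card_range] at h1
  rw [Nat.card_Ico] at h2
  calc _ ≤ 2 ^ b * 2 ^ (b * i) * 2 ^ (b * (w - (i + 1))) :=
        Nat.mul_le_mul (Nat.mul_le_mul (hnum i hi) h1) h2
    _ = 2 ^ (b * w) := by
      rw [← pow_add, ← pow_add]
      congr 1
      obtain ⟨e, rfl⟩ : ∃ e, w = i + 1 + e := ⟨w - (i + 1), by omega⟩
      rw [Nat.add_sub_cancel_left]; ring

theorem loadRowCmd_reaches {inp : ℕ → ℤ} {β w o pos b : ℕ} {s m : ℕ → ℤ}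
    (h1 : s 1 = 1) (h2 : s 2 = w) (h31 : s 31 = 0) (h5 : s 5 = (pos : ℕ))
    (h6 : s 6 = 32 + (o : ℕ)) (num den : ℕ → ℤ)
    (hinp : ∀ i < w, inp (pos + 2 * i) = num i ∧ inp (pos + 2 * i + 1) = den i)
    (hnum : ∀ i < w, (num i).natAbs ≤ 2 ^ b) (hden : ∀ i < w, (den i).natAbs ≤ 2 ^ b)
    (hb : b * w + b < β) (hβ : 64 + o + w < 2 ^ β) (hpos : pos + 2 * w < 2 ^ β) :
    Reaches inp β loadRowCmd (w * 22 + 11) s m fun s' m' =>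
      (∀ i, (i < 7 ∨ 12 < i) ∧ i ≠ 5 → s' i = s i) ∧ s' 5 = (pos + 2 * w : ℕ) ∧
      m' = setRow m o w (clearedEntry num den w) := by
  have sm : ∀ z : ℤ, z.natAbs < 64 + o + w → HasBits β z := fun z hz => hz.trans hβ
  have sp : ∀ z : ℤ, z.natAbs ≤ pos + 2 * w → HasBits β z := fun z hz => hz.trans_lt hpos
  have hn : ∀ i < w, HasBits β (num i) := fun i hi => .of_two_pow (hnum i hi) (by omega)
  have hd : ∀ i < w, HasBits β (den i) := fun i hi => .of_two_pow (hden i hi) (by omega)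
  have hP : ∀ j ≤ w, HasBits β (∏ i ∈ Finset.range j, den i) := fun j hj =>
    .of_two_pow (natAbs_prod_le den _ fun i hi => hden i (by
      have := Finset.mem_range.1 hi; omega)) (by
      rw [Finset.card_range]; have := Nat.mul_le_mul_left b hj; omega)
  have hS : ∀ j ≤ w, HasBits β (∏ i ∈ Finset.Ico j w, den i) := fun j hj =>
    .of_two_pow (natAbs_prod_le den _ fun i hi => hden i (by
      have := Finset.mem_Ico.1 hi; omega)) (by
      rw [Nat.card_Ico]; have := Nat.mul_le_mul_left b (Nat.sub_le w j); omega)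
  have hNP : ∀ j < w, HasBits β (num j * ∏ i ∈ Finset.range j, den i) := fun j hj => by
    refine .of_two_pow (e := b * (j + 1)) ?_ (by
      have : b * (j + 1) ≤ b * w := Nat.mul_le_mul_left b hj
      omega)
    rw [Int.natAbs_mul, mul_add, mul_one, add_comm, pow_add]
    have := natAbs_prod_le den (Finset.range j) fun i hi => hden i (by
      have := Finset.mem_range.1 hi; omega)
    rw [Finset.card_range] at this
    exact Nat.mul_le_mul (hnum j hj) this
  have hC : ∀ j < w, HasBits β (clearedEntry num den w j) := fun j hj =>
    .of_two_pow (natAbs_clearedEntry_le num den hnum hden hj) (by omega)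
  refine (Reaches.seq (N₁ := 5) (N₂ := (w * 11 + 1) + (4 + (w * 11 + 1))) ?_).mono (by omega)
    fun _ _ h => h
  refine Reaches.ofBlock [_, _, _, _] ?_
  simp only [blockPost, Ins.Ok, Ins.scalars, Ins.memory, Function.update_apply, Nat.reduceEqDiff,
    reduceIte, Nat.reduceLT, true_and, h31, h2, h1, h5, h6, add_zero]
  refine ⟨⟨sm _ (by omega), sm _ (by omega)⟩, ⟨sm _ (by omega), sm _ (by omega)⟩,
    ⟨sp _ (by omega), sm _ (by omega)⟩, ⟨sm _ (by omega), sm _ (by omega)⟩, ?_⟩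
  refine Reaches.seq ((Reaches.loop (a := 7) (by norm_num) (fun k s' m' => ∃ j, j + k = w ∧
    s' 7 = k ∧ s' 8 = 32 + (o + j : ℕ) ∧ s' 9 = (pos + 2 * j : ℕ) ∧
    s' 10 = ∏ i ∈ Finset.range j, den i ∧ (∀ i, i < 7 ∨ 12 < i → s' i = s i) ∧
    m' = setRow m o w fun i => if i < j then num i * ∏ i ∈ Finset.range i, den i else m (o + i))
    ?_ ?_ w ?_).mono le_rfl ?_)
  · rintro k s' m' ⟨j, hj, h7, -⟩
    exact ⟨h7, sm _ (by omega)⟩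
  · rintro k s' m' ⟨j, hj, h7, h8, h9, h10, hs, rfl⟩
    refine Reaches.ofBlock [_, _, _, _, _, _, _, _, _] ?_
    have e1 := (hs 1 (by norm_num)).trans h1
    have hjw : j < w := by omega
    have e9 : ((pos + 2 * j : ℕ) : ℤ) + 1 = ((pos + 2 * j + 1 : ℕ) : ℤ) := by push_cast; rfl
    simp only [blockPost, Ins.Ok, Ins.scalars, Ins.memory, Function.update_apply, Nat.reduceEqDiff,
      reduceIte, Nat.reduceLT, true_and, h7, h8, h9, h10, e1, e9, add_sub_cancel_left,
      Int.toNat_natCast, hinp j hjw]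
    refine ⟨⟨sp _ (by omega), hn j hjw⟩, ⟨hn j hjw, hP j hjw.le⟩,
      ⟨by omega, sm _ (by omega), hNP j hjw⟩, ⟨sp _ (by omega), sm _ (by omega)⟩,
      ⟨sp _ (by omega), hd j hjw⟩, ⟨hP j hjw.le, hd j hjw⟩, ⟨sp _ (by omega), sm _ (by omega)⟩,
      ⟨sm _ (by omega), sm _ (by omega)⟩, ⟨sm _ (by omega), sm _ (by omega)⟩,
      j + 1, by omega, by omega, by omega, by omega, (Finset.prod_range_succ _ _).symm,
      fun i hi => ?_, ?_⟩
    · simp (disch := omega) only [if_neg, hs i hi]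
    · exact update_setRow _ _ _ _ _ hjw _ (if_pos (by omega)) fun i _ hij => by
        simp only [show i < j + 1 ↔ i < j by omega]
  · refine ⟨0, by simp, ?_⟩
    simp only [Function.update_apply, Nat.reduceEqDiff, reduceIte, true_and, add_zero, mul_zero,
      not_lt_zero, if_false, Finset.range_zero, Finset.prod_empty]
    refine ⟨fun i hi => ?_, (setRow_self m o w).symm⟩
    simp (disch := omega) only [if_neg]
  rintro s' m' ⟨j, hj, -, h8, h9, -, hs, rfl⟩
  obtain rfl : j = w := by omega
  refine Reaches.seq (Reaches.ofBlock [_, _, _] ?_)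
  simp only [blockPost, Ins.Ok, Ins.scalars, Ins.memory, Function.update_apply, Nat.reduceEqDiff,
    reduceIte, Nat.reduceLT, true_and, h9, hs 31 (by norm_num), hs 2 (by norm_num),
    hs 1 (by norm_num), h31, h2, h1, add_zero]
  refine ⟨⟨sm _ (by omega), sm _ (by omega)⟩, ⟨sm _ (by omega), sm _ (by omega)⟩,
    ⟨sp _ (by omega), sm _ (by omega)⟩, ?_⟩
  refine (Reaches.loop (a := 7) (by norm_num) (fun k s' m' => k ≤ j ∧
    s' 7 = k ∧ s' 8 = 32 + (o + k : ℕ) ∧ s' 9 = (pos + 2 * k : ℕ) ∧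
    s' 10 = ∏ i ∈ Finset.Ico k j, den i ∧ s' 5 = (pos + 2 * j : ℕ) ∧
    (∀ i, (i < 7 ∨ 12 < i) ∧ i ≠ 5 → s' i = s i) ∧
    m' = setRow m o j fun i => if k ≤ i then clearedEntry num den j i else
      num i * ∏ i ∈ Finset.range i, den i)
    ?_ ?_ j ?_).mono le_rfl ?_
  · rintro k s' m' ⟨hk, h7, -⟩
    exact ⟨h7, sm _ (by omega)⟩
  · rintro k s'' m' ⟨hk, h7, h8, h9, h10, h5', hs', rfl⟩
    refine Reaches.ofBlock [_, _, _, _, _, _, _, _, _] ?_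
    have e1 := (hs' 1 (by norm_num)).trans h1
    have hkw : k < j := by omega
    have e8 : 32 + ((o + (k + 1) : ℕ) : ℤ) - 1 = 32 + ((o + k : ℕ) : ℤ) := by push_cast; ring
    have e9 : ((pos + 2 * (k + 1) : ℕ) : ℤ) - 1 = ((pos + 2 * k + 1 : ℕ) : ℤ) := by
      push_cast; ring
    have e9' : ((pos + 2 * k + 1 : ℕ) : ℤ) - 1 = ((pos + 2 * k : ℕ) : ℤ) := by push_cast; ring
    have em : setRow m o j (fun i => if k + 1 ≤ i then clearedEntry num den j i else
        num i * ∏ i ∈ Finset.range i, den i) (o + k) = num k * ∏ i ∈ Finset.range k, den i := by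
      rw [setRow_apply _ _ _ _ hkw, if_neg (by omega)]
    simp only [blockPost, Ins.Ok, Ins.scalars, Ins.memory, Function.update_apply, Nat.reduceEqDiff,
      reduceIte, Nat.reduceLT, true_and, h7, h8, h9, h10, e1, e8, e9, e9', h5',
      add_sub_cancel_left, Int.toNat_natCast, hinp k hkw, em]
    refine ⟨⟨sm _ (by omega), sm _ (by omega)⟩, ⟨sp _ (by omega), sm _ (by omega)⟩,
      ⟨sp _ (by omega), hd k hkw⟩, ⟨sp _ (by omega), sm _ (by omega)⟩,
      ⟨by omega, sm _ (by omega), hNP k hkw⟩, ⟨hNP k hkw, hS _ hk⟩,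
      ⟨by omega, sm _ (by omega), hC k hkw⟩, ⟨hS _ hk, hd k hkw⟩,
      ⟨sm _ (by omega), sm _ (by omega)⟩, by omega, by omega, ?_, fun i hi => ?_, ?_⟩
    · rw [Finset.prod_eq_prod_Ico_succ_bot hkw, mul_comm]
    · simp (disch := omega) only [if_neg, hs' i hi]
    · exact update_setRow _ _ _ _ _ hkw _ (by rw [if_pos le_rfl]; rfl) fun i _ hij => by
        simp only [show k + 1 ≤ i ↔ k ≤ i by omega]
  · simp only [Function.update_apply, Nat.reduceEqDiff, reduceIte, true_and, h8, h9,
      Finset.Ico_self, Finset.prod_empty, le_refl]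
    refine ⟨fun i hi => ?_, setRow_congr _ _ _ fun i hi => ?_⟩
    · simp (disch := omega) only [if_neg, hs i hi.1]
    · rw [if_pos hi, if_neg (by omega)]
  · rintro s'' m' ⟨-, -, -, -, -, h5', hs', rfl⟩
    exact ⟨hs', h5', setRow_congr _ _ _ fun i hi => if_pos (Nat.zero_le _)⟩

/-! ### Incremental fraction-free elimination -/

/-- The `w` memory cells from `o` on as a rational vector. -/
def rowVec (w : ℕ) (m : ℕ → ℤ) (o : ℕ) : Fin w → ℚ := fun i => (m (o + i) : ℚ)

theorem rowVec_setRow (w : ℕ) (m : ℕ → ℤ) (o : ℕ) (f : ℕ → ℤ) :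
    rowVec w (setRow m o w f) o = fun i : Fin w => (f i : ℚ) := by
  funext i
  simp only [rowVec, setRow_apply _ _ _ _ i.2]

theorem rowVec_setRow_of_disjoint (w : ℕ) (m : ℕ → ℤ) {o o' : ℕ} (f : ℕ → ℤ)
    (h : o' + w ≤ o ∨ o + w ≤ o') : rowVec w (setRow m o w f) o' = rowVec w m o' := by
  funext i
  have := i.2
  simp only [rowVec]
  rw [setRow_of_notMem _ _ _ _ (by omega)]

/-- The slots `(l + 2) * w`, `l < w`, of the memory hold the rows of an upper triangular integer
matrix; a row whose diagonal entry vanishes is zero, there are `n` other rows, and the rows span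
`U`. The entries of row `l` have less than `2 ^ l * E` bits. -/
structure Echelon (w E : ℕ) (U : Submodule ℚ (Fin w → ℚ)) (n : ℕ) (m : ℕ → ℤ) : Prop where
  triangular : ∀ l < w, ∀ k < l, m ((l + 2) * w + k) = 0
  zero_row : ∀ l < w, m ((l + 2) * w + l) = 0 → ∀ i < w, m ((l + 2) * w + i) = 0
  bound : ∀ l < w, ∀ i < w, 2 * (m ((l + 2) * w + i)).natAbs ≤ 2 ^ (2 ^ l * E)
  span_eq : Submodule.span ℚ (Set.range fun l : Fin w => rowVec w m ((l.1 + 2) * w)) = U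
  card_eq : ((Finset.range w).filter fun l => m ((l + 2) * w + l) ≠ 0).card = n

/-- The current row, at address `w`, vanishes before column `j`, and together with the rows of the
triangular matrix it spans `V`. -/
structure Eliminating (w E : ℕ) (V : Submodule ℚ (Fin w → ℚ)) (j n : ℕ) (m : ℕ → ℤ) : Prop where
  echelon : ∃ U, Echelon w E U n m ∧ U ⊔ Submodule.span ℚ {rowVec w m w} = V
  row_zero : ∀ k < w, k < j → m (w + k) = 0
  row_bound : ∀ i < w, 2 * (m (w + i)).natAbs ≤ 2 ^ (2 ^ j * E)

theorem slot_le {l j : ℕ} (w : ℕ) (h : l < j) : (l + 2) * w + w ≤ (j + 2) * w := by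
  have := Nat.mul_le_mul_right w (show l + 3 ≤ j + 2 by omega)
  linarith

theorem le_slot (l w : ℕ) : w + w ≤ (l + 2) * w := by
  have := Nat.mul_le_mul_right w (show 2 ≤ l + 2 by omega)
  linarith

theorem Echelon.setRow_of_le {w E n o : ℕ} {U : Submodule ℚ (Fin w → ℚ)} {m : ℕ → ℤ}
    (h : Echelon w E U n m) (ho : o ≤ w) (f : ℕ → ℤ) : Echelon w E U n (setRow m o w f) := by
  have e : ∀ l k, setRow m o w f ((l + 2) * w + k) = m ((l + 2) * w + k) := fun l k =>
    setRow_of_notMem _ _ _ _ (by have := le_slot l w; omega)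
  have e' : ∀ l, rowVec w (setRow m o w f) ((l + 2) * w) = rowVec w m ((l + 2) * w) := fun l =>
    funext fun i => by simp only [rowVec, e]
  exact ⟨by simpa only [e] using h.triangular, by simpa only [e] using h.zero_row,
    by simpa only [e] using h.bound, by simpa only [e'] using h.span_eq,
    by simpa only [e] using h.card_eq⟩

theorem Echelon.eliminating {w E n : ℕ} {U : Submodule ℚ (Fin w → ℚ)} {m : ℕ → ℤ}
    (h : Echelon w E U n m) (f : ℕ → ℤ) (hf : ∀ i < w, 2 * (f i).natAbs ≤ 2 ^ E) :
    Eliminating w E (U ⊔ Submodule.span ℚ {fun i : Fin w => (f i : ℚ)}) 0 n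
      (setRow m w w f) := by
  refine ⟨⟨U, h.setRow_of_le le_rfl f, by rw [rowVec_setRow]⟩, fun k _ hk => absurd hk (by omega),
    fun i hi => ?_⟩
  rw [setRow_apply _ _ _ _ hi]
  simpa using hf i hi

theorem Eliminating.finish {w E n : ℕ} {V : Submodule ℚ (Fin w → ℚ)} {m : ℕ → ℤ}
    (h : Eliminating w E V w n m) : Echelon w E V n m := by
  obtain ⟨U, hU, rfl⟩ := h.echelon
  have : rowVec w m w = 0 := funext fun i => by simp [rowVec, h.row_zero i i.2 i.2]
  rw [this, Submodule.span_zero_singleton, sup_bot_eq]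
  exact hU

theorem Eliminating.skip {w E j n : ℕ} {V : Submodule ℚ (Fin w → ℚ)} {m : ℕ → ℤ}
    (h : Eliminating w E V j n m) (hj : m (w + j) = 0) : Eliminating w E V (j + 1) n m := by
  refine ⟨h.echelon, fun k hk hkj => ?_, fun i hi => (h.row_bound i hi).trans ?_⟩
  · rcases Nat.lt_succ_iff_lt_or_eq.1 hkj with h' | rfl
    · exact h.row_zero k hk h'
    · exact hj
  · exact Nat.pow_le_pow_right (by norm_num) (Nat.mul_le_mul_right _
      (Nat.pow_le_pow_right (by norm_num) (by omega)))

/-- A row with its pivot in a column whose slot is empty is stored there. -/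
theorem Eliminating.insert {w E j n : ℕ} {V : Submodule ℚ (Fin w → ℚ)} {m : ℕ → ℤ}
    (h : Eliminating w E V j n m) (hjw : j < w) (hj : m (w + j) ≠ 0)
    (hB : m ((j + 2) * w + j) = 0) :
    Eliminating w E V j (n + 1) (setRow m ((j + 2) * w) w fun i => m (w + i)) := by
  obtain ⟨U, hU, rfl⟩ := h.echelon
  set m' := setRow m ((j + 2) * w) w fun i => m (w + i) with hm'
  have ej : ∀ i < w, m' ((j + 2) * w + i) = m (w + i) := fun i hi => setRow_apply _ _ _ _ hi
  have el : ∀ l, l ≠ j → ∀ i < w, m' ((l + 2) * w + i) = m ((l + 2) * w + i) := fun l hl i hi =>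
    setRow_of_notMem _ _ _ _ (by
      rcases lt_or_gt_of_ne hl with h1 | h1
      · have := slot_le w h1; omega
      · have := slot_le w h1; omega)
  have ex : ∀ i < w, m' (w + i) = m (w + i) := fun i hi =>
    setRow_of_notMem _ _ _ _ (by have := le_slot j w; omega)
  have vj : rowVec w m' ((j + 2) * w) = rowVec w m w := funext fun i => by
    simp only [rowVec, ej i i.2]
  have vl : ∀ l, l ≠ j → rowVec w m' ((l + 2) * w) = rowVec w m ((l + 2) * w) := fun l hl =>
    funext fun i => by simp only [rowVec, el l hl i i.2]
  have vx : rowVec w m' w = rowVec w m w := funext fun i => by simp only [rowVec, ex i i.2]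
  have v0 : rowVec w m ((j + 2) * w) = 0 := funext fun i => by
    simp [rowVec, hU.zero_row j hjw hB i i.2]
  refine ⟨⟨_, ⟨fun l hl k hk => ?_, fun l hl h0 i hi => ?_, fun l hl i hi => ?_, rfl, ?_⟩, ?_⟩,
    fun k hk hkj => ?_, fun i hi => ?_⟩
  · by_cases hlj : l = j
    · subst hlj; rw [ej k (by omega), h.row_zero k (by omega) hk]
    · rw [el l hlj k (by omega), hU.triangular l hl k hk]
  · by_cases hlj : l = j
    · subst hlj; rw [ej l hl] at h0; exact absurd h0 hj
    · rw [el l hlj l hl] at h0; rw [el l hlj i hi, hU.zero_row l hl h0 i hi]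
  · by_cases hlj : l = j
    · subst hlj; rw [ej i hi]; exact h.row_bound i hi
    · rw [el l hlj i hi]; exact hU.bound l hl i hi
  · rw [← hU.card_eq, ← Finset.card_insert_of_notMem (a := j)
      (by simp [hB] : j ∉ (Finset.range w).filter fun l => m ((l + 2) * w + l) ≠ 0)]
    congr 1
    ext l
    simp only [Finset.mem_filter, Finset.mem_range, Finset.mem_insert]
    by_cases hlj : l = j
    · subst hlj; simp [hjw, ej l hjw, hj]
    · simp only [hlj, false_or]
      exact and_congr_right fun hl => by rw [el l hlj l hl]
  · rw [vx, ← hU.span_eq, ← Submodule.span_union, ← Submodule.span_union]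
    apply le_antisymm <;> rw [Submodule.span_le]
    · rintro x (⟨l, rfl⟩ | rfl)
      · by_cases hlj : l.1 = j
        · simp only [hlj, vj]; exact Submodule.subset_span (Or.inr rfl)
        · simp only [vl _ hlj]; exact Submodule.subset_span (Or.inl ⟨l, rfl⟩)
      · exact Submodule.subset_span (Or.inr rfl)
    · rintro x (⟨l, rfl⟩ | rfl)
      · by_cases hlj : l.1 = j
        · simp only [hlj, v0]; exact Submodule.zero_mem _
        · simp only [← vl _ hlj]; exact Submodule.subset_span (Or.inl ⟨l, rfl⟩)
      · exact Submodule.subset_span (Or.inr rfl)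
  · rw [ex k hk, h.row_zero k hk hkj]
  · rw [ex i hi]; exact h.row_bound i hi

theorem two_mul_natAbs_sub_le {a b c d : ℤ} {e : ℕ} (ha : 2 * a.natAbs ≤ 2 ^ e)
    (hb : 2 * b.natAbs ≤ 2 ^ e) (hc : 2 * c.natAbs ≤ 2 ^ e) (hd : 2 * d.natAbs ≤ 2 ^ e) :
    2 * (a * b - c * d).natAbs ≤ 2 ^ (2 * e) := by
  have h1 : (a * b - c * d).natAbs ≤ a.natAbs * b.natAbs + c.natAbs * d.natAbs := by
    rw [← Int.natAbs_mul, ← Int.natAbs_mul]; omega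
  have h2 := Nat.mul_le_mul ha hb
  have h3 := Nat.mul_le_mul hc hd
  have h4 : 2 ^ (2 * e) = 2 ^ e * 2 ^ e := by rw [two_mul, pow_add]
  rw [h4]
  nlinarith

/-- The pivot of the current row is cancelled by a multiple of the row in the slot of its column. -/
theorem Eliminating.reduce {w E j n : ℕ} {V : Submodule ℚ (Fin w → ℚ)} {m : ℕ → ℤ}
    (h : Eliminating w E V j n m) (hjw : j < w) (hB : m ((j + 2) * w + j) ≠ 0) :
    Eliminating w E V (j + 1) n (setRow m w w fun i =>
      m (w + i) * m ((j + 2) * w + j) - m ((j + 2) * w + i) * m (w + j)) := by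
  obtain ⟨U, hU, rfl⟩ := h.echelon
  refine ⟨⟨U, hU.setRow_of_le le_rfl _, ?_⟩, fun k hk hkj => ?_, fun i hi => ?_⟩
  · have hmem : rowVec w m ((j + 2) * w) ∈ U := by
      rw [← hU.span_eq]; exact Submodule.subset_span ⟨⟨j, hjw⟩, rfl⟩
    have hc : (m ((j + 2) * w + j) : ℚ) ≠ 0 := by exact_mod_cast hB
    have e : (fun i : Fin w => ((m (w + i) * m ((j + 2) * w + j) -
        m ((j + 2) * w + i) * m (w + j) : ℤ) : ℚ)) =
        (m ((j + 2) * w + j) : ℚ) • rowVec w m w -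
          (m (w + j) : ℚ) • rowVec w m ((j + 2) * w) := by
      funext i
      simp only [rowVec, Pi.sub_apply, Pi.smul_apply, smul_eq_mul]
      push_cast; ring
    rw [rowVec_setRow, e]
    apply le_antisymm
    · refine sup_le le_sup_left ?_
      rw [Submodule.span_singleton_le_iff_mem]
      exact Submodule.sub_mem _ (Submodule.smul_mem _ _ (Submodule.mem_sup_right
        (Submodule.mem_span_singleton_self _))) (Submodule.smul_mem _ _
          (Submodule.mem_sup_left hmem))
    · refine sup_le le_sup_left ?_
      rw [Submodule.span_singleton_le_iff_mem, ← Submodule.smul_mem_iff _ hc]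
      have := Submodule.add_mem _ (Submodule.mem_sup_right (S := U)
        (Submodule.mem_span_singleton_self ((m ((j + 2) * w + j) : ℚ) • rowVec w m w -
          (m (w + j) : ℚ) • rowVec w m ((j + 2) * w))))
        (Submodule.mem_sup_left (Submodule.smul_mem U (m (w + j) : ℚ) hmem))
      simpa using this
  · rw [setRow_apply _ _ _ _ hk]
    rcases Nat.lt_succ_iff_lt_or_eq.1 hkj with h' | rfl
    · rw [h.row_zero k hk h', hU.triangular j hjw k h']; ring
    · ring
  · rw [setRow_apply _ _ _ _ hi, pow_succ, show 2 ^ j * 2 * E = 2 * (2 ^ j * E) by ring]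
    exact two_mul_natAbs_sub_le (h.row_bound i hi) (hU.bound j hjw j hjw) (hU.bound j hjw i hi)
      (h.row_bound j hjw)

/-- The nonzero rows of a triangular matrix whose rows with vanishing diagonal entry are zero are
linearly independent. -/
theorem Echelon.finrank_eq {w E n : ℕ} {U : Submodule ℚ (Fin w → ℚ)} {m : ℕ → ℤ}
    (h : Echelon w E U n m) : Module.finrank ℚ U = n := by
  let ι := {l : Fin w // m ((l.1 + 2) * w + l.1) ≠ 0}
  let v : ι → Fin w → ℚ := fun l => rowVec w m ((l.1.1 + 2) * w)
  have hli : LinearIndependent ℚ v := by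
    rw [Fintype.linearIndependent_iff]
    intro g hg
    by_contra! hne
    obtain ⟨i, hi⟩ := hne
    -- the first row with a nonzero coefficient determines its diagonal entry
    obtain ⟨l, hl, hmin⟩ := Finset.exists_min_image (Finset.univ.filter fun l => g l ≠ 0)
      (fun l : ι => l.1) ⟨i, by simpa using hi⟩
    have h1 := congrFun hg l.1
    rw [Finset.sum_apply, Finset.sum_eq_single l] at h1
    · simp only [Pi.smul_apply, smul_eq_mul, Pi.zero_apply, mul_eq_zero, v, rowVec] at h1
      rcases h1 with h1 | h1
      · simp [h1] at hl
      · exact l.2 (by exact_mod_cast h1)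
    · intro l' _ hl'
      by_cases hg' : g l' = 0
      · simp [hg']
      · have h2 : l.1 ≤ l'.1 := hmin l' (by simpa using hg')
        have h3 : l.1 < l'.1 := lt_of_le_of_ne h2 fun e => hl' (Subtype.ext e.symm)
        simp [v, rowVec, h.triangular l'.1 l'.1.2 l.1 h3]
    · simp
  have hspan : Submodule.span ℚ (Set.range v) = U := by
    rw [← h.span_eq]
    apply le_antisymm <;> rw [Submodule.span_le]
    · rintro _ ⟨l, rfl⟩
      exact Submodule.subset_span ⟨l.1, rfl⟩
    · rintro _ ⟨l, rfl⟩
      by_cases hl : m ((l.1 + 2) * w + l.1) = 0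
      · have : rowVec w m ((l.1 + 2) * w) = 0 := funext fun i => by
          simp [rowVec, h.zero_row l l.2 hl i i.2]
        simp only [this]; exact Submodule.zero_mem _
      · exact Submodule.subset_span ⟨⟨l, hl⟩, rfl⟩
  rw [← hspan, finrank_span_eq_card hli, ← h.card_eq, Fintype.card_subtype]
  refine Finset.card_bij (fun l _ => l.1) (fun l hl => ?_) (fun _ _ _ _ => Fin.ext) fun l hl => ?_
  · simpa using hl
  · obtain ⟨h1, h2⟩ := Finset.mem_filter.1 hl
    exact ⟨⟨l, Finset.mem_range.1 h1⟩, by simpa using h2, rfl⟩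

theorem Echelon.zero (w E : ℕ) (m : ℕ → ℤ) (hm : ∀ a, w ≤ a → m a = 0) :
    Echelon w E ⊥ 0 m := by
  have e : ∀ l k, m ((l + 2) * w + k) = 0 := fun l k => hm _ (by have := le_slot l w; omega)
  refine ⟨fun l _ k _ => e l k, fun l _ _ i _ => e l i, fun l _ i _ => by simp [e], ?_, by simp [e]⟩
  rw [Submodule.span_eq_bot]
  rintro _ ⟨l, rfl⟩
  exact funext fun i => by simp [rowVec, e]

/-- One column of the elimination. The entry of the current row in this column is at address
`R[18]`, the slot of the column at `R[15]`, and the diagonal entry of the slot at `R[20]`; the first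
and the last are loaded into `R[19]` and `R[21]`. If the slot is empty, the current row is copied to
it and afterwards reduced to zero by its copy, so that both cases end with the same reduction. -/
def elimStepCmd : Cmd :=
  .seq (block [.load 19 18])
    (.seq (.ite 19
      (.seq (block [.load 21 20])
        (.seq (.ite 21 (block []) (.seq copyCmd (block [.add 17 17 1, .add 21 19 31])))
          reduceCmd))
      (block []))
      (block [.add 15 15 2, .add 18 18 1, .add 20 20 22, .sub 16 16 1]))

/-- Reduce the row at address `R[13]` by the triangular matrix, and count in `R[17]` whether a row
has been added to the matrix. -/
def elimCmd : Cmd :=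
  .seq (block [.add 16 2 31, .add 15 13 2, .add 18 13 31, .add 20 15 31]) (.loop 16 elimStepCmd)

/-- The scalar registers that are constant during the outer loop. -/
structure Constants (w : ℕ) (s : ℕ → ℤ) : Prop where
  r1 : s 1 = 1
  r2 : s 2 = w
  r13 : s 13 = 32 + (w : ℕ)
  r22 : s 22 = (w + 1 : ℕ)
  r31 : s 31 = 0

/-- The scalar registers `15, 16, 18, 20` at column `j` of the elimination. -/
structure ElimRegs (w j : ℕ) (s : ℕ → ℤ) : Prop where
  r15 : s 15 = 32 + ((j + 2) * w : ℕ)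
  r16 : s 16 = (w - j : ℕ)
  r18 : s 18 = 32 + (w + j : ℕ)
  r20 : s 20 = 32 + ((j + 2) * w + j : ℕ)

/-- If the current row vanishes before column `j`, then one step makes it vanish in column `j`, too,
either by cancelling its pivot or by moving it to the empty slot of the column. -/
theorem elimStepCmd_reaches {inp : ℕ → ℤ} {β w E j n : ℕ} {V : Submodule ℚ (Fin w → ℚ)}
    {s m : ℕ → ℤ} (hc : Constants w s) (hr : ElimRegs w j s) (hjw : j < w)
    (h17 : s 17 = (n : ℕ)) (hn : n ≤ w) (hm : Eliminating w E V j n m)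
    (hβ : 64 + (w + 3) * w + w < 2 ^ β) (hE : 2 ^ w * E ≤ β) :
    Reaches inp β elimStepCmd (w * 18 + 24) s m fun s' m' =>
      (∀ i, i < 7 ∨ i = 13 ∨ i = 14 ∨ 21 < i → s' i = s i) ∧ ElimRegs w (j + 1) s' ∧
      (∀ a < w, m' a = m a) ∧
      ∃ n', s' 17 = (n' : ℕ) ∧ Eliminating w E V (j + 1) n' m' := by
  obtain ⟨U, hU, -⟩ := hm.echelon
  have hjs : (j + 2) * w + w ≤ (w + 2) * w := slot_le w hjw
  have hws : (w + 3) * w = (w + 2) * w + w := by ring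
  have sm : ∀ z : ℤ, z.natAbs < 64 + (w + 3) * w + w → HasBits β z := fun z hz => hz.trans hβ
  have hle : ∀ l < w, 2 ^ l * E ≤ 2 ^ w * E := fun l hl => Nat.mul_le_mul_right _
    (Nat.pow_le_pow_right (by norm_num) hl.le)
  -- numbers at column `j` have less than `2 ^ j * E` bits, and products of two of them are handled
  have hb : ∀ v : ℤ, 2 * v.natAbs ≤ 2 ^ (2 ^ j * E) → HasBits β v := fun v hv => by
    have h1 : 2 ^ (2 ^ j * E) ≤ 2 ^ β := Nat.pow_le_pow_right (by norm_num) ((hle j hjw).trans hE)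
    have h2 : 0 < 2 ^ β := by positivity
    unfold HasBits; omega
  have hb2 : ∀ v : ℤ, 2 * v.natAbs ≤ 2 ^ (2 * (2 ^ j * E)) → HasBits β v := fun v hv => by
    have h0 : 2 * (2 ^ j * E) ≤ 2 ^ w * E := by
      rw [← mul_assoc, ← pow_succ']
      exact Nat.mul_le_mul_right _ (Nat.pow_le_pow_right (by norm_num) hjw)
    have h1 : 2 ^ (2 * (2 ^ j * E)) ≤ 2 ^ β := Nat.pow_le_pow_right (by norm_num) (h0.trans hE)
    have h2 : 0 < 2 ^ β := by positivity
    unfold HasBits; omega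
  have hb3 : ∀ u v : ℤ, 2 * u.natAbs ≤ 2 ^ (2 ^ j * E) → 2 * v.natAbs ≤ 2 ^ (2 ^ j * E) →
      HasBits β (u * v) := fun u v hu hv => hb2 _ <| by
    simpa using two_mul_natAbs_sub_le (c := 0) (d := 0) hu hv (by simp) (by simp)
  have hX := hm.row_bound
  have hBj := hU.bound j hjw
  refine (Reaches.seq (N₁ := 2) (N₂ := (w * 18 + 17) + 5) ?_).mono (by omega) fun _ _ h => h
  refine Reaches.ofBlock [_] ?_
  simp only [blockPost, Ins.Ok, Ins.scalars, Ins.memory, Nat.reduceLT, true_and, hr.r18,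
    add_sub_cancel_left, Int.toNat_natCast]
  refine ⟨⟨by omega, sm _ (by omega), hb _ (hX j hjw)⟩, ?_⟩
  -- the state after the conditional statement
  refine Reaches.seq (Reaches.mono (Q := fun s' m' => (∀ i, i < 7 ∨ 12 < i ∧ i ≠ 17 ∧ i ≠ 19 ∧
    i ≠ 21 → s' i = s i) ∧ (∀ a < w, m' a = m a) ∧
    ∃ n', s' 17 = (n' : ℕ) ∧ Eliminating w E V (j + 1) n' m') ?_ le_rfl ?_)
  · refine (Reaches.ite (N := w * 18 + 16) (by norm_num) ?_ (fun h19 => ?_) fun h19 => ?_).mono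
      le_rfl fun _ _ h => h
    · simpa using hb _ (hX j hjw)
    · simp only [Function.update_self] at h19
      refine (Reaches.seq (N₁ := 2) (N₂ := (w * 7 + 9) + (w * 11 + 5)) ?_).mono (by omega)
        fun _ _ h => h
      refine Reaches.ofBlock [_] ?_
      simp only [blockPost, Ins.Ok, Ins.scalars, Ins.memory, Function.update_apply,
        Nat.reduceEqDiff, reduceIte, Nat.reduceLT, true_and, hr.r20, add_sub_cancel_left,
        Int.toNat_natCast]
      refine ⟨⟨by omega, sm _ (by omega), hb _ (hBj j hjw)⟩, ?_⟩
      refine Reaches.seq (Reaches.mono (Q := fun s' m' => (∀ i, i < 7 ∨ 12 < i ∧ i ≠ 17 ∧ i ≠ 19 ∧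
        i ≠ 21 → s' i = s i) ∧ (∀ a < w, m' a = m a) ∧ s' 19 = m' (w + j) ∧
        s' 21 = m' ((j + 2) * w + j) ∧ s' 21 ≠ 0 ∧
        ∃ n', s' 17 = (n' : ℕ) ∧ Eliminating w E V j n' m') ?_ le_rfl ?_)
      · refine (Reaches.ite (N := w * 7 + 8) (by norm_num) ?_ (fun h21 => ?_) fun h21 => ?_).mono
          le_rfl fun _ _ h => h
        · simpa using hb _ (hBj j hjw)
        · simp only [Function.update_self] at h21
          refine (Reaches.ofBlock [] ?_).mono (by simp) fun _ _ h => h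
          refine ⟨fun i hi => ?_, fun _ _ => rfl, ?_, ?_, ?_, n, ?_, hm⟩
          · simp (disch := omega) only [Function.update_apply, if_neg]
          · simp
          · simp
          · simpa using h21
          · simpa [Function.update_apply] using h17
        · simp only [Function.update_self] at h21
          refine (Reaches.seq (N₁ := w * 7 + 5) (N₂ := 3) ?_).mono (by omega) fun _ _ h => h
          refine (copyCmd_reaches (w := w) (x := w) (y := (j + 2) * w) ?_ ?_ ?_ ?_ ?_
            (le_slot j w) (fun i hi => hb _ (hX i hi)) (by omega)).mono le_rfl ?_
          · simpa [Function.update_apply] using hc.r1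
          · simpa [Function.update_apply] using hc.r2
          · simpa [Function.update_apply] using hc.r31
          · simpa [Function.update_apply] using hc.r13
          · simpa [Function.update_apply] using hr.r15
          rintro s' m' ⟨hs, rfl⟩
          have hm' := hm.insert hjw h19 h21
          have e19 := hs 19 (by norm_num)
          have e17 := hs 17 (by norm_num)
          have e1 := hs 1 (by norm_num)
          have e31 := hs 31 (by norm_num)
          simp only [Function.update_apply, Nat.reduceEqDiff, reduceIte, h17, hc.r1, hc.r31]
            at e19 e17 e1 e31
          refine Reaches.ofBlock [_, _] ?_
          simp only [blockPost, Ins.Ok, Ins.scalars, Ins.memory, Function.update_apply,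
            Nat.reduceEqDiff, reduceIte, Nat.reduceLT, true_and, e1, e31, e17, e19, add_zero]
          refine ⟨⟨sm _ (by omega), sm _ (by omega)⟩, ⟨hb _ (hX j hjw), sm _ (by omega)⟩,
            fun i hi => ?_, fun a ha => setRow_of_notMem _ _ _ _
              (by have := le_slot j w; omega), ?_, ?_, h19, n + 1, by push_cast; rfl, hm'⟩
          · simp (disch := omega) only [if_neg, hs i (by omega), Function.update_apply]
          · rw [setRow_of_notMem _ _ _ _ (by have := le_slot j w; omega)]
          · rw [setRow_apply _ _ _ _ hjw]
      · rintro s' m' ⟨hs, hS, e19, e21, hne, n', e17, hm'⟩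
        obtain ⟨U', hU', -⟩ := hm'.echelon
        have hX' := hm'.row_bound
        have hBj' := hU'.bound j hjw
        refine (reduceCmd_reaches (w := w) (x := w) (y := (j + 2) * w) ((hs 1 (by norm_num)).trans
          hc.r1) ((hs 2 (by norm_num)).trans hc.r2) ((hs 31 (by norm_num)).trans hc.r31)
          ((hs 13 (by norm_num)).trans hc.r13) ((hs 15 (by norm_num)).trans hr.r15) (le_slot j w)
          (fun i hi => ⟨hb _ (hX' i hi), hb _ (hBj' i hi), ?_, ?_, ?_⟩) ?_ ?_ (by omega)).mono
          le_rfl ?_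
        · rw [e21]; exact hb3 _ _ (hX' i hi) (hBj' j hjw)
        · rw [e19]; exact hb3 _ _ (hBj' i hi) (hX' j hjw)
        · rw [e21, e19]
          exact hb2 _ (two_mul_natAbs_sub_le (hX' i hi) (hBj' j hjw) (hBj' i hi) (hX' j hjw))
        · rw [e19]; exact hb _ (hX' j hjw)
        · rw [e21]; exact hb _ (hBj' j hjw)
        rintro s'' m'' ⟨hs', rfl⟩
        refine ⟨fun i hi => (hs' i (by omega)).trans (hs i hi), fun a ha =>
          (setRow_of_notMem _ _ _ _ (by omega)).trans (hS a ha), n',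
          (hs' 17 (by norm_num)).trans e17, ?_⟩
        rw [e21] at hne
        rw [e19, e21]
        exact hm'.reduce hjw hne
    · simp only [Function.update_self] at h19
      refine (Reaches.ofBlock [] ?_).mono (by simp) fun _ _ h => h
      refine ⟨fun i hi => ?_, fun _ _ => rfl, n, ?_, hm.skip h19⟩
      · simp (disch := omega) only [Function.update_apply, if_neg]
      · simpa [Function.update_apply] using h17
  · rintro s' m' ⟨hs, hS, n', e17, hm'⟩
    refine Reaches.ofBlock [_, _, _, _] ?_
    have e1 := (hs 1 (by norm_num)).trans hc.r1
    have e2 := (hs 2 (by norm_num)).trans hc.r2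
    have e22 := (hs 22 (by norm_num)).trans hc.r22
    have e15 := (hs 15 (by norm_num)).trans hr.r15
    have e16 := (hs 16 (by norm_num)).trans hr.r16
    have e18 := (hs 18 (by norm_num)).trans hr.r18
    have e20 := (hs 20 (by norm_num)).trans hr.r20
    have e3 : (j + 1 + 2) * w = (j + 2) * w + w := by ring
    simp only [blockPost, Ins.Ok, Ins.scalars, Ins.memory, Function.update_apply, Nat.reduceEqDiff,
      reduceIte, Nat.reduceLT, true_and, e1, e2, e22, e15, e16, e18, e20, e17]
    refine ⟨⟨sm _ (by omega), sm _ (by omega)⟩, ⟨sm _ (by omega), sm _ (by omega)⟩,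
      ⟨sm _ (by omega), sm _ (by omega)⟩, ⟨sm _ (by omega), sm _ (by omega)⟩, fun i hi => ?_,
      ⟨?_, ?_, ?_, ?_⟩, hS, n', by trivial, hm'⟩
    · simp (disch := omega) only [if_neg, hs i (by omega)]
    all_goals
      simp only [Function.update_apply, Nat.reduceEqDiff, reduceIte, e15, e16, e18, e20, e3]
      omega

theorem elimCmd_reaches {inp : ℕ → ℤ} {β w E n : ℕ} {V : Submodule ℚ (Fin w → ℚ)}
    {s m : ℕ → ℤ} (hc : Constants w s) (h17 : s 17 = (n : ℕ)) (hm : Eliminating w E V 0 n m)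
    (hβ : 64 + (w + 3) * w + w < 2 ^ β) (hE : 2 ^ w * E ≤ β) :
    Reaches inp β elimCmd (w * (w * 18 + 25) + 6) s m fun s' m' =>
      (∀ i, i < 7 ∨ i = 13 ∨ i = 14 ∨ 21 < i → s' i = s i) ∧
      (∀ a < w, m' a = m a) ∧ ∃ n', s' 17 = (n' : ℕ) ∧ Echelon w E V n' m' := by
  have hw2 := le_slot w w
  have hws : (w + 3) * w = (w + 2) * w + w := by ring
  have sm : ∀ z : ℤ, z.natAbs < 64 + (w + 3) * w + w → HasBits β z := fun z hz => hz.trans hβ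
  refine (Reaches.seq (N₁ := 5) (N₂ := w * (w * 18 + 24 + 1) + 1) ?_).mono
    (le_of_eq (by ring)) fun _ _ h => h
  refine Reaches.ofBlock [_, _, _, _] ?_
  simp only [blockPost, Ins.Ok, Ins.scalars, Ins.memory, Function.update_apply, Nat.reduceEqDiff,
    reduceIte, Nat.reduceLT, true_and, hc.r31, hc.r2, hc.r13, add_zero]
  refine ⟨⟨sm _ (by omega), sm _ (by omega)⟩, ⟨sm _ (by omega), sm _ (by omega)⟩,
    ⟨sm _ (by omega), sm _ (by omega)⟩, ⟨sm _ (by omega), sm _ (by omega)⟩, ?_⟩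
  refine (Reaches.loop (a := 16) (by norm_num) (fun k s' m' => ∃ j, j + k = w ∧ ElimRegs w j s' ∧
    (∀ i, i < 7 ∨ i = 13 ∨ i = 14 ∨ 21 < i → s' i = s i) ∧ (∀ a < w, m' a = m a) ∧
    ∃ n', s' 17 = (n' : ℕ) ∧ Eliminating w E V j n' m') ?_ ?_ w ?_).mono le_rfl ?_
  · rintro k s' m' ⟨j, hj, hr, -⟩
    have := hr.r16
    exact ⟨by omega, sm _ (by omega)⟩
  · rintro k s' m' ⟨j, hj, hr, hs, hS, n', h17', hm'⟩
    obtain ⟨U, hU, -⟩ := hm'.echelon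
    have hn : n' ≤ w := hU.card_eq ▸ (Finset.card_filter_le _ _).trans (by simp)
    refine (elimStepCmd_reaches (j := j) ⟨(hs 1 (by norm_num)).trans hc.r1,
      (hs 2 (by norm_num)).trans hc.r2, (hs 13 (by norm_num)).trans hc.r13,
      (hs 22 (by norm_num)).trans hc.r22, (hs 31 (by norm_num)).trans hc.r31⟩ hr (by omega) h17'
      hn hm' hβ hE).mono le_rfl ?_
    rintro s'' m'' ⟨hs', hr', hS', hm''⟩
    exact ⟨j + 1, by omega, hr', fun i hi => (hs' i hi).trans (hs i hi),
      fun a ha => (hS' a ha).trans (hS a ha), hm''⟩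
  · refine ⟨0, by simp, ⟨?_, ?_, ?_, ?_⟩, fun i hi => ?_, fun _ _ => rfl, n, ?_, hm⟩
    · simp; ring
    · simp
    · simp
    · simp; ring
    · simp (disch := omega) only [Function.update_apply, if_neg]
    · simpa [Function.update_apply] using h17
  · rintro s' m' ⟨j, hj, -, hs, hS, n', h17', hm'⟩
    obtain rfl : j = w := by omega
    exact ⟨hs, hS, n', h17', hm'.finish⟩

/-! ### The redundancy test as a program -/

/-- The position of an entry of a row. -/
def entryEquiv (q : ℕ) : Fin q ⊕ Unit ≃ Fin (q + 1) :=
  (Equiv.sumCongr (Equiv.refl _) (Equiv.ofUnique Unit (Fin 1))).trans finSumFinEquiv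

theorem entryEquiv_inl {q : ℕ} (j : Fin q) : (entryEquiv q (Sum.inl j)).1 = j.1 := by
  simp [entryEquiv]

theorem entryEquiv_inr {q : ℕ} (u : Unit) : (entryEquiv q (Sum.inr u)).1 = q := by
  simp [entryEquiv]

/-- The numerators of a row, by position. -/
def numAt {q : ℕ} (r : Fin q ⊕ Unit → ℚ) (i : ℕ) : ℤ :=
  if h : i < q + 1 then (r ((entryEquiv q).symm ⟨i, h⟩)).num else 0

/-- The denominators of a row, by position. -/
def denAt {q : ℕ} (r : Fin q ⊕ Unit → ℚ) (i : ℕ) : ℤ :=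
  if h : i < q + 1 then (r ((entryEquiv q).symm ⟨i, h⟩)).den else 1

/-- The row of integers that arises from clearing denominators. -/
def clearedRow {q : ℕ} (r : Fin q ⊕ Unit → ℚ) : ℕ → ℤ :=
  clearedEntry (numAt r) (denAt r) (q + 1)

theorem denAt_ne_zero {q : ℕ} (r : Fin q ⊕ Unit → ℚ) (i : ℕ) : denAt r i ≠ 0 := by
  unfold denAt
  split_ifs
  · exact_mod_cast (Rat.den_pos _).ne'
  · exact one_ne_zero

/-- The product of the denominators of a row. -/
def denProd {q : ℕ} (r : Fin q ⊕ Unit → ℚ) : ℚ := ∏ j ∈ Finset.range (q + 1), (denAt r j : ℚ)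

theorem denProd_ne_zero {q : ℕ} (r : Fin q ⊕ Unit → ℚ) : denProd r ≠ 0 :=
  Finset.prod_ne_zero_iff.2 fun j _ => by exact_mod_cast denAt_ne_zero r j

theorem clearedRow_eq {q : ℕ} (r : Fin q ⊕ Unit → ℚ) (i : Fin (q + 1)) :
    (clearedRow r i.1 : ℚ) = denProd r * r ((entryEquiv q).symm i) := by
  have h1 : (denAt r i.1 : ℚ) ≠ 0 := by exact_mod_cast denAt_ne_zero r i.1
  have h2 : r ((entryEquiv q).symm i) = (numAt r i.1 : ℚ) / denAt r i.1 := by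
    rw [numAt, denAt, dif_pos i.2, dif_pos i.2]
    exact (Rat.num_div_den _).symm
  have h3 : denProd r = (∏ j ∈ Finset.range i.1, (denAt r j : ℚ)) * denAt r i.1 *
      ∏ j ∈ Finset.Ico (i.1 + 1) (q + 1), (denAt r j : ℚ) := by
    rw [denProd, ← Finset.prod_range_succ, Finset.prod_range_mul_prod_Ico _ (by omega)]
  rw [h2, h3, clearedRow, clearedEntry]
  push_cast
  field_simp

theorem natAbs_numAt_le {q b : ℕ} {r : Fin q ⊕ Unit → ℚ} (h : ∀ j, (r j).num.natAbs ≤ 2 ^ b)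
    (i : ℕ) : (numAt r i).natAbs ≤ 2 ^ b := by
  unfold numAt
  split_ifs
  · exact h _
  · simp

theorem natAbs_denAt_le {q b : ℕ} {r : Fin q ⊕ Unit → ℚ} (h : ∀ j, (r j).den ≤ 2 ^ b)
    (i : ℕ) : (denAt r i).natAbs ≤ 2 ^ b := by
  unfold denAt
  split_ifs
  · exact h _
  · exact Nat.one_le_two_pow

theorem sum_clearedRow_mul {q : ℕ} (r s : Fin q ⊕ Unit → ℚ) :
    ((∑ i ∈ Finset.range (q + 1), clearedRow s i * clearedRow r i : ℤ) : ℚ) =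
      denProd s * denProd r * (r ⬝ᵥ s) := by
  push_cast
  rw [Finset.sum_range fun i => (clearedRow s i : ℚ) * clearedRow r i, dotProduct,
    ← Equiv.sum_comp (entryEquiv q).symm, Finset.mul_sum]
  refine Finset.sum_congr rfl fun i _ => ?_
  rw [clearedRow_eq, clearedRow_eq]; ring

theorem List.getElem?_flatten_of_length {α : Type*} (k : ℕ) (l : List (List α))
    (h : ∀ x ∈ l, x.length = k) (i j : ℕ) (hj : j < k) :
    l.flatten[k * i + j]? = l[i]?.bind fun x => x[j]? := by
  induction l generalizing i with
  | nil => simp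
  | cons x l ih =>
    have hx := h x List.mem_cons_self
    rw [List.flatten_cons]
    cases i with
    | zero => rw [List.getElem?_append_left (by omega)]; simp
    | succ i =>
      rw [List.getElem?_append_right (by rw [hx]; nlinarith),
        show k * (i + 1) + j - x.length = k * i + j by rw [hx, Nat.mul_succ]; omega,
        ih (fun y hy => h y (List.mem_cons_of_mem _ hy)), List.getElem?_cons_succ]

theorem length_encodeRow {q : ℕ} (r : Fin q ⊕ Unit → ℚ) : (encodeRow r).length = 2 * (q + 1) := by
  rw [encodeRow, List.length_append, List.length_flatten, List.map_ofFn]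
  simp [Function.comp_def]
  ring

theorem encodeRow_getElem? {q : ℕ} (r : Fin q ⊕ Unit → ℚ) (i : ℕ) (hi : i < q + 1) :
    (encodeRow r)[2 * i]? = some (numAt r i) ∧ (encodeRow r)[2 * i + 1]? = some (denAt r i) := by
  have e : encodeRow r = ((List.ofFn fun j : Fin q => [(r (Sum.inl j)).num,
      ((r (Sum.inl j)).den : ℤ)]) ++ [[(r (Sum.inr ())).num, ((r (Sum.inr ())).den : ℤ)]]).flatten
      := by simp [encodeRow]
  have hl := List.getElem?_flatten_of_length 2 _ (fun x hx => by
    rcases List.mem_append.1 hx with hx | hx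
    · obtain ⟨j, rfl⟩ := (List.mem_ofFn' _ _).1 hx; rfl
    · rw [List.mem_singleton.1 hx]; rfl :
    ∀ x ∈ (List.ofFn fun j : Fin q => [(r (Sum.inl j)).num, ((r (Sum.inl j)).den : ℤ)]) ++
      [[(r (Sum.inr ())).num, ((r (Sum.inr ())).den : ℤ)]], x.length = 2) i
  have h0 := hl 0 (by norm_num)
  have h1 := hl 1 (by norm_num)
  rw [← e] at h0 h1
  rw [add_zero] at h0
  rw [h0, h1]
  rcases Nat.lt_succ_iff_lt_or_eq.1 hi with h | rfl
  · have : (entryEquiv q).symm ⟨i, hi⟩ = Sum.inl ⟨i, h⟩ := by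
      rw [Equiv.symm_apply_eq]; exact Fin.ext (entryEquiv_inl _).symm
    rw [List.getElem?_append_left (by simpa using h)]
    simp [numAt, denAt, hi, h, this]
  · have : (entryEquiv i).symm ⟨i, hi⟩ = Sum.inr () := by
      rw [Equiv.symm_apply_eq]; exact Fin.ext (entryEquiv_inr _).symm
    rw [List.getElem?_append_right (by simp)]
    simp [numAt, denAt, this]

section encodeInput

variable {d q : ℕ} (M : Matrix (Fin d) (Fin q ⊕ Unit) ℚ) (s : Fin q ⊕ Unit → ℚ)

theorem encodeInput_zero : encodeInput M s 0 = d := by simp [encodeInput]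

theorem encodeInput_one : encodeInput M s 1 = q := by simp [encodeInput]

/-- The input is read as `d`, `q`, and then the rows `s, M 0, M 1, …`, each of them as `q + 1` pairs
of a numerator and a denominator. -/
theorem encodeInput_row (l : ℕ) (r : Fin q ⊕ Unit → ℚ)
    (hr : (s :: List.ofFn M)[l]? = some r) (i : ℕ) (hi : i < q + 1) :
    encodeInput M s (2 + 2 * (q + 1) * l + 2 * i) = numAt r i ∧
      encodeInput M s (2 + 2 * (q + 1) * l + 2 * i + 1) = denAt r i := by
  have e : ∀ k, encodeInput M s (2 + k) =
      (((s :: List.ofFn M).map encodeRow).flatten)[k]?.getD 0 := fun k => by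
    rw [encodeInput, List.append_assoc, List.getD_eq_getElem?_getD,
      List.getElem?_append_right (by simp), List.map_cons,
      show (List.ofFn M).map encodeRow = List.ofFn fun i => encodeRow (M i) from
        List.map_ofFn]
    simp
  have h : ∀ j < 2 * (q + 1), encodeInput M s (2 + (2 * (q + 1) * l + j)) =
      (encodeRow r)[j]?.getD 0 := fun j hj => by
    rw [e, List.getElem?_flatten_of_length (2 * (q + 1)) _ (fun x hx => by
      obtain ⟨y, -, rfl⟩ := List.mem_map.1 hx; exact length_encodeRow y) _ _ hj,
      List.getElem?_map, hr]
    rfl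
  obtain ⟨h1, h2⟩ := encodeRow_getElem? r i hi
  constructor
  · rw [add_assoc, h _ (by omega), h1]; rfl
  · rw [add_assoc, add_assoc, h _ (by omega), h2]; rfl

end encodeInput

/-- The redundancy test: the cleared vector `s` is stored at address `32`; then every row is cleared
at address `R[13]`, and if its inner product with `s` vanishes, it is added to the triangular
matrix. The registers `1`, `2`, `4`, `22` hold the constants `1`, `q + 1`, `q`, `q + 2`, and
register `31` stays zero; `R[3]` counts the remaining rows, `R[5]` is the position in the input,
`R[6]` the address to which rows are read, `R[14]` the inner product, and `R[17]` the rank so far.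
The answer is left in register `0`. -/
def testCmd : Cmd :=
  .seq (block [.const 1 1, .read 3 31, .read 4 1, .add 2 4 1, .const 5 2, .const 6 32,
      .add 22 2 1, .const 13 32, .add 13 13 2])
    (.seq loadRowCmd (.seq (block [.add 6 13 31])
      (.seq (.loop 3 (.seq loadRowCmd (.seq dotCmd (.seq (.ite 14 (block []) elimCmd)
          (block [.sub 3 3 1])))))
        (.seq (block [.sub 11 17 4]) (.ite 11 (block [.const 0 1]) (block [.const 0 0]))))))

/-- The span of the rows of index less than `i` that are orthogonal to `s`. -/
def tightSpan {d q : ℕ} (M : Matrix (Fin d) (Fin q ⊕ Unit) ℚ) (s : Fin q ⊕ Unit → ℚ) (i : ℕ) :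
    Submodule ℚ (Fin (q + 1) → ℚ) :=
  Submodule.span ℚ {x | ∃ l : Fin d, l.1 < i ∧ (M *ᵥ s) l = 0 ∧
    x = fun j => M l ((entryEquiv q).symm j)}

theorem finrank_tightSpan {d q : ℕ} (M : Matrix (Fin d) (Fin q ⊕ Unit) ℚ)
    (s : Fin q ⊕ Unit → ℚ) : Module.finrank ℚ (tightSpan M s d) =
      (M.submatrix (Subtype.val : {i // (M *ᵥ s) i = 0} → Fin d) id).rank := by
  rw [← Matrix.rank_submatrix _ (Equiv.refl _) (entryEquiv q).symm,
    Matrix.rank_eq_finrank_span_row, tightSpan]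
  refine congrArg (fun S : Set (Fin (q + 1) → ℚ) => Module.finrank ℚ (Submodule.span ℚ S))
    (Set.ext fun x => ?_)
  constructor
  · rintro ⟨l, -, hl, rfl⟩; exact ⟨⟨l, hl⟩, rfl⟩
  · rintro ⟨⟨l, hl⟩, rfl⟩; exact ⟨l, l.2, hl, rfl⟩

theorem tightSpan_succ_of_ne {d q i : ℕ} (M : Matrix (Fin d) (Fin q ⊕ Unit) ℚ)
    (s : Fin q ⊕ Unit → ℚ) (hi : i < d) (h : (M *ᵥ s) ⟨i, hi⟩ ≠ 0) :
    tightSpan M s (i + 1) = tightSpan M s i := by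
  unfold tightSpan
  congr 1
  ext x
  constructor
  · rintro ⟨l, hli, hl, rfl⟩
    refine ⟨l, ?_, hl, rfl⟩
    rcases Nat.lt_succ_iff_lt_or_eq.1 hli with h' | h'
    · exact h'
    · exact absurd (by rwa [show l = ⟨i, hi⟩ from Fin.ext h'] at hl) h
  · rintro ⟨l, hli, hl, rfl⟩; exact ⟨l, by omega, hl, rfl⟩

theorem tightSpan_succ_of_eq {d q i : ℕ} (M : Matrix (Fin d) (Fin q ⊕ Unit) ℚ)
    (s : Fin q ⊕ Unit → ℚ) (hi : i < d) (h : (M *ᵥ s) ⟨i, hi⟩ = 0) :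
    tightSpan M s i ⊔ Submodule.span ℚ {fun j : Fin (q + 1) =>
      (clearedRow (M ⟨i, hi⟩) j.1 : ℚ)} = tightSpan M s (i + 1) := by
  have e : (fun j : Fin (q + 1) => (clearedRow (M ⟨i, hi⟩) j.1 : ℚ)) =
      denProd (M ⟨i, hi⟩) • fun j => M ⟨i, hi⟩ ((entryEquiv q).symm j) :=
    funext fun j => clearedRow_eq _ j
  rw [e, Submodule.span_singleton_smul_eq (IsUnit.mk0 _ (denProd_ne_zero _)), tightSpan, tightSpan,
    ← Submodule.span_union]
  congr 1
  ext x
  constructor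
  · rintro (⟨l, hli, hl, rfl⟩ | rfl)
    · exact ⟨l, by omega, hl, rfl⟩
    · exact ⟨⟨i, hi⟩, Nat.lt_succ_self i, h, rfl⟩
  · rintro ⟨l, hli, hl, rfl⟩
    rcases Nat.lt_succ_iff_lt_or_eq.1 hli with h' | h'
    · exact Or.inl ⟨l, h', hl, rfl⟩
    · obtain rfl : l = ⟨i, hi⟩ := Fin.ext h'
      exact Or.inr rfl

/-- A number of bits that suffices for the redundancy test with `q` variables on numbers of `b`
bits: row `l` of the triangular matrix has entries of less than `2 ^ l * (b * (q + 1) + 1)` bits. -/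
def testBits (q b : ℕ) : ℕ := 2 ^ (q + 5) * (b * (q + 1) + 1)

/-- The number of instructions of the redundancy test is at most this. -/
def testSteps (d q : ℕ) : ℕ := 100 * (d + 1) * (q + 2) ^ 2

/-- The numbers and addresses that occur in the program have at most `testBits q b` bits. -/
theorem testBits_spec (q b d : ℕ) (hd : d ≤ 2 ^ b) :
    b * (q + 1) + b < testBits q b ∧ 64 + (q + 1 + 3) * (q + 1) + (q + 1) < 2 ^ testBits q b ∧
      2 ^ (q + 1) * (b * (q + 1) + 1) ≤ testBits q b ∧
      (q + 1) * (2 ^ (b * (q + 1))) ^ 2 + 2 ^ (b * (q + 1)) < 2 ^ testBits q b ∧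
      2 + 2 * (q + 1) * (d + 2) < 2 ^ testBits q b := by
  have h1 : q + 1 < 2 ^ (q + 1) := Nat.lt_two_pow_self
  have h2 : testBits q b = 16 * 2 ^ (q + 1) * (b * (q + 1) + 1) := by
    rw [testBits, show q + 5 = q + 1 + 4 by ring, pow_add]; ring
  have h3 : b ≤ b * (q + 1) := Nat.le_mul_of_pos_right _ (by omega)
  set P := 2 ^ (q + 1)
  set X := b * (q + 1)
  have h4 : testBits q b = 16 * (P * X) + 16 * P := by rw [h2]; ring
  have h5 : X ≤ P * X := Nat.le_mul_of_pos_left _ (by omega)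
  have hpow : ∀ k, k < testBits q b → 2 * 2 ^ k ≤ 2 ^ testBits q b := fun k hk => by
    rw [← pow_succ']; exact Nat.pow_le_pow_right (by norm_num) hk
  refine ⟨by omega, ?_, ?_, ?_, ?_⟩
  · have h6 := hpow (2 * (q + 1) + 7) (by omega)
    have h7 : 2 ^ (2 * (q + 1) + 7) = 128 * (P * P) := by rw [pow_add, two_mul, pow_add]; ring
    nlinarith
  · rw [h2]; nlinarith
  · have h6 := hpow (q + 1 + 2 * X) (by omega)
    have h7 : 2 ^ (q + 1 + 2 * X) = P * (2 ^ X) ^ 2 := by rw [pow_add, mul_comm 2 X, pow_mul]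
    have h8 : 1 ≤ 2 ^ X := Nat.one_le_two_pow
    have h9 : 2 ^ X ≤ (2 ^ X) ^ 2 := Nat.le_self_pow (by norm_num) _
    have h10 : (q + 1 + 1) * (2 ^ X) ^ 2 ≤ P * (2 ^ X) ^ 2 := Nat.mul_le_mul_right _ h1
    have h11 : 0 < P * (2 ^ X) ^ 2 := by positivity
    nlinarith
  · have h6 := hpow (q + 1 + b + 3) (by omega)
    have h7 : 2 ^ (q + 1 + b + 3) = 8 * (P * 2 ^ b) := by rw [pow_add, pow_add]; ring
    have h8 : 1 ≤ 2 ^ b := Nat.one_le_two_pow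
    have h9 : (q + 1) * (d + 2) ≤ P * (3 * 2 ^ b) := Nat.mul_le_mul h1.le (by omega)
    have h10 : 1 ≤ P * 2 ^ b := Nat.mul_pos (by omega) h8
    nlinarith

/-- The invariant of the outer loop before row `i`: the triangular matrix spans the same space as
the earlier rows that are orthogonal to the vector. -/
structure TestState {d q : ℕ} (M : Matrix (Fin d) (Fin q ⊕ Unit) ℚ) (v : Fin q ⊕ Unit → ℚ)
    (E i : ℕ) (s m : ℕ → ℤ) : Prop where
  const : Constants (q + 1) s
  r3 : s 3 = (d - i : ℕ)
  r4 : s 4 = (q : ℕ)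
  r5 : s 5 = (2 + 2 * (q + 1) * (i + 1) : ℕ)
  r6 : s 6 = 32 + (q + 1 : ℕ)
  vec : ∀ a < q + 1, m a = clearedRow v a
  echelon : ∃ n, s 17 = (n : ℕ) ∧ Echelon (q + 1) E (tightSpan M v i) n m

/-- One round of the outer loop: row `i` is read and, if it is orthogonal to `s`, added to the
triangular matrix. -/
theorem testLoop_reaches {d q b i : ℕ} {M : Matrix (Fin d) (Fin q ⊕ Unit) ℚ}
    {v : Fin q ⊕ Unit → ℚ} {s m : ℕ → ℤ} (hd : d ≤ 2 ^ b) (hi : i < d)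
    (hM : ∀ i j, (M i j).num.natAbs ≤ 2 ^ b ∧ (M i j).den ≤ 2 ^ b)
    (hv : ∀ j, (v j).num.natAbs ≤ 2 ^ b ∧ (v j).den ≤ 2 ^ b)
    (h : TestState M v (b * (q + 1) + 1) i s m) :
    Reaches (encodeInput M v) (testBits q b) (.seq loadRowCmd (.seq dotCmd
      (.seq (.ite 14 (block []) elimCmd) (block [.sub 3 3 1]))))
      ((q + 1) * 22 + 11 + ((q + 1) * 9 + 6 + ((q + 1) * ((q + 1) * 18 + 25) + 6 + 1 + 2))) s m
      (TestState M v (b * (q + 1) + 1) (i + 1)) := by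
  obtain ⟨hβ1, hβ2, hβ3, hβ4, hβ5⟩ := testBits_spec q b d hd
  obtain ⟨n, h17, hn⟩ := h.echelon
  have hc := h.const
  set w := q + 1 with hw
  have hws : (w + 3) * w = w * w + 3 * w := by ring
  have hmul : 2 * w * (i + 1) + 2 * w ≤ 2 * w * (d + 2) := by
    have : 2 * w * (i + 2) ≤ 2 * w * (d + 2) := Nat.mul_le_mul_left _ (by omega)
    linarith
  have hmul' : 2 * (q + 1) * (i + 1) = 2 * w * (i + 1) := rfl
  set r := M ⟨i, hi⟩ with hr
  refine Reaches.seq ((loadRowCmd_reaches (w := w) (o := w) (b := b) hc.r1 hc.r2 hc.r31 h.r5 h.r6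
    (numAt r) (denAt r) (fun j hj => encodeInput_row M v (i + 1) r
      ((List.getElem?_ofFn (f := M)).trans (dif_pos hi)) j hj)
    (fun j _ => natAbs_numAt_le (fun k => (hM _ k).1) j)
    (fun j _ => natAbs_denAt_le (fun k => (hM _ k).2) j) hβ1 (by omega) (by omega)).mono le_rfl ?_)
  rintro s1 m1 ⟨hs1, h5, rfl⟩
  have hcl : ∀ (x : Fin q ⊕ Unit → ℚ), (∀ j, (x j).num.natAbs ≤ 2 ^ b ∧ (x j).den ≤ 2 ^ b) →
      ∀ j < w, (clearedRow x j).natAbs ≤ 2 ^ (b * w) := fun x hx j hj =>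
    natAbs_clearedEntry_le _ _ (fun j _ => natAbs_numAt_le (fun k => (hx k).1) j)
      (fun j _ => natAbs_denAt_le (fun k => (hx k).2) j) hj
  set m1 := setRow m w w (clearedEntry (numAt r) (denAt r) w) with hm1
  have mS : ∀ a < w, m1 a = clearedRow v a := fun a ha => by
    rw [hm1, setRow_of_notMem _ _ _ _ (by omega), h.vec a ha]
  have mX : ∀ a < w, m1 (w + a) = clearedRow r a := fun a ha => setRow_apply _ _ _ _ ha
  refine Reaches.seq ((dotCmd_reaches (w := w) (x := w) (B := 2 ^ (b * w))
    ((hs1 1 (by norm_num)).trans hc.r1) ((hs1 2 (by norm_num)).trans hc.r2)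
    ((hs1 31 (by norm_num)).trans hc.r31) ((hs1 13 (by norm_num)).trans hc.r13)
    (fun j hj => ?_) hβ4 (by omega)).mono le_rfl ?_)
  · rw [zero_add, mS j hj, mX j hj]
    exact ⟨hcl v hv j hj, hcl r (hM _) j hj⟩
  rintro s2 m2 ⟨hs2, rfl, h14⟩
  rw [Finset.sum_congr rfl fun j hj => by
    rw [zero_add, mS j (Finset.mem_range.1 hj), mX j (Finset.mem_range.1 hj)]] at h14
  have hzero : s2 14 = 0 ↔ (M *ᵥ v) ⟨i, hi⟩ = 0 := by
    have h1 := sum_clearedRow_mul r v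
    rw [← h14] at h1
    rw [← Int.cast_eq_zero (α := ℚ), h1, mul_eq_zero, mul_eq_zero]
    simp only [denProd_ne_zero, false_or]
    rfl
  have hb14 : HasBits (testBits q b) (s2 14) := by
    have h1 := natAbs_sum_range_le (B := (2 ^ (b * w)) ^ 2)
      (fun j => clearedRow v j * clearedRow r j) w fun j hj => by
        rw [Int.natAbs_mul, sq]; exact Nat.mul_le_mul (hcl v hv j hj) (hcl r (hM _) j hj)
    rw [h14]
    exact h1.trans_lt (lt_of_le_of_lt (Nat.le_add_right _ _) hβ4)
  have hs12 : ∀ j, (j < 7 ∨ 12 < j) ∧ j ≠ 5 ∧ j ≠ 14 → s2 j = s j := fun j hj =>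
    (hs2 j (by omega)).trans (hs1 j (by omega))
  have h25 := (hs2 5 (by norm_num)).trans h5
  refine Reaches.seq (Reaches.mono (Q := fun s' m' => (∀ j, j < 7 ∨ j = 13 ∨ 21 < j →
    s' j = s2 j) ∧ (∀ a < w, m' a = clearedRow v a) ∧
    ∃ n, s' 17 = (n : ℕ) ∧ Echelon w (b * w + 1) (tightSpan M v (i + 1)) n m')
    (Reaches.ite (by norm_num) hb14 (fun hne => ?_) fun heq => ?_) le_rfl ?_)
  · refine (Reaches.ofBlock [] ?_).mono (by simp) fun _ _ h => h
    rw [tightSpan_succ_of_ne M v hi (mt hzero.2 hne)]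
    exact ⟨fun _ _ => rfl, mS, n, (hs12 17 (by norm_num)).trans h17, hn.setRow_of_le le_rfl _⟩
  · have hel := hn.eliminating (clearedRow r) fun j hj => by
      have := hcl r (hM _) j hj
      change 2 * (clearedRow r j).natAbs ≤ 2 ^ (b * w + 1)
      rw [pow_succ]; omega
    rw [tightSpan_succ_of_eq M v hi (hzero.1 heq)] at hel
    refine (elimCmd_reaches ⟨(hs12 1 (by norm_num)).trans hc.r1,
      (hs12 2 (by norm_num)).trans hc.r2, (hs12 13 (by norm_num)).trans hc.r13,
      (hs12 22 (by norm_num)).trans hc.r22, (hs12 31 (by norm_num)).trans hc.r31⟩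
      ((hs12 17 (by norm_num)).trans h17) hel hβ2 hβ3).mono le_rfl ?_
    rintro s' m' ⟨hs', hm', hn'⟩
    exact ⟨fun j hj => hs' j (by omega), fun a ha => (hm' a ha).trans (mS a ha), hn'⟩
  · rintro s3 m3 ⟨hs3, hm3, hn3⟩
    have hs : ∀ j, (j < 7 ∨ j = 13 ∨ 21 < j) ∧ j ≠ 5 → s3 j = s j := fun j hj =>
      (hs3 j hj.1).trans (hs12 j (by omega))
    refine (Reaches.ofBlock [_] ?_).mono le_rfl fun _ _ h => h
    have e3 := (hs 3 (by norm_num)).trans h.r3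
    have e1 := (hs 1 (by norm_num)).trans hc.r1
    have hdd : 2 * w * (d + 2) = 2 * (w * d) + 4 * w := by ring
    have hwd : d ≤ w * d := Nat.le_mul_of_pos_left _ (by omega)
    simp only [blockPost, Ins.Ok, Ins.scalars, Ins.memory, Nat.reduceLT, true_and, e1, e3]
    refine ⟨⟨?_, ?_⟩, ⟨?_, ?_, ?_, ?_, ?_⟩, ?_, ?_, ?_, ?_, hm3, hn3⟩
    · unfold HasBits; omega
    · unfold HasBits; omega
    · exact (hs 1 (by norm_num)).trans hc.r1
    · exact (hs 2 (by norm_num)).trans hc.r2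
    · exact (hs 13 (by norm_num)).trans hc.r13
    · exact (hs 22 (by norm_num)).trans hc.r22
    · exact (hs 31 (by norm_num)).trans hc.r31
    · simp only [Function.update_self]; omega
    · exact (hs 4 (by norm_num)).trans h.r4
    · exact ((hs3 5 (by norm_num)).trans h25).trans (by rw [hw]; push_cast; ring)
    · exact (hs 6 (by norm_num)).trans h.r6

/-- On numbers of at most `b` bits the program outputs the answer of the redundancy test, within the
given number of bit operations. -/
theorem testCmd_outputs {d q : ℕ} (M : Matrix (Fin d) (Fin q ⊕ Unit) ℚ) (v : Fin q ⊕ Unit → ℚ)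
    (b : ℕ) (hd : d ≤ 2 ^ b)
    (hM : ∀ i j, (M i j).num.natAbs ≤ 2 ^ b ∧ (M i j).den ≤ 2 ^ b)
    (hv : ∀ j, (v j).num.natAbs ≤ 2 ^ b ∧ (v j).den ≤ 2 ^ b) :
    ∃ t ≤ testSteps d q * unitCost (testBits q b),
      Outputs testCmd (encodeInput M v) (redundancyTest M v) t := by
  suffices h : Reaches (encodeInput M v) (testBits q b) testCmd (testSteps d q) 0 0
      fun s _ => s 0 = if redundancyTest M v then 1 else 0 by
    obtain ⟨t, s, m, ht, hrun, hs⟩ := h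
    refine ⟨t, ht, glue s m, ?_, (glue_scalar s m (by norm_num)).trans hs⟩
    convert hrun using 1
    funext a
    simp [glue]
  obtain ⟨hβ1, hβ2, hβ3, hβ4, hβ5⟩ := testBits_spec q b d hd
  have hdd : 2 * (q + 1) * (d + 2) = 2 * ((q + 1) * d) + 4 * (q + 1) := by ring
  have hwd : d ≤ (q + 1) * d := Nat.le_mul_of_pos_left _ (by omega)
  have sm : ∀ z : ℤ, z.natAbs < 64 + (q + 1) → HasBits (testBits q b) z := fun z hz =>
    hz.trans (lt_of_le_of_lt (by omega) hβ2)
  refine (Reaches.seq (N₁ := 10) (N₂ := (q + 1) * 22 + 11 + (2 + ((d * ((q + 1) * 22 + 11 +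
    ((q + 1) * 9 + 6 + ((q + 1) * ((q + 1) * 18 + 25) + 6 + 1 + 2)) + 1) + 1) + (2 + 3)))) ?_).mono
    ?_ fun _ _ h => h
  · refine Reaches.ofBlock [_, _, _, _, _, _, _, _, _] ?_
    simp only [blockPost, Ins.Ok, Ins.scalars, Ins.memory, Function.update_apply,
      Nat.reduceEqDiff, reduceIte, Nat.reduceLT, true_and, Pi.zero_apply, Int.toNat_zero,
      Int.toNat_one, encodeInput_zero, encodeInput_one]
    refine ⟨sm _ (by omega), ⟨sm _ (by omega), ?_⟩, ⟨sm _ (by omega), sm _ (by omega)⟩,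
      ⟨sm _ (by omega), sm _ (by omega)⟩, sm _ (by omega), sm _ (by omega),
      ⟨sm _ (by omega), sm _ (by omega)⟩, sm _ (by omega), ⟨sm _ (by omega), sm _ (by omega)⟩, ?_⟩
    · unfold HasBits; omega
    refine Reaches.seq ((loadRowCmd_reaches (w := q + 1) (o := 0) (pos := 2) (b := b) ?_ ?_ ?_ ?_ ?_
      (numAt v) (denAt v) (fun j hj => by simpa using encodeInput_row M v 0 v (by simp) j hj)
      (fun j _ => natAbs_numAt_le (fun k => (hv k).1) j)
      (fun j _ => natAbs_denAt_le (fun k => (hv k).2) j) hβ1 (by omega) (by omega)).mono le_rfl ?_)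
    any_goals simp
    rintro s m hs h5 rfl
    refine Reaches.seq (Reaches.ofBlock [_] ?_)
    have e13 := hs 13 (by norm_num) (by norm_num)
    have e31 := hs 31 (by norm_num) (by norm_num)
    simp at e13 e31
    simp only [blockPost, Ins.Ok, Ins.scalars, Ins.memory, Nat.reduceLT, true_and, e13, e31,
      add_zero]
    refine ⟨⟨sm _ (by omega), sm _ (by omega)⟩, ?_⟩
    refine Reaches.seq ((Reaches.loop (a := 3) (by norm_num) (fun k s' m' => ∃ i, i + k = d ∧
      TestState M v (b * (q + 1) + 1) i s' m') ?_ ?_ d ?_).mono le_rfl ?_)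
    · rintro k s' m' ⟨i, hik, h⟩
      have := h.r3
      refine ⟨by omega, ?_⟩
      unfold HasBits; omega
    · rintro k s' m' ⟨i, hik, h⟩
      exact (testLoop_reaches hd (by omega) hM hv h).mono le_rfl fun _ _ h => ⟨i + 1, by omega, h⟩
    · refine ⟨0, by simp, ⟨?_, ?_, ?_, ?_, ?_⟩, ?_, ?_, ?_, ?_, fun a ha => ?_, 0, ?_, ?_⟩
      · simpa using hs 1 (by norm_num) (by norm_num)
      · simpa using hs 2 (by norm_num) (by norm_num)
      · simpa using e13
      · simpa using hs 22 (by norm_num) (by norm_num)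
      · simpa using e31
      · simpa using hs 3 (by norm_num) (by norm_num)
      · simpa using hs 4 (by norm_num) (by norm_num)
      · simpa using h5
      · simp
      · have := setRow_apply 0 0 (q + 1) (clearedEntry (numAt v) (denAt v) (q + 1)) ha
        rwa [zero_add] at this
      · simpa using hs 17 (by norm_num) (by norm_num)
      · have : tightSpan M v 0 = ⊥ := by
          rw [tightSpan, Submodule.span_eq_bot]
          rintro x ⟨l, hl, -⟩
          omega
        rw [this]
        exact Echelon.zero _ _ _ fun a ha => setRow_of_notMem _ _ _ _ (by omega)
    · rintro s' m' ⟨i, hid, h⟩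
      obtain rfl : i = d := by omega
      obtain ⟨n, h17, hn⟩ := h.echelon
      have hnw : n ≤ q + 1 := hn.card_eq ▸ (Finset.card_filter_le _ _).trans (by simp)
      have hrank := hn.finrank_eq
      rw [finrank_tightSpan] at hrank
      refine Reaches.seq (N₁ := 2) (N₂ := 3) ?_
      refine Reaches.ofBlock [_] ?_
      simp only [blockPost, Ins.Ok, Ins.scalars, Ins.memory, Nat.reduceLT, true_and, h17, h.r4]
      refine ⟨⟨sm _ (by omega), sm _ (by omega)⟩, ?_⟩
      refine Reaches.ite (by norm_num) (sm _ (by simp only [Function.update_self]; omega))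
        (fun hne => ?_) fun heq => ?_
      · simp only [Function.update_self] at hne
        refine Reaches.ofBlock [_] ⟨⟨by norm_num, sm _ (by omega)⟩, ?_⟩
        have : n ≠ q := by omega
        simp [redundancyTest, hrank, this, blockPost, Ins.scalars]
      · simp only [Function.update_self] at heq
        refine Reaches.ofBlock [_] ⟨⟨by norm_num, sm _ (by omega)⟩, ?_⟩
        have : n = q := by omega
        simp [redundancyTest, hrank, this, blockPost, Ins.scalars]
  · unfold testSteps
    nlinarith [Nat.zero_le (d * q ^ 2), Nat.zero_le (d * q), Nat.zero_le (q ^ 2)]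

/-! ### The estimate of the running time -/

theorem exists_unitCost_bound (ε : ℝ) (hε : 0 < ε) :
    ∃ C : ℝ, 0 ≤ C ∧ ∀ β : ℕ, (unitCost β : ℝ) ≤ C * ((β : ℝ) + 1) ^ (1 + ε) := by
  obtain ⟨C, hC, h⟩ := exists_opCost_bound ε hε
  refine ⟨2 + C, by positivity, fun β => ?_⟩
  obtain ⟨k, hk, hsup⟩ := Finset.exists_mem_eq_sup (Finset.range (β + 1)) ⟨0, by simp⟩
    fun k => opCost .add k + opCost .sub k + opCost .mul k
  have hkβ : (k : ℝ) ≤ β := by exact_mod_cast Nat.lt_succ_iff.1 (Finset.mem_range.1 hk)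
  have h1 : ((k : ℝ) + 1) ^ (1 + ε) ≤ ((β : ℝ) + 1) ^ (1 + ε) :=
    Real.rpow_le_rpow (by positivity) (by linarith) (by linarith)
  have h2 : (β : ℝ) + 1 ≤ ((β : ℝ) + 1) ^ (1 + ε) :=
    Real.self_le_rpow_of_one_le (by linarith [(Nat.cast_nonneg β : (0 : ℝ) ≤ β)]) (by linarith)
  have h3 := h k
  have h4 := mul_le_mul_of_nonneg_left h1 hC
  rw [unitCost, hsup]
  push_cast at h3 ⊢
  linarith [(Nat.cast_nonneg β : (0 : ℝ) ≤ β)]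

/-- The factorial of `⌊n / 2⌋` dominates every exponential function of `n`. -/
theorem exists_pow_div_factorial_half_le (R : ℝ) (hR : 1 ≤ R) :
    ∃ C : ℝ, 0 ≤ C ∧ ∀ n : ℕ, R ^ n / (n / 2).factorial ≤ C := by
  obtain ⟨C, hC⟩ := (FloorSemiring.tendsto_pow_div_factorial_atTop (R ^ 2)).bddAbove_range
  have hC' : ∀ k : ℕ, (R ^ 2) ^ k / k.factorial ≤ C := fun k => hC ⟨k, rfl⟩
  have hC0 : 0 ≤ C := le_trans (by positivity) (hC' 0)
  refine ⟨R * C, by positivity, fun n => ?_⟩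
  have h1 : R ^ n ≤ R * (R ^ 2) ^ (n / 2) := by
    rw [← pow_mul, ← pow_succ']
    exact pow_le_pow_right₀ hR (by omega)
  calc R ^ n / (n / 2).factorial ≤ R * (R ^ 2) ^ (n / 2) / (n / 2).factorial := by gcongr
    _ = R * ((R ^ 2) ^ (n / 2) / (n / 2).factorial) := by ring
    _ ≤ R * C := by gcongr; exact hC' _

theorem choose_half_le {m n : ℕ} (hm : 1 ≤ m) :
    ((m + 1).choose (n / 2) : ℝ) ≤
      2 ^ n / (n / 2).factorial * (m : ℝ) ^ ((n : ℝ) / 2) := by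
  have hm' : (1 : ℝ) ≤ m := by exact_mod_cast hm
  have h1 : ((m + 1 : ℕ) : ℝ) ≤ 2 * m := by push_cast; linarith
  have h2 : (m : ℝ) ^ (n / 2) ≤ (m : ℝ) ^ ((n : ℝ) / 2) := by
    rw [← Real.rpow_natCast]
    exact Real.rpow_le_rpow_of_exponent_le hm' Nat.cast_div_le
  calc ((m + 1).choose (n / 2) : ℝ) ≤ ((m + 1 : ℕ) : ℝ) ^ (n / 2) / (n / 2).factorial :=
        Nat.choose_le_pow_div _ _
    _ ≤ (2 * m) ^ (n / 2) / (n / 2).factorial := by gcongr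
    _ = 2 ^ (n / 2) / (n / 2).factorial * (m : ℝ) ^ (n / 2) := by rw [mul_pow]; ring
    _ ≤ 2 ^ n / (n / 2).factorial * (m : ℝ) ^ ((n : ℝ) / 2) := by
      gcongr
      · norm_num
      · exact Nat.div_le_self _ _

theorem natCast_le_two_pow (n : ℕ) : (n : ℝ) ≤ 2 ^ n := by exact_mod_cast Nat.lt_two_pow_self.le

theorem testBits_succ_le {ε K h : ℝ} (hε : 0 < ε) (hK : 1 ≤ K) (hh : 1 ≤ h) {n q b : ℕ}
    (hn : 1 ≤ n) (hq : q ≤ n) (hb : (b : ℝ) ≤ K * (n : ℝ) ^ (3 + ε) * h) :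
    (testBits q b : ℝ) + 1 ≤ 97 * K * (4 * 2 ^ (3 + ε)) ^ n * h := by
  have hn' : (1 : ℝ) ≤ n := by exact_mod_cast hn
  have hq' : (q : ℝ) ≤ n := by exact_mod_cast hq
  set B := K * (n : ℝ) ^ (3 + ε) * h with hB
  have hpow : 1 ≤ (n : ℝ) ^ (3 + ε) := Real.one_le_rpow hn' (by linarith)
  have hB1 : 1 ≤ B := one_le_mul_of_one_le_of_one_le (one_le_mul_of_one_le_of_one_le hK hpow) hh
  have h2n := natCast_le_two_pow n
  have h1 : (2 : ℝ) ^ (q + 5) ≤ 32 * 2 ^ n := by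
    rw [pow_add, mul_comm]; norm_num
    exact pow_le_pow_right₀ (by norm_num) hq
  have h2 : (b : ℝ) * (q + 1) + 1 ≤ 3 * n * B := by
    have : (b : ℝ) * (q + 1) ≤ B * (2 * n) := by gcongr; linarith
    nlinarith
  have h3 : (n : ℝ) ^ (3 + ε) ≤ (2 ^ (3 + ε)) ^ n := by
    rw [← Real.rpow_natCast (2 ^ (3 + ε)), ← Real.rpow_mul (by norm_num), mul_comm (3 + ε),
      Real.rpow_mul (by norm_num), Real.rpow_natCast]
    exact Real.rpow_le_rpow (by positivity) h2n (by linarith)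
  have h4 : (1 : ℝ) ≤ 2 ^ n * n * B :=
    one_le_mul_of_one_le_of_one_le (one_le_mul_of_one_le_of_one_le (hn'.trans h2n) hn') hB1
  calc (testBits q b : ℝ) + 1 = 2 ^ (q + 5) * (b * (q + 1) + 1) + 1 := by
        rw [testBits]; push_cast; ring
    _ ≤ 32 * 2 ^ n * (3 * n * B) + 2 ^ n * n * B := by gcongr
    _ = 97 * K * (2 ^ n * n * (n : ℝ) ^ (3 + ε)) * h := by rw [hB]; ring
    _ ≤ 97 * K * (2 ^ n * 2 ^ n * (2 ^ (3 + ε)) ^ n) * h := by gcongr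
    _ = 97 * K * (4 * 2 ^ (3 + ε)) ^ n * h := by
      rw [mul_pow, show (4 : ℝ) = 2 * 2 by norm_num, mul_pow]

theorem testSteps_le {m n d q : ℕ} (hm : 1 ≤ m) (hnm : n ≤ m) (hn : 1 ≤ n) (hq : q ≤ n)
    (hd : d ≤ 2 * (m + 1).choose (n / 2)) :
    (testSteps d q : ℝ) ≤
      2700 * (8 ^ n / (n / 2).factorial) * (m : ℝ) ^ ((n : ℝ) / 2) := by
  have hn' : (1 : ℝ) ≤ n := by exact_mod_cast hn
  have hq' : (q : ℝ) ≤ n := by exact_mod_cast hq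
  have h2n := natCast_le_two_pow n
  have hpos : 1 ≤ (m + 1).choose (n / 2) := Nat.choose_pos (by omega)
  have h1 : (d : ℝ) + 1 ≤ 3 * (m + 1).choose (n / 2) := by
    exact_mod_cast (by omega : d + 1 ≤ 3 * (m + 1).choose (n / 2))
  calc (testSteps d q : ℝ) = 100 * (d + 1) * (q + 2) ^ 2 := by rw [testSteps]; push_cast; ring
    _ ≤ 100 * (3 * (m + 1).choose (n / 2)) * (3 * 2 ^ n) ^ 2 := by gcongr; linarith
    _ = 2700 * (2 ^ n * 2 ^ n) * (m + 1).choose (n / 2) := by ring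
    _ ≤ 2700 * (2 ^ n * 2 ^ n) *
        (2 ^ n / (n / 2).factorial * (m : ℝ) ^ ((n : ℝ) / 2)) := by
      gcongr; exact choose_half_le hm
    _ = 2700 * (8 ^ n / (n / 2).factorial) * (m : ℝ) ^ ((n : ℝ) / 2) := by
      rw [show (8 : ℝ) = 2 * 2 * 2 by norm_num, mul_pow, mul_pow]; ring

/-- The running time on matrices with at most `2 * (m + 1).choose (n / 2)` rows and entries of
polynomially many bits. -/
theorem exists_time_bound (ε K : ℝ) (hε : 0 < ε) (hK : 1 ≤ K) :
    ∃ C : ℝ, 0 ≤ C ∧ ∀ (m n d q b : ℕ) (h : ℝ), 1 ≤ n → n ≤ m → q ≤ n → 1 ≤ h →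
      d ≤ 2 * (m + 1).choose (n / 2) → (b : ℝ) ≤ K * (n : ℝ) ^ (3 + ε) * h →
      ((testSteps d q * unitCost (testBits q b) : ℕ) : ℝ) ≤
        C * (m : ℝ) ^ ((n : ℝ) / 2) * h ^ (1 + ε) := by
  obtain ⟨C₀, hC₀, hU⟩ := exists_unitCost_bound ε hε
  set S : ℝ := (4 * 2 ^ (3 + ε)) ^ (1 + ε) with hS
  have hS1 : 1 ≤ S := by
    refine Real.one_le_rpow ?_ (by linarith)
    have : (1 : ℝ) ≤ 2 ^ (3 + ε) := Real.one_le_rpow (by norm_num) (by linarith)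
    linarith
  obtain ⟨C₁, hC₁, hF⟩ := exists_pow_div_factorial_half_le (8 * S) (by linarith)
  refine ⟨2700 * C₀ * (97 * K) ^ (1 + ε) * C₁, by positivity,
    fun m n d q b h hn hnm hq hh hd hb => ?_⟩
  have h1 : (unitCost (testBits q b) : ℝ) ≤ C₀ * ((97 * K) ^ (1 + ε) * S ^ n * h ^ (1 + ε)) := by
    refine (hU _).trans (mul_le_mul_of_nonneg_left ?_ hC₀)
    refine (Real.rpow_le_rpow (by positivity) (testBits_succ_le hε hK hh hn hq hb)
      (by linarith)).trans_eq ?_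
    rw [Real.mul_rpow (by positivity) (by positivity), Real.mul_rpow (by positivity) (by positivity),
      hS, ← Real.rpow_natCast, ← Real.rpow_natCast, ← Real.rpow_mul (by positivity),
      ← Real.rpow_mul (by positivity), mul_comm (n : ℝ)]
  push_cast
  calc (testSteps d q : ℝ) * unitCost (testBits q b)
      ≤ (2700 * (8 ^ n / (n / 2).factorial) * (m : ℝ) ^ ((n : ℝ) / 2)) *
          (C₀ * ((97 * K) ^ (1 + ε) * S ^ n * h ^ (1 + ε))) := by
        gcongr; exact testSteps_le (by omega) hnm hn hq hd
    _ = 2700 * C₀ * (97 * K) ^ (1 + ε) * ((8 * S) ^ n / (n / 2).factorial) *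
          (m : ℝ) ^ ((n : ℝ) / 2) * h ^ (1 + ε) := by rw [mul_pow]; ring
    _ ≤ 2700 * C₀ * (97 * K) ^ (1 + ε) * C₁ * (m : ℝ) ^ ((n : ℝ) / 2) * h ^ (1 + ε) := by
        gcongr; exact hF n

/-! ### Heights -/

theorem natAbs_le_exp_of_ratHeight_le {x : ℚ} {H : ℝ} (h : ratHeight x ≤ H) :
    (x.num.natAbs : ℝ) ≤ Real.exp H ∧ (x.den : ℝ) ≤ Real.exp H := by
  have hpos : (0 : ℝ) < (max x.num.natAbs x.den : ℕ) := by
    exact_mod_cast lt_of_lt_of_le x.den_pos (le_max_right _ _)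
  have h1 := (Real.log_le_iff_le_exp hpos).1 h
  exact ⟨le_trans (by exact_mod_cast le_max_left _ _) h1,
    le_trans (by exact_mod_cast le_max_right _ _) h1⟩

theorem natAbs_lt_two_pow_of_ratHeight_le {x : ℚ} {H : ℝ} (h : ratHeight x ≤ H) :
    x.num.natAbs < 2 ^ (⌈2 * H⌉₊ + 1) ∧ x.den < 2 ^ (⌈2 * H⌉₊ + 1) := by
  have h1 : Real.exp H ≤ 2 ^ ⌈2 * H⌉₊ := by
    have h2 : (1 : ℝ) ≤ 2 * Real.log 2 := by linarith [Real.log_two_gt_d9]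
    rw [← Real.exp_log (show (0 : ℝ) < 2 ^ ⌈2 * H⌉₊ by positivity), Real.log_pow]
    refine Real.exp_le_exp.2 ?_
    have h3 : 2 * H ≤ ⌈2 * H⌉₊ := Nat.le_ceil _
    have h4 : (0 : ℝ) ≤ ⌈2 * H⌉₊ := Nat.cast_nonneg _
    nlinarith
  obtain ⟨h2, h3⟩ := natAbs_le_exp_of_ratHeight_le h
  have h4 : 2 ^ ⌈2 * H⌉₊ < 2 ^ (⌈2 * H⌉₊ + 1) := Nat.pow_lt_pow_right (by norm_num) (by omega)
  exact ⟨lt_of_le_of_lt (by exact_mod_cast h2.trans h1) h4,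
    lt_of_le_of_lt (by exact_mod_cast h3.trans h1) h4⟩

/-- The entries of primitive rows have polynomial height, by Cramer's rule and the Leibniz
bound for determinants. -/
theorem ratHeight_le_of_isPrimitiveRow {m n : ℕ} (hn : 1 ≤ n) {A : Matrix (Fin m) (Fin n) ℚ}
    {c : Fin m → ℚ} {h : ℝ} (hh : 1 ≤ h) (hA : ∀ i j, ratHeight (A i j) ≤ h)
    (hc : ∀ i, ratHeight (c i) ≤ h) {r : Fin n ⊕ Unit → ℚ} (hr : IsPrimitiveRow r)
    (hex : IsExtremeRay (ineqCone (homMatrix A c)) r) (j : Fin n ⊕ Unit) :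
    ratHeight (r j) ≤ 8 * (n : ℝ) ^ 2 * h := by
  obtain ⟨z, hz, hgcd⟩ := hr
  obtain rfl : r = fun j => (z j : ℚ) := funext hz
  set P := ⌊Real.exp h⌋₊ with hP
  have hP1 : 1 ≤ P := Nat.le_floor (by simpa using Real.one_le_exp (by linarith))
  have hPh : (P : ℝ) ≤ Real.exp h := Nat.floor_le (Real.exp_pos h).le
  have hx : ∀ x : ℚ, ratHeight x ≤ h → x.num.natAbs ≤ P ∧ x.den ≤ P := fun x hx =>
    ⟨Nat.le_floor (natAbs_le_exp_of_ratHeight_le hx).1,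
      Nat.le_floor (natAbs_le_exp_of_ratHeight_le hx).2⟩
  have hG : ∀ i j, (homMatrix A c i j).num.natAbs ≤ P ∧ (homMatrix A c i j).den ≤ P := by
    rintro (i | i) (j | j)
    · exact hx _ (hA i j)
    · exact hx _ (hc i)
    · simpa [homMatrix] using hP1
    · simpa [homMatrix] using hP1
  have h1 := natAbs_le_of_isExtremeRay (homMatrix A c) P hP1 hG z hgcd hex j
  have hD : 1 ≤ (n + 1).factorial * (P ^ (n + 2)) ^ (n + 1) :=
    Nat.mul_pos (Nat.factorial_pos _) (by positivity)
  have h2 : max (z j : ℚ).num.natAbs (z j : ℚ).den ≤ (n + 1).factorial * (P ^ (n + 2)) ^ (n + 1) :=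
    max_le (by simpa using h1) (by simpa using hD)
  have hn' : (1 : ℝ) ≤ n := by exact_mod_cast hn
  have hlogP : Real.log P ≤ h := (Real.log_le_iff_le_exp (by exact_mod_cast hP1)).2 hPh
  have hfac : Real.log (n + 1).factorial ≤ (n + 1) * n := by
    calc Real.log (n + 1).factorial ≤ Real.log (((n + 1 : ℕ) : ℝ) ^ (n + 1)) :=
          Real.log_le_log (by exact_mod_cast Nat.factorial_pos _)
            (by exact_mod_cast Nat.factorial_le_pow _)
      _ = (n + 1) * Real.log ((n + 1 : ℕ) : ℝ) := by rw [Real.log_pow]; push_cast; ring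
      _ ≤ (n + 1) * n := by
        gcongr
        have := Real.log_le_sub_one_of_pos (show (0 : ℝ) < ((n + 1 : ℕ) : ℝ) by positivity)
        push_cast at this ⊢
        linarith
  calc ratHeight (z j : ℚ)
      ≤ Real.log (((n + 1).factorial * (P ^ (n + 2)) ^ (n + 1) : ℕ) : ℝ) :=
        Real.log_le_log (Nat.cast_pos.2 (lt_of_lt_of_le (Rat.den_pos _) (le_max_right _ _)))
          (by exact_mod_cast h2)
    _ = Real.log (n + 1).factorial + (n + 1) * ((n + 2) * Real.log P) := by
        have hP0 : (P : ℝ) ≠ 0 := by positivity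
        push_cast
        rw [Real.log_mul (by positivity) (by positivity), Real.log_pow, Real.log_pow]
        push_cast; ring
    _ ≤ (n + 1) * n + (n + 1) * ((n + 2) * h) := by gcongr
    _ ≤ 2 * n * n * h + 2 * n * (3 * n * h) := by
        have e1 : ((n : ℝ) + 1) * n ≤ 2 * n * n := by gcongr; linarith
        have e2 : 2 * (n : ℝ) * n ≤ 2 * n * n * h := le_mul_of_one_le_right (by positivity) hh
        refine add_le_add (e1.trans e2) ?_
        gcongr <;> linarith
    _ = 8 * (n : ℝ) ^ 2 * h := by ring

/-- A bit bound for the numbers of height at most `K * n ^ (2 + ε) * h`, large enough also for the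
number of rows of a matrix with such entries and `n + 1` columns. -/
theorem rowBits_le {ε K h : ℝ} (hε : 0 < ε) (hK : 1 ≤ K) (hh : 1 ≤ h) {n : ℕ} (hn : 1 ≤ n) :
    (((2 * (⌈2 * (K * (n : ℝ) ^ (2 + ε) * h)⌉₊ + 1) + 1) * (n + 1) : ℕ) : ℝ) ≤
      18 * K * (n : ℝ) ^ (3 + ε) * h := by
  have hn' : (1 : ℝ) ≤ n := by exact_mod_cast hn
  set H := K * (n : ℝ) ^ (2 + ε) * h with hH
  have hpow : 1 ≤ (n : ℝ) ^ (2 + ε) := Real.one_le_rpow hn' (by linarith)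
  have hH1 : 1 ≤ H := one_le_mul_of_one_le_of_one_le (one_le_mul_of_one_le_of_one_le hK hpow) hh
  have h1 : (⌈2 * H⌉₊ : ℝ) ≤ 2 * H + 1 := (Nat.ceil_lt_add_one (by linarith)).le
  have h2 : (n : ℝ) ^ (3 + ε) = n ^ (2 + ε) * n := by
    rw [show 3 + ε = 2 + ε + 1 by ring, Real.rpow_add_one (by positivity)]
  push_cast
  calc (2 * ((⌈2 * H⌉₊ : ℝ) + 1) + 1) * (n + 1) ≤ (9 * H) * (2 * n) := by
        gcongr <;> linarith
    _ = 18 * K * (n : ℝ) ^ (3 + ε) * h := by rw [h2, hH]; ring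

theorem linAlgExponent_nonneg : 0 ≤ linAlgExponent := Real.sInf_nonneg fun _ h => h.1.le

/-- The size of a coefficient matrix of the initial redundancy test cone: the number of its rows,
and the number of bits that suffices for this number and for the entries. -/
theorem IsInitialTestMatrix.size_le {m n d : ℕ} {hn : n ≤ m} {A : Matrix (Fin m) (Fin n) ℚ}
    {c : Fin m → ℚ} {M : Matrix (Fin d) (Fin n ⊕ Unit) ℚ} {ε K h : ℝ} (hε : 0 < ε) (hK : 8 ≤ K)
    (hn1 : 1 ≤ n) (hA : LinearIndependent ℚ (fun i : Fin n => A (Fin.castLE hn i))) (hh : 1 ≤ h)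
    (hAh : ∀ i j, ratHeight (A i j) ≤ h) (hch : ∀ i, ratHeight (c i) ≤ h)
    (hM : IsInitialTestMatrix hn A c M)
    (hMh : (∀ i, IsPrimitiveRow (M i)) ∨ ∀ i j, ratHeight (M i j) ≤ K * (n : ℝ) ^ (2 + ε) * h) :
    d ≤ 2 * (m + 1).choose (n / 2) ∧ ∃ b : ℕ, (b : ℝ) ≤ 18 * K * (n : ℝ) ^ (3 + ε) * h ∧
      d ≤ 2 ^ b ∧ (∀ i j, (M i j).num.natAbs ≤ 2 ^ b ∧ (M i j).den ≤ 2 ^ b) ∧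
      ∀ x : ℚ, ratHeight x ≤ K * (n : ℝ) ^ (2 + ε) * h → x.num.natAbs ≤ 2 ^ b ∧ x.den ≤ 2 ^ b := by
  obtain ⟨hrays, hinj, -⟩ := hM.rows hA
  have hn' : (1 : ℝ) ≤ n := by exact_mod_cast hn1
  have hM' : ∀ i j, ratHeight (M i j) ≤ K * (n : ℝ) ^ (2 + ε) * h := by
    rcases hMh with hprim | hb
    · refine fun i j =>
        (ratHeight_le_of_isPrimitiveRow hn1 hh hAh hch (hprim i) (hrays i) j).trans ?_
      gcongr
      rw [← Real.rpow_natCast]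
      exact Real.rpow_le_rpow_of_exponent_le hn' (by push_cast; linarith)
    · exact hb
  set b₀ := ⌈2 * (K * (n : ℝ) ^ (2 + ε) * h)⌉₊ + 1 with hb₀
  set b := (2 * b₀ + 1) * (n + 1) with hb
  have hx : ∀ x : ℚ, ratHeight x ≤ K * (n : ℝ) ^ (2 + ε) * h →
      x.num.natAbs < 2 ^ b₀ ∧ x.den < 2 ^ b₀ := fun x hx => natAbs_lt_two_pow_of_ratHeight_le hx
  have hbb : 2 ^ b₀ ≤ 2 ^ b := Nat.pow_le_pow_right (by norm_num) (by rw [hb]; nlinarith)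
  refine ⟨?_, b, rowBits_le hε (by linarith) hh hn1, ?_, fun i j => ?_, fun x h' => ?_⟩
  · simpa using card_extremeRays_le (homMatrix A c) n (by simp) (homMatrix_injective hn A c hA)
      (fun i => M i) hrays hinj
  · simpa [hb] using card_le_of_bits (fun i => M i)
      (fun i j hij => hinj i j 1 one_pos (by simpa using hij)) fun i j => hx _ (hM' i j)
  · exact ⟨(hx _ (hM' i j)).1.le.trans hbb, (hx _ (hM' i j)).2.le.trans hbb⟩
  · exact ⟨(hx x h').1.le.trans hbb, (hx x h').2.le.trans hbb⟩

/-- The bit complexity of the redundancy test on the coefficient matrices of test cones. -/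
theorem exists_testCmd_time_bound (ε : ℝ) (hε : 0 < ε) (K : ℝ) : ∃ C : ℝ,
    ∀ (m p q : ℕ) (hn : p + q ≤ m)
      (A : Matrix (Fin m) (Fin (p + q)) ℚ) (c : Fin m → ℚ) (h : ℝ)
      (d : ℕ) (M : Matrix (Fin d) (Fin (p + q) ⊕ Unit) ℚ) (s : Fin q ⊕ Unit → ℚ),
      1 ≤ p + q →
      LinearIndependent ℚ (fun i : Fin (p + q) => A (Fin.castLE hn i)) →
      1 ≤ h → (∀ i j, ratHeight (A i j) ≤ h) → (∀ i, ratHeight (c i) ≤ h) →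
      IsInitialTestMatrix hn A c M →
      ((∀ i, IsPrimitiveRow (M i)) ∨
        ∀ i j, ratHeight (M i j) ≤ K * ((p + q : ℕ) : ℝ) ^ (2 + ε) * h) →
      (∀ j, ratHeight (s j) ≤ K * ((p + q : ℕ) : ℝ) ^ (2 + ε) * h) →
        ∃ t : ℕ, Outputs testCmd (encodeInput (dropColumns p q M) s)
            (redundancyTest (dropColumns p q M) s) t ∧
          (t : ℝ) ≤ C * (m : ℝ) ^ (((p + q : ℕ) : ℝ) / 2) *
            ((p + q : ℕ) : ℝ) ^ (linAlgExponent + ε) * h ^ (1 + ε) := by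
  -- primitive rows have height at most `8 * n ^ 2 * h`
  obtain ⟨C, hC, hT⟩ := exists_time_bound ε (18 * max K 8) hε
    (by linarith [le_max_right K 8])
  refine ⟨C, fun m p q hn A c h d M s hpq hA hh hAh hch hM hMh hsh => ?_⟩
  have hKK : ∀ x : ℝ, x ≤ K * ((p + q : ℕ) : ℝ) ^ (2 + ε) * h →
      x ≤ max K 8 * ((p + q : ℕ) : ℝ) ^ (2 + ε) * h :=
    fun x hx => hx.trans (by gcongr; exact le_max_left _ _)
  obtain ⟨hdc, b, hb, hdb, hMb, hxb⟩ := hM.size_le hε (le_max_right K 8) hpq hA hh hAh hch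
    (hMh.imp_right fun hMh i j => hKK _ (hMh i j))
  obtain ⟨t, ht, hout⟩ := testCmd_outputs (dropColumns p q M) s b hdb (fun i j => hMb i _)
    (fun j => hxb _ (hKK _ (hsh j)))
  refine ⟨t, hout, le_trans (by exact_mod_cast ht)
    ((hT m (p + q) d q b h hpq hn (by omega) hh hdc hb).trans ?_)⟩
  have hexp : 1 ≤ ((p + q : ℕ) : ℝ) ^ (linAlgExponent + ε) :=
    Real.one_le_rpow (by exact_mod_cast hpq) (by linarith [linAlgExponent_nonneg])
  have hX : 0 ≤ C * (m : ℝ) ^ (((p + q : ℕ) : ℝ) / 2) := by positivity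
  have := le_mul_of_one_le_right hX hexp
  gcongr

/-- Every input consists of numbers of a bounded number of bits. -/
theorem exists_testCmd_outputs {d q : ℕ} (M : Matrix (Fin d) (Fin q ⊕ Unit) ℚ)
    (s : Fin q ⊕ Unit → ℚ) :
    ∃ t, Outputs testCmd (encodeInput M s) (redundancyTest M s) t := by
  set b := d + (∑ i, ∑ j, ((M i j).num.natAbs + (M i j).den)) +
    ∑ j, ((s j).num.natAbs + (s j).den) with hb
  have h2 : b ≤ 2 ^ b := Nat.lt_two_pow_self.le
  have hM : ∀ i j, (M i j).num.natAbs + (M i j).den ≤ b := fun i j => by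
    have h3 := Finset.single_le_sum (f := fun j => (M i j).num.natAbs + (M i j).den)
      (fun _ _ => Nat.zero_le _) (Finset.mem_univ j)
    have h4 := Finset.single_le_sum (f := fun i => ∑ j, ((M i j).num.natAbs + (M i j).den))
      (fun _ _ => Nat.zero_le _) (Finset.mem_univ i)
    beta_reduce at h3 h4
    omega
  have hs : ∀ j, (s j).num.natAbs + (s j).den ≤ b := fun j => by
    have h3 := Finset.single_le_sum (f := fun j => (s j).num.natAbs + (s j).den)
      (fun _ _ => Nat.zero_le _) (Finset.mem_univ j)
    beta_reduce at h3
    omega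
  obtain ⟨t, -, h⟩ := testCmd_outputs M s b (by omega)
    (fun i j => by have := hM i j; constructor <;> omega)
    (fun j => by have := hs j; constructor <;> omega)
  exact ⟨t, h⟩

theorem mainTheorem7 :
    -- correctness of the rank test for every pointed polyhedral cone
    (∀ (d q : ℕ) (M : Matrix (Fin d) (Fin q ⊕ Unit) ℚ) (s : Fin q ⊕ Unit → ℚ),
      (∀ x, M *ᵥ x = 0 → x = 0) → (∀ i, (M *ᵥ s) i ≤ 0) →
        (redundancyTest M s = false ↔ IsExtremeRay {x | ∀ i, (M *ᵥ x) i ≤ 0} s)) ∧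
    ∃ prog : Cmd,
      -- the program performs the test on every input
      (∀ (d q : ℕ) (M : Matrix (Fin d) (Fin q ⊕ Unit) ℚ) (s : Fin q ⊕ Unit → ℚ),
        ∃ t : ℕ, Outputs prog (encodeInput M s) (redundancyTest M s) t) ∧
      -- test cones: correctness and bit complexity
      ∀ ε : ℝ, 0 < ε → ∀ K : ℝ, ∃ C : ℝ,
        ∀ (m p q : ℕ) (hn : p + q ≤ m) (hq : q ≤ m)
          (A : Matrix (Fin m) (Fin (p + q)) ℚ) (c : Fin m → ℚ) (h : ℝ)
          (d : ℕ) (M : Matrix (Fin d) (Fin (p + q) ⊕ Unit) ℚ) (s : Fin q ⊕ Unit → ℚ),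
          1 ≤ p + q →
          LinearIndependent ℚ (fun i : Fin (p + q) => A (Fin.castLE hn i)) →
          LinearIndependent ℚ
            (fun i : Fin q => A.submatrix id (Fin.natAdd p) (Fin.castLE hq i)) →
          FullDimensional (polyhedron A c) →
          1 ≤ h → (∀ i j, ratHeight (A i j) ≤ h) → (∀ i, ratHeight (c i) ≤ h) →
          IsInitialTestMatrix hn A c M →
          ((∀ i, IsPrimitiveRow (M i)) ∨
            ∀ i j, ratHeight (M i j) ≤ K * ((p + q : ℕ) : ℝ) ^ (2 + ε) * h) →
          (s ∈ testCone hq (A.submatrix id (Fin.castAdd q)) (A.submatrix id (Fin.natAdd p)) c →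
            (redundancyTest (dropColumns p q M) s = false ↔
              IsExtremeRay (testCone hq (A.submatrix id (Fin.castAdd q))
                (A.submatrix id (Fin.natAdd p)) c) s)) ∧
          ((∀ j, ratHeight (s j) ≤ K * ((p + q : ℕ) : ℝ) ^ (2 + ε) * h) →
            ∃ t : ℕ, Outputs prog (encodeInput (dropColumns p q M) s)
                (redundancyTest (dropColumns p q M) s) t ∧
              (t : ℝ) ≤ C * (m : ℝ) ^ (((p + q : ℕ) : ℝ) / 2) *
                ((p + q : ℕ) : ℝ) ^ (linAlgExponent + ε) * h ^ (1 + ε)) := by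
  refine ⟨fun d q M s => redundancyTest_eq_false_iff M s, testCmd,
    fun d q M s => exists_testCmd_outputs M s, fun ε hε K => ?_⟩
  obtain ⟨C, hC⟩ := exists_testCmd_time_bound ε hε K
  refine ⟨C, fun m p q hn hq A c h d M s hpq hA hB hQ hh hAh hch hM hMh => ⟨fun hs => ?_, fun hs => ?_⟩⟩
  · exact redundancyTest_dropColumns_iff hn hq A c M hA hB hQ hM s hs
  · exact hC m p q hn A c h d M s hpq hA hh hAh hch hM hMh hs
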